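/- Let $D=\mathbb R^2$ or $D=\mathbb R\times\mathbb T$, where $\mathbb T=\mathbb R/\mathbb Z$, and let $u:D\to\mathbb R^2$ be Lipschitz, divergence-free in the sense of distributions, and periodic with some period in each coordinate direction. For an amplitude $A\in\mathbb R$ and $1\le p<\infty$ let $\mathcal P_\tau(Au)$ be the solution operator $\phi_0\mapsto\phi(\cdot,\tau)$ on $L^p(D)$ of $$\phi_t+Au\cdot\nabla\phi=\Delta\phi,\qquad \phi(\cdot,0)=\phi_0 ,$$ and assume that $u$ is dissipation-enhancing on $D$, that is, for all $1\le p<q\le\infty$ and all $\tau>0$, $$\|\mathcal P_\tau(Au)\|_{L^p(D)\to L^q(D)}\to0\qquad\text{as }A\to\infty .$$ Let $f$ be Lipschitz continuous on $[0,1]$ with $f(0)=f(1)=0$, and suppose that $f(s)\le c\,s^{\alpha}$ for all $s\in[0,1]$, where $c>0$, and $\alpha>2$ if $D=\mathbb R^2$, respectively $\alpha>3$ if $D=\mathbb R\times\mathbb T$. Then for each $M$ there is $A_0(M)$ such that for every $A>A_0(M)$ and every measurable $T_0:D\to[0,1]$ with $\|T_0\|_{L^1(D)}\le M$, the $[0,1]$-valued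 solution $T$ of $$T_t+Au\cdot\nabla T=\Delta T+f(T),\qquad T(\cdot,0)=T_0,$$ is quenched: $\|T(\cdot,t)\|_{L^\infty(D)}\to0$ as $t\to\infty$. Here solutions are understood in the weak sense: with $g=0$, $w=\phi$, $w_0=\phi_0$ (respectively $g=f$, $w=T$, $w_0=T_0$), $w$ is jointly measurable, is bounded in $L^p(D)$ on bounded time intervals (respectively takes values in $[0,1]$), and for all $t\ge0$ and all $\psi\in C_c^\infty(D)$, $$\int_D w(t)\psi=\int_D w_0\psi+\int_0^t\!\int_D\big(w(s)(\Delta\psi+Au\cdot\nabla\psi)+g(w(s))\psi\big)\,dx\,ds .$$ -/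

import Mathlib

open MeasureTheory Set Filter Topology
open scoped ENNReal NNReal ContDiff

noncomputable section

namespace FlowQuenching

/-- The Euclidean plane. Functions on the strip `ℝ × 𝕋`, where `𝕋 = ℝ / ℤ`, are represented by
their lifts to the plane, i.e. by functions that are `1`-periodic in the second coordinate. -/
abbrev Plane : Type := EuclideanSpace ℝ (Fin 2)

/-- The two spatial domains: the plane `ℝ²` and the periodic strip `ℝ × 𝕋`. -/
inductive Domain : Type
  | plane : Domain
  | strip : Domain

namespace Domain

/-- `g` is (the lift of) a function on the domain. -/
def IsFun {β : Type*} (D : Domain) (g : Plane → β) : Prop :=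
  match D with
  | plane => True
  | strip => ∀ x : Plane, g (x + EuclideanSpace.single 1 1) = g x

/-- Lebesgue measure of the domain. For the strip it is carried by the fundamental domain
`ℝ × [0, 1)`, so that for a lift `g` the number `eLpNorm g p D.measure` is the norm of `g` in
`L^p(ℝ × 𝕋)`. -/
def measure (D : Domain) : Measure Plane :=
  match D with
  | plane => volume
  | strip => volume.restrict {x : Plane | x 1 ∈ Ico (0 : ℝ) 1}

/-- The exponent that the order of vanishing of the reaction has to exceed. -/
def criticalExponent (D : Domain) : ℝ :=
  match D with
  | plane => 2
  | strip => 3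

end Domain

/-- Real-valued smooth compactly supported functions on the plane. -/
def IsTest (ψ : Plane → ℝ) : Prop := ContDiff ℝ ∞ ψ ∧ HasCompactSupport ψ

/-- `∇ · u = 0` in the sense of distributions. -/
def Incompressible (u : Plane → Plane) : Prop :=
  ∀ ψ : Plane → ℝ, IsTest ψ → ∫ x, fderiv ℝ ψ x (u x) = 0

/-- `u` is a periodic (with some period in each coordinate direction), incompressible, Lipschitz
flow on the domain `D`. -/
structure IsFlow (D : Domain) (u : Plane → Plane) : Prop where
  isFun : D.IsFun u
  periodic : ∃ L : Fin 2 → ℝ, (∀ i, 0 < L i) ∧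
    ∀ i x, u (x + EuclideanSpace.single i (L i)) = u x
  incompressible : Incompressible u
  lipschitz : ∃ K : ℝ≥0, LipschitzWith K u

/-- `φ` is a weak solution on `D × [0, ∞)` of
`φ_t + v · ∇φ = Δφ + g(φ)`, `φ(·, 0) = φ₀`, where `v` is incompressible: for each time `t ≥ 0` and
each test function `ψ`,
`∫ φ(t) ψ = ∫ φ₀ ψ + ∫₀ᵗ ∫ (φ (Δψ + v · ∇ψ) + g(φ) ψ)`.
The first argument of `φ` is time (negative times play no role), and `fderiv ℝ ψ x (v x)` is
`v · ∇ψ` at `x`. Each solution notion below adds the bounds which make these integrals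
convergent. -/
structure IsWeakSolution (D : Domain) (v : Plane → Plane) (g : ℝ → ℝ) (φ₀ : Plane → ℝ)
    (φ : ℝ → Plane → ℝ) : Prop where
  measurable : Measurable (Function.uncurry φ)
  isFun_zero : D.IsFun φ₀
  isFun : ∀ t, D.IsFun (φ t)
  weak : ∀ t : ℝ, 0 ≤ t → ∀ ψ : Plane → ℝ, IsTest ψ →
    ∫ x, φ t x * ψ x = (∫ x, φ₀ x * ψ x) +
      ∫ s in (0 : ℝ)..t, ∫ x,
        (φ s x * (Laplacian.laplacian ψ x + fderiv ℝ ψ x (v x)) + g (φ s x) * ψ x)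

/-- `φ` is the solution, locally bounded in time with values in `L^p(D)`, of the passive scalar
equation `φ_t + v · ∇φ = Δφ` with initial datum `φ₀ ∈ L^p(D)`. -/
structure IsScalarSolution (D : Domain) (v : Plane → Plane) (p : ℝ≥0∞) (φ₀ : Plane → ℝ)
    (φ : ℝ → Plane → ℝ) : Prop where
  weakSolution : IsWeakSolution D v (fun _ => 0) φ₀ φ
  memLp_zero : MemLp φ₀ p D.measure
  bounded : ∀ τ : ℝ, ∃ C : ℝ≥0, ∀ t ∈ Icc (0 : ℝ) τ, eLpNorm (φ t) p D.measure ≤ C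

/-- The norm of the solution operator `φ₀ ↦ φ(·, τ)` of the passive scalar equation, as an operator
from `L^p(D)` to `L^q(D)` (equal to `∞` if it is not bounded between these spaces). -/
def solutionOperatorNorm (D : Domain) (v : Plane → Plane) (p q : ℝ≥0∞) (τ : ℝ) : ℝ≥0∞ :=
  ⨆ (φ₀ : Plane → ℝ) (φ : ℝ → Plane → ℝ) (_ : IsScalarSolution D v p φ₀ φ)
    (_ : eLpNorm φ₀ p D.measure ≤ 1), eLpNorm (φ τ) q D.measure

/-- `u` is dissipation-enhancing on `D`: for all `1 ≤ p < q ≤ ∞` and `τ > 0`, the `L^p → L^q` norm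
of the time-`τ` solution operator for the flow `A u` tends to `0` as `A → ∞`. -/
def DissipationEnhancing (D : Domain) (u : Plane → Plane) : Prop :=
  ∀ p q : ℝ≥0∞, 1 ≤ p → p < q → ∀ τ : ℝ, 0 < τ →
    Tendsto (fun A : ℝ => solutionOperatorNorm D (fun x => A • u x) p q τ) atTop (𝓝 0)

/-- `T` is the solution, with values in `[0, 1]`, of the reaction-advection-diffusion equation
`T_t + v · ∇T = ΔT + f(T)`, `T(·, 0) = T₀`. -/
structure IsReactionSolution (D : Domain) (v : Plane → Plane) (f : ℝ → ℝ) (T₀ : Plane → ℝ)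
    (T : ℝ → Plane → ℝ) : Prop where
  weakSolution : IsWeakSolution D v f T₀ T
  mem_Icc : ∀ t : ℝ, 0 ≤ t → ∀ x, T t x ∈ Icc (0 : ℝ) 1

end FlowQuenching

end

noncomputable section

namespace FlowQuenching

/-! ### Coordinates of the plane and test functions -/

/-! Let φ solve the passive scalar equation with drift A u and φ(0) = T₀. Suppose q ≥ 0 satisfies
2^α c ‖φ(t)‖_∞^(α-1) ≤ q(t) and ∫₀ᵗ q ≤ 1 for all t, and put H(t) = 1 + ∫₀ᵗ q, so that 1 ≤ H ≤ 2.
Then w = Hφ satisfies w_t + A u · ∇w - Δw = qφ ≥ c (2φ)^α ≥ c w^α ≥ f(w) wherever w ≤ 1. Hence w is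
a supersolution and T ≤ w ≤ 2φ (`IsReactionSolution.ae_le_two_mul`). It remains to find q and to see
that ‖φ(t)‖_∞ → 0.

The weight q is built from three pieces, each of integral at most 1/3 (`exists_time_weight`). For t
≤ τ the trivial bound φ ≤ 1 is enough if τ is small. For τ ≤ t ≤ ℓ one needs φ ≤ ε with ε small;
this follows from the smallness of the L¹ → L^∞ norm at time τ and the maximum principle. For t > ℓ
one needs an integrable tail that does not depend on A, so that ℓ, and with it ε, can be fixed
before A is chosen.

The tail comes from energy estimates. An incompressible drift drops out of the balance of ∫ φ^p, so
a Nash inequality (`nash`) gives E' ≤ -const · E^(1+β) for E = ∫ φ^p, p = 2k - 1, with constants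
depending only on k, the mass bound and the domain. Hence E ≲ t^(-(p-1)) in the plane and
t^(-(p-1)/2) in the strip (`exists_decay`, `exists_integral_pow_decay`). Waiting one more unit of
time, with the L^p → L^∞ norm at most 1 for large A, turns this into decay of ‖φ‖_∞. The resulting
exponent for ‖φ‖_∞^(α-1) exceeds 1 for large p exactly when α exceeds 2, respectively 3
(`Domain.exists_one_lt_div_rate`).

All solutions are merely weak. The equation is therefore mollified; since u is Lipschitz, the
commutator of mollification and transport tends to zero in L¹ (`IsField.lintegral_commutator_le`),
which justifies entropy and energy inequalities for functions of the solution. The comparison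
principle `WSol.le_of_source_le` is localized to balls, since nothing is known about T at infinity
beyond boundedness. A passive scalar with values in [0, 1] and controlled mass is constructed by a
Duhamel series (`exists_growth_solution`, `exists_unitSolution`). Its uniqueness is never needed:
the operator norms are suprema over all weak solutions, so any solution is a competitor. -/

/-- The standard basis vectors of the plane. -/
abbrev bv (i : Fin 2) : Plane := EuclideanSpace.single i 1

/-- Partial derivatives. -/
def pd (i : Fin 2) (f : Plane → ℝ) (x : Plane) : ℝ := fderiv ℝ f x (bv i)

lemma plane_eq_sum (w : Plane) : w = ∑ i, w i • bv i := by
  ext j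
  fin_cases j <;> simp [Fin.sum_univ_two]

lemma fderiv_eq_sum (f : Plane → ℝ) (x w : Plane) : fderiv ℝ f x w = ∑ i, w i * pd i f x := by
  conv_lhs => rw [plane_eq_sum w]
  rw [map_sum]
  simp only [map_smul, smul_eq_mul, pd]

lemma contDiff_pd {f : Plane → ℝ} (hf : ContDiff ℝ ∞ f) (i : Fin 2) : ContDiff ℝ ∞ (pd i f) := by
  have : ContDiff ℝ ∞ (fderiv ℝ f) := hf.fderiv_right (m := ∞) (by norm_cast)
  exact this.clm_apply contDiff_const

lemma IsTest.pd {f : Plane → ℝ} (hf : IsTest f) (i : Fin 2) : IsTest (pd i f) :=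
  ⟨contDiff_pd hf.1 i, by
    have := hf.2.fderiv (𝕜 := ℝ)
    refine this.comp_left (g := fun L : Plane →L[ℝ] ℝ => L (bv i)) (by simp)⟩

lemma laplacian_eq_sum {f : Plane → ℝ} (hf : ContDiff ℝ ∞ f) (x : Plane) :
    Laplacian.laplacian f x = ∑ i, pd i (pd i f) x := by
  rw [InnerProductSpace.laplacian_eq_iteratedFDeriv_orthonormalBasis f
    (EuclideanSpace.basisFun (Fin 2) ℝ)]
  refine Finset.sum_congr rfl fun i _ => ?_
  rw [iteratedFDeriv_two_apply]
  have h1 : DifferentiableAt ℝ (fderiv ℝ f) x :=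
    ((hf.fderiv_right (m := 1) (by norm_cast)).differentiable (by norm_num)) x
  have : pd i f = fun y => fderiv ℝ f y (bv i) := rfl
  simp only [Matrix.cons_val_zero, Matrix.cons_val_one, EuclideanSpace.basisFun_apply]
  rw [this, pd, fderiv_clm_apply h1 (by fun_prop)]
  simp

/-! ### Product coordinates and translation invariance on both domains -/

/-- The measure of the second coordinate in the product structure of the domain. -/
def Domain.snd (D : Domain) : Measure ℝ :=
  match D with
  | .plane => volume
  | .strip => volume.restrict (Ico 0 1)

instance (D : Domain) : SFinite D.snd := by cases D <;> unfold Domain.snd <;> infer_instance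

instance (D : Domain) : SFinite D.measure := by
  cases D <;> unfold Domain.measure <;> infer_instance

/-- Cartesian coordinates on the plane. -/
def coord : ℝ × ℝ ≃ᵐ Plane :=
  (MeasurableEquiv.finTwoArrow (α := ℝ)).symm.trans (MeasurableEquiv.toLp 2 (Fin 2 → ℝ))

@[simp] lemma coord_zero (p : ℝ × ℝ) : coord p 0 = p.1 := rfl
@[simp] lemma coord_one (p : ℝ × ℝ) : coord p 1 = p.2 := rfl

lemma coord_add (p q : ℝ × ℝ) : coord p + coord q = coord (p + q) := by
  ext i; fin_cases i <;> rfl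

lemma coord_surj (x : Plane) : coord (x 0, x 1) = x := by
  ext i; fin_cases i <;> rfl

lemma measurePreserving_coord_volume : MeasurePreserving coord volume volume :=
  ((volume_preserving_finTwoArrow ℝ).symm _).trans
    (PiLp.volume_preserving_toLp (Fin 2))

lemma measurePreserving_coord (D : Domain) :
    MeasurePreserving coord (volume.prod D.snd) D.measure := by
  cases D
  · exact measurePreserving_coord_volume
  · have h := measurePreserving_coord_volume.restrict_preimage
      (s := {x : Plane | x 1 ∈ Ico (0 : ℝ) 1}) (by measurability)
    have h2 : (coord ⁻¹' {x : Plane | x 1 ∈ Ico (0 : ℝ) 1}) = (univ : Set ℝ) ×ˢ Ico (0 : ℝ) 1 := by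
      ext p; simp
    rw [h2, Measure.volume_eq_prod, ← Measure.prod_restrict, Measure.restrict_univ] at h
    exact h

lemma lintegral_coord (D : Domain) (g : Plane → ℝ≥0∞) :
    ∫⁻ x, g x ∂D.measure = ∫⁻ p, g (coord p) ∂(volume.prod D.snd) :=
  ((measurePreserving_coord D).lintegral_comp_emb coord.measurableEmbedding g).symm

lemma lintegral_Ico_periodic {g : ℝ → ℝ≥0∞} (hg : Function.Periodic g 1) (a : ℝ) :
    ∫⁻ y in Ico 0 1, g (y + a) = ∫⁻ y in Ico 0 1, g y := by
  have h1 : ∫⁻ y in Ico 0 1, g (y + a) = ∫⁻ y in Ico a (a + 1), g y := by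
    have := (measurePreserving_add_right (volume : Measure ℝ) a).setLIntegral_comp_emb
      (MeasurableEquiv.addRight a).measurableEmbedding g (Ico 0 1)
    simp only [image_add_const_Ico, zero_add] at this
    rw [add_comm a 1]
    exact this
  rw [h1, restrict_Ico_eq_restrict_Ioc, restrict_Ico_eq_restrict_Ioc]
  have : VAddInvariantMeasure (AddSubgroup.zmultiples (1 : ℝ)) ℝ volume :=
    ⟨fun c s _ => measure_preimage_add _ _ _⟩
  have := (isAddFundamentalDomain_Ioc one_pos a).setLIntegral_eq
    (isAddFundamentalDomain_Ioc one_pos 0) g hg.map_vadd_zmultiples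
  simpa using this

/-- In the strip the measure itself is not invariant: a vertical shift moves the fundamental domain.
For lifts this is harmless, because a periodic function has the same integral over every period.
This invariance is what allows plane and strip to be treated together from here on. -/
lemma lintegral_translate (D : Domain) {g : Plane → ℝ≥0∞} (hm : Measurable g) (hg : D.IsFun g)
    (a : Plane) : ∫⁻ x, g (x + a) ∂D.measure = ∫⁻ x, g x ∂D.measure := by
  cases D
  · exact lintegral_add_right_eq_self (μ := (volume : Measure Plane)) g a
  · rw [lintegral_coord, lintegral_coord, lintegral_prod_symm _ (by fun_prop),
      lintegral_prod_symm _ (by fun_prop)]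
    have ha : a = coord (a 0, a 1) := (coord_surj a).symm
    have h1 : ∀ y : ℝ, ∫⁻ x : ℝ, g (coord (x, y) + a) = ∫⁻ x : ℝ, g (coord (x, y + a 1)) := by
      intro y
      rw [ha]
      simp only [coord_add, Prod.mk_add_mk]
      exact lintegral_add_right_eq_self (fun x => g (coord (x, y + a 1))) (a 0)
    simp only [h1]
    refine lintegral_Ico_periodic (g := fun y => ∫⁻ x : ℝ, g (coord (x, y))) (fun y => ?_) (a 1)
    refine lintegral_congr fun x => ?_
    have := hg (coord (x, y))
    rw [← this]
    congr 1
    ext i; fin_cases i <;> simp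

lemma integrable_translate (D : Domain) {g : Plane → ℝ} (hm : Measurable g) (hg : D.IsFun g)
    (hi : Integrable g D.measure) (a : Plane) : Integrable (fun x => g (x + a)) D.measure := by
  refine ⟨(hm.comp (measurable_id.add_const a)).aestronglyMeasurable, ?_⟩
  have h := lintegral_translate D (g := fun x => ‖g x‖ₑ) hm.enorm
    (by cases D; · trivial
        · intro x; simp only; rw [hg x]) a
  rw [HasFiniteIntegral, h]
  exact hi.2

lemma integral_translate (D : Domain) {g : Plane → ℝ} (hm : Measurable g) (hg : D.IsFun g)
    (hi : Integrable g D.measure) (a : Plane) :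
    ∫ x, g (x + a) ∂D.measure = ∫ x, g x ∂D.measure := by
  rw [integral_eq_lintegral_pos_part_sub_lintegral_neg_part (integrable_translate D hm hg hi a),
    integral_eq_lintegral_pos_part_sub_lintegral_neg_part hi]
  rw [lintegral_translate D (g := fun x => ENNReal.ofReal (g x)) (by fun_prop)
    (by cases D; · trivial
        · intro x; simp only; rw [hg x]) a,
    lintegral_translate D (g := fun x => ENNReal.ofReal (- g x)) (by fun_prop)
    (by cases D; · trivial
        · intro x; simp only; rw [hg x]) a]

lemma Domain.IsFun.pd {D : Domain} {F : Plane → ℝ} (hF : D.IsFun F) (i : Fin 2) :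
    D.IsFun (pd i F) := by
  cases D
  · trivial
  · intro x
    unfold FlowQuenching.pd
    rw [← fderiv_comp_add_right]
    congr 2
    funext y
    exact hF y

lemma Domain.IsFun.comp {D : Domain} {β γ : Type*} {F : Plane → β} (hF : D.IsFun F) (h : β → γ) :
    D.IsFun (fun x => h (F x)) := by
  cases D
  · trivial
  · intro x
    simp only
    rw [hF x]

lemma Domain.IsFun.comp₂ {D : Domain} {β γ δ : Type*} {F : Plane → β} {G : Plane → γ}
    (hF : D.IsFun F) (hG : D.IsFun G) (h : β → γ → δ) : D.IsFun (fun x => h (F x) (G x)) := by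
  cases D
  · trivial
  · intro x
    simp only
    rw [hF x, hG x]

/-- Integrate F(x + e_i) - F(x) = ∫₀¹ ∂_i F(x + s e_i) ds over the domain. By translation invariance
the left side integrates to zero and the right side to ∫ ∂_i F. No cutoff at infinity is needed. -/
lemma integral_pd_eq_zero (D : Domain) {F : Plane → ℝ} (hF : ContDiff ℝ 1 F) (hfun : D.IsFun F)
    (hi : Integrable F D.measure) (i : Fin 2) (hi' : Integrable (pd i F) D.measure) :
    ∫ x, pd i F x ∂D.measure = 0 := by
  have hdF : Continuous (pd i F) := (hF.continuous_fderiv (by norm_num)).clm_apply continuous_const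
  have hfun' : D.IsFun (pd i F) := hfun.pd i
  have hline : ∀ x (s : ℝ), HasDerivAt (fun s : ℝ => F (x + s • bv i)) (pd i F (x + s • bv i)) s := by
    intro x s
    have h1 := (hF.differentiable (by norm_num) (x + s • bv i)).hasFDerivAt
    have h2 : HasDerivAt (fun s : ℝ => x + s • bv i) (bv i) s := by
      simpa using ((hasDerivAt_id s).smul_const (bv i)).const_add x
    exact h1.comp_hasDerivAt s h2
  have hftc : ∀ x, ∫ s in (0:ℝ)..1, pd i F (x + s • bv i) = F (x + bv i) - F x := by
    intro x
    rw [intervalIntegral.integral_eq_sub_of_hasDerivAt (fun s _ => hline x s)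
      (Continuous.intervalIntegrable (by fun_prop) _ _)]
    simp
  have hI : Integrable (Function.uncurry fun (s : ℝ) x => pd i F (x + s • bv i))
      ((volume.restrict (Ioc (0:ℝ) 1)).prod D.measure) := by
    rw [integrable_prod_iff (Continuous.aestronglyMeasurable (by fun_prop))]
    refine ⟨ae_of_all _ fun s => integrable_translate D hdF.measurable hfun' hi' (s • bv i), ?_⟩
    have : ∀ s : ℝ, ∫ x, ‖pd i F (x + s • bv i)‖ ∂D.measure = ∫ x, ‖pd i F x‖ ∂D.measure := by
      intro s
      exact integral_translate D (g := fun x => ‖pd i F x‖) hdF.norm.measurable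
        (by cases D; · trivial
            · intro x; simp only; rw [hfun' x]) hi'.norm _
    simp only [Function.uncurry, this]
    exact integrable_const _
  have hsw : ∫ s in (0:ℝ)..1, ∫ x, pd i F (x + s • bv i) ∂D.measure
      = ∫ x, (∫ s in (0:ℝ)..1, pd i F (x + s • bv i)) ∂D.measure := by
    simp only [intervalIntegral.integral_of_le zero_le_one]
    exact integral_integral_swap hI
  have hl : ∀ s : ℝ, ∫ x, pd i F (x + s • bv i) ∂D.measure = ∫ x, pd i F x ∂D.measure :=
    fun s => integral_translate D hdF.measurable hfun' hi' _
  simp only [hl, hftc] at hsw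
  rw [integral_sub (integrable_translate D hF.continuous.measurable hfun hi _) hi,
    integral_translate D hF.continuous.measurable hfun hi] at hsw
  simpa using hsw

/-! ### Convolution -/

/-- Convolution of a kernel with a function on the plane. -/
def cv (k z : Plane → ℝ) (x : Plane) : ℝ := ∫ y, k y * z (x - y)

lemma cv_eq_convolution (k z : Plane → ℝ) :
    cv k z = convolution k z (ContinuousLinearMap.mul ℝ ℝ) volume := rfl

lemma locallyIntegrable_of_bdd {z : Plane → ℝ} (hz : Measurable z) {C : ℝ} (hC : ∀ x, |z x| ≤ C) :
    LocallyIntegrable z volume :=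
  (memLp_top_of_bound hz.aestronglyMeasurable C (ae_of_all _ hC)).locallyIntegrable le_top

lemma IsTest.continuous {k : Plane → ℝ} (hk : IsTest k) : Continuous k := hk.1.continuous

lemma IsTest.integrable {k : Plane → ℝ} (hk : IsTest k) : Integrable k :=
  hk.continuous.integrable_of_hasCompactSupport hk.2

lemma IsTest.integrable_mul {k z : Plane → ℝ} (hk : IsTest k) (hz : Measurable z) {C : ℝ}
    (hC : ∀ x, |z x| ≤ C) : Integrable (fun x => z x * k x) :=
  hk.integrable.bdd_mul hz.aestronglyMeasurable (ae_of_all _ hC)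

lemma IsTest.reflect {k : Plane → ℝ} (hk : IsTest k) (x : Plane) : IsTest (fun y => k (x - y)) :=
  ⟨hk.1.comp (contDiff_const.sub contDiff_id),
    hk.2.comp_homeomorph (Homeomorph.subLeft x)⟩

lemma pd_reflect {k : Plane → ℝ} (hk : ContDiff ℝ ∞ k) (x : Plane) (i : Fin 2) :
    pd i (fun y => k (x - y)) = fun y => - pd i k (x - y) := by
  funext y
  have h1 : HasFDerivAt k (fderiv ℝ k (x - y)) (x - y) :=
    (hk.differentiable (by simp) (x - y)).hasFDerivAt
  have h2 : HasFDerivAt (fun y => x - y) (-ContinuousLinearMap.id ℝ Plane) y := by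
    simpa using (hasFDerivAt_id y).const_sub x
  have h3 := (h1.comp y h2).fderiv
  simp only [pd]
  rw [show (fun y => k (x - y)) = k ∘ (fun y => x - y) from rfl, h3]
  simp

lemma cv_swap (k z : Plane → ℝ) (x : Plane) : ∫ y, z y * k (x - y) = cv k z x := by
  unfold cv
  rw [← integral_sub_left_eq_self (fun y => z y * k (x - y)) volume x]
  refine integral_congr_ae (ae_of_all _ fun y => ?_)
  simp [mul_comm]

lemma contDiff_cv {k z : Plane → ℝ} (hk : IsTest k) (hz : Measurable z) {C : ℝ}
    (hC : ∀ x, |z x| ≤ C) : ContDiff ℝ ∞ (cv k z) := by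
  rw [cv_eq_convolution]
  exact hk.2.contDiff_convolution_left _ hk.1 (locallyIntegrable_of_bdd hz hC)

lemma pd_cv {k z : Plane → ℝ} (hk : IsTest k) (hz : Measurable z) {C : ℝ}
    (hC : ∀ x, |z x| ≤ C) (i : Fin 2) : pd i (cv k z) = cv (pd i k) z := by
  funext x
  have hloc := locallyIntegrable_of_bdd hz hC
  have h := hk.2.hasFDerivAt_convolution_left (ContinuousLinearMap.mul ℝ ℝ)
    (hk.1.of_le (by simp)) hloc x
  rw [← cv_eq_convolution] at h
  rw [pd, h.fderiv]
  unfold convolution cv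
  rw [ContinuousLinearMap.integral_apply]
  · rfl
  · exact ((hk.2.fderiv (𝕜 := ℝ)).convolutionExists_left _
      (hk.1.continuous_fderiv (by simp)) hloc x)

lemma cv_integrand {k z : Plane → ℝ} (hk : IsTest k) (hz : Measurable z) {C : ℝ}
    (hC : ∀ x, |z x| ≤ C) (x : Plane) : Integrable (fun y => k y * z (x - y)) := by
  have := hk.integrable_mul (z := fun y => z (x - y)) (hz.comp (measurable_const.sub measurable_id))
    (fun y => hC _)
  simpa only [mul_comm] using this

lemma abs_cv_le {k z : Plane → ℝ} (hk : IsTest k) {C : ℝ}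
    (hC : ∀ x, |z x| ≤ C) (x : Plane) : |cv k z x| ≤ C * ∫ y, |k y| := by
  unfold cv
  rw [← integral_const_mul, ← Real.norm_eq_abs]
  refine norm_integral_le_of_norm_le (hk.integrable.abs.const_mul C) (ae_of_all _ fun y => ?_)
  rw [norm_mul, mul_comm, Real.norm_eq_abs, Real.norm_eq_abs]
  gcongr
  exact hC _

lemma Domain.IsFun.cv {D : Domain} {z : Plane → ℝ} (hz : D.IsFun z) (k : Plane → ℝ) :
    D.IsFun (cv k z) := by
  cases D
  · trivial
  · intro x
    refine integral_congr_ae (ae_of_all _ fun y => ?_)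
    simp only
    rw [show x + EuclideanSpace.single 1 1 - y = x - y + EuclideanSpace.single 1 1 by abel, hz]

lemma measurable_cv_uncurry {k : Plane → ℝ} (hk : Measurable k) {z : ℝ → Plane → ℝ}
    (hz : Measurable (Function.uncurry z)) :
    Measurable (Function.uncurry fun s x => cv k (z s) x) := by
  have : StronglyMeasurable (fun p : (ℝ × Plane) × Plane => k p.2 * z p.1.1 (p.1.2 - p.2)) := by
    apply Measurable.stronglyMeasurable
    refine (hk.comp measurable_snd).mul (hz.comp (f := fun p : (ℝ × Plane) × Plane =>
      (p.1.1, p.1.2 - p.2)) (by fun_prop))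
  exact (this.integral_prod_right (ν := volume)).measurable

lemma pd_eq_zero_of_support {k : Plane → ℝ} {ε : ℝ} (hs : ∀ y, ε < ‖y‖ → k y = 0) (i : Fin 2) :
    ∀ y, ε < ‖y‖ → pd i k y = 0 := by
  intro y hy
  have : k =ᶠ[𝓝 y] fun _ => 0 := by
    filter_upwards [(isOpen_lt continuous_const continuous_norm).mem_nhds hy] with x hx
    exact hs x hx
  simp [pd, this.fderiv_eq]

/-! ### L¹ bounds and L¹ continuity of translates, on balls and on the domain -/

/-- Uniform control of the `L¹(μ)` norms of the small translates of a function. -/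
def Ctrl (μ : Measure Plane) (M : ℝ) (z : Plane → ℝ) : Prop :=
  ∀ y : Plane, ‖y‖ ≤ 1 → ∫⁻ x, ‖z (x - y)‖ₑ ∂μ ≤ ENNReal.ofReal M

/-- Young's inequality for a measure that need not be translation invariant. Only shifts from the
support of `k` occur, and `Ctrl` bounds exactly these. Restricted Lebesgue measure on a ball and the
measure of the domain are thereby covered at once. -/
lemma lintegral_cv_le {μ : Measure Plane} [SFinite μ] {M : ℝ} {k z : Plane → ℝ} (hk : IsTest k)
    (hs : ∀ y, 1 < ‖y‖ → k y = 0) (hz : Measurable z) (hM : Ctrl μ M z) :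
    ∫⁻ x, ‖cv k z x‖ₑ ∂μ ≤ (∫⁻ y, ‖k y‖ₑ) * ENNReal.ofReal M := by
  calc ∫⁻ x, ‖cv k z x‖ₑ ∂μ ≤ ∫⁻ x, ∫⁻ y, ‖k y‖ₑ * ‖z (x - y)‖ₑ ∂volume ∂μ := by
        refine lintegral_mono fun x => ?_
        refine (enorm_integral_le_lintegral_enorm _).trans (le_of_eq ?_)
        simp [enorm_mul]
    _ = ∫⁻ y, ∫⁻ x, ‖k y‖ₑ * ‖z (x - y)‖ₑ ∂μ := by
        refine lintegral_lintegral_swap ?_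
        have := hk.continuous.measurable
        apply Measurable.aemeasurable
        fun_prop
    _ ≤ ∫⁻ y, ‖k y‖ₑ * ENNReal.ofReal M := by
        refine lintegral_mono fun y => ?_
        rw [lintegral_const_mul _ (by fun_prop)]
        by_cases hy : ‖y‖ ≤ 1
        · gcongr
          exact hM y hy
        · simp [hs y (not_le.1 hy)]
    _ = _ := lintegral_mul_const _ (by have := hk.continuous.measurable; fun_prop)

lemma IsTest.lintegral_ne_top {k : Plane → ℝ} (hk : IsTest k) : ∫⁻ y, ‖k y‖ₑ ≠ ⊤ :=
  hk.integrable.2.ne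

lemma integrable_cv {μ : Measure Plane} [SFinite μ] {M : ℝ} {k z : Plane → ℝ} (hk : IsTest k)
    (hs : ∀ y, 1 < ‖y‖ → k y = 0) (hz : Measurable z) {C : ℝ} (hC : ∀ x, |z x| ≤ C)
    (hM : Ctrl μ M z) : Integrable (cv k z) μ :=
  ⟨(contDiff_cv hk hz hC).continuous.aestronglyMeasurable,
    (lintegral_cv_le hk hs hz hM).trans_lt
      (ENNReal.mul_lt_top hk.lintegral_ne_top.lt_top ENNReal.ofReal_lt_top)⟩

lemma Ctrl.integrable {μ : Measure Plane} {M : ℝ} {z : Plane → ℝ} (hM : Ctrl μ M z)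
    (hz : Measurable z) : Integrable z μ := by
  refine ⟨hz.aestronglyMeasurable, ?_⟩
  have := hM 0 (by simp)
  simp only [sub_zero] at this
  exact this.trans_lt ENNReal.ofReal_lt_top

lemma Ctrl.mul_bdd {μ : Measure Plane} {M : ℝ} {z b : Plane → ℝ} (hM : Ctrl μ M z) {L : ℝ}
    (hb : ∀ x, |b x| ≤ L) : Ctrl μ (L * M) (fun x => z x * b x) := by
  intro y hy
  have hL : 0 ≤ L := (abs_nonneg _).trans (hb 0)
  calc ∫⁻ x, ‖z (x - y) * b (x - y)‖ₑ ∂μ ≤ ∫⁻ x, ENNReal.ofReal L * ‖z (x - y)‖ₑ ∂μ := by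
        refine lintegral_mono fun x => ?_
        rw [enorm_mul, mul_comm, Real.enorm_eq_ofReal_abs (b _)]
        gcongr
        exact hb _
    _ = ENNReal.ofReal L * ∫⁻ x, ‖z (x - y)‖ₑ ∂μ := lintegral_const_mul' _ _ ENNReal.ofReal_ne_top
    _ ≤ _ := by
        rw [ENNReal.ofReal_mul hL]
        gcongr
        exact hM y hy

/-- The `L¹(μ)` modulus of continuity tends to zero. -/
def TransCont (μ : Measure Plane) (z : Plane → ℝ) : Prop :=
  Tendsto (fun y => ∫⁻ x, ‖z (x - y) - z x‖ₑ ∂μ) (𝓝 0) (𝓝 0)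

/-- Translations act continuously on L¹. This is read off from the continuity of composition with
measure preserving maps, the translations being a continuous family of such maps. -/
lemma transCont_volume {g : Plane → ℝ} (hg : Integrable g) : TransCont volume g := by
  have hmp : ∀ y : Plane, MeasurePreserving (fun x : Plane => x - y) volume volume :=
    fun y => measurePreserving_sub_right _ y
  let F : Plane → C(Plane, Plane) := fun y => ⟨fun x => x - y, by fun_prop⟩
  have hF : Continuous F := by
    have : Continuous (Function.uncurry fun (y x : Plane) => x - y) := by fun_prop
    exact (ContinuousMap.curry ⟨_, this⟩).continuous
  let f : Lp ℝ 1 (volume : Measure Plane) := hg.toL1 g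
  have hc := Continuous.compMeasurePreservingLp (μ := (volume : Measure Plane)) (ν := volume)
    (p := 1) (f := fun _ => f) (g := F) continuous_const hF hmp ENNReal.one_ne_top
  have ht := (hc.tendsto 0).sub_const (Lp.compMeasurePreserving (F 0) (hmp 0) f)
  have ht2 := ht.enorm
  rw [sub_self, enorm_zero] at ht2
  refine ht2.congr fun y => ?_
  rw [Lp.enorm_def, eLpNorm_one_eq_lintegral_enorm]
  refine lintegral_congr_ae ?_
  have e1 : ∀ y, (Lp.compMeasurePreserving (F y) (hmp y) f : Plane → ℝ)
      =ᵐ[volume] fun x => g (x - y) := by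
    intro y
    refine (Lp.coeFn_compMeasurePreserving f (hmp y)).trans ?_
    exact (hmp y).quasiMeasurePreserving.ae_eq_comp hg.coeFn_toL1
  filter_upwards [Lp.coeFn_sub (Lp.compMeasurePreserving (F y) (hmp y) f)
    (Lp.compMeasurePreserving (F 0) (hmp 0) f), e1 y, e1 0] with x h1 h2 h3
  rw [h1, Pi.sub_apply, h2, h3, sub_zero]

/-- Shifts of length at most one see only the values of `z` on the larger set `S'`, so `z` may be
replaced by its restriction there, which is integrable on the whole plane. -/
lemma transCont_restrict {z : Plane → ℝ} {S S' : Set Plane} (hS : MeasurableSet S)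
    (hS' : MeasurableSet S') (hsub : ∀ x ∈ S, ∀ y : Plane, ‖y‖ ≤ 1 → x - y ∈ S')
    (hz : IntegrableOn z S') : TransCont (volume.restrict S) z := by
  have h := transCont_volume ((integrable_indicator_iff hS').2 hz)
  unfold TransCont at *
  refine tendsto_of_tendsto_of_tendsto_of_le_of_le' tendsto_const_nhds h
    (Eventually.of_forall fun _ => zero_le) ?_
  filter_upwards [Metric.closedBall_mem_nhds (0 : Plane) one_pos] with y hy
  rw [mem_closedBall_zero_iff] at hy
  calc ∫⁻ x in S, ‖z (x - y) - z x‖ₑ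
      = ∫⁻ x in S, ‖S'.indicator z (x - y) - S'.indicator z x‖ₑ := by
        refine setLIntegral_congr_fun hS fun x hx => ?_
        rw [indicator_of_mem (hsub x hx y hy),
          indicator_of_mem (by simpa using hsub x hx 0 (by simp))]
    _ ≤ _ := setLIntegral_le_lintegral _ _

lemma transCont_ball {z : Plane → ℝ} (hz : Measurable z) {C : ℝ} (hC : ∀ x, |z x| ≤ C) (R : ℝ) :
    TransCont (volume.restrict (Metric.ball 0 R)) z := by
  refine transCont_restrict (S' := Metric.ball 0 (R + 1)) measurableSet_ball measurableSet_ball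
    (fun x hx y hy => ?_) ?_
  · rw [mem_ball_zero_iff] at *
    linarith [norm_sub_le x y]
  · exact Measure.integrableOn_of_bounded (M := C) measure_ball_lt_top.ne hz.aestronglyMeasurable
      (ae_of_all _ hC)

lemma ctrl_ball {z : Plane → ℝ} {C : ℝ} (hC : ∀ x, |z x| ≤ C) (R : ℝ) :
    Ctrl (volume.restrict (Metric.ball 0 R)) (C * volume.real (Metric.ball (0 : Plane) R)) z := by
  intro y _
  have h0 : 0 ≤ C := (abs_nonneg _).trans (hC 0)
  calc ∫⁻ x in Metric.ball 0 R, ‖z (x - y)‖ₑ ≤ ∫⁻ x in Metric.ball (0 : Plane) R, ENNReal.ofReal C := by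
        refine lintegral_mono fun x => ?_
        rw [Real.enorm_eq_ofReal_abs]
        exact ENNReal.ofReal_le_ofReal (hC _)
    _ = _ := by
        rw [lintegral_const, Measure.restrict_apply_univ, ENNReal.ofReal_mul h0, Measure.real,
          ENNReal.ofReal_toReal measure_ball_lt_top.ne]

/-- The enlarged set [-1, 2) consists of three vertical translates of the fundamental domain, and a
unit shift of [0, 1) stays inside it. -/
lemma integrableOn_strip {z : Plane → ℝ} (hz : Measurable z)
    (hf : Domain.strip.IsFun z) (hi : Integrable z Domain.strip.measure) :
    IntegrableOn z {x : Plane | x 1 ∈ Ico (-1 : ℝ) 2} := by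
  have key : ∀ a : ℝ, IntegrableOn z {x : Plane | x 1 ∈ Ico a (a + 1)} := by
    intro a
    have h1 := integrable_translate .strip hz hf hi (a • bv 1)
    have h2 := (measurePreserving_add_right (volume : Measure Plane) (a • bv 1)).integrableOn_comp_preimage
      (MeasurableEquiv.addRight (a • bv 1)).measurableEmbedding (f := z)
      (s := {x : Plane | x 1 ∈ Ico a (a + 1)})
    rw [← h2]
    refine IntegrableOn.congr_set_ae (t := {x : Plane | x 1 ∈ Ico (0:ℝ) 1}) h1 (ae_of_all _ ?_)
    intro x
    simp only [eq_iff_iff]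
    change (x + a • bv 1 ∈ {x : Plane | x 1 ∈ Ico a (a + 1)}) ↔
      (x ∈ {x : Plane | x 1 ∈ Ico (0:ℝ) 1})
    simp [add_comm a]
  have := ((key (-1)).union (key 0)).union (key 1)
  refine this.mono_set fun x hx => ?_
  simp only [mem_union, mem_ofPred_eq, mem_Ico] at *
  norm_num
  grind

lemma transCont_domain {D : Domain} {z : Plane → ℝ} (hz : Measurable z) (hf : D.IsFun z)
    (hi : Integrable z D.measure) : TransCont D.measure z := by
  cases D
  · exact transCont_volume hi
  · refine transCont_restrict (by measurability) (by measurability) (fun x hx y hy => ?_)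
      (integrableOn_strip hz hf hi)
    have h1 : |y 1| ≤ 1 := (PiLp.norm_apply_le y 1).trans hy
    rw [abs_le] at h1
    simp only [mem_ofPred_eq, mem_Ico, PiLp.sub_apply] at *
    constructor <;> linarith

lemma ctrl_domain {D : Domain} {z : Plane → ℝ} (hz : Measurable z) (hf : D.IsFun z) {M : ℝ}
    (hM : ∫⁻ x, ‖z x‖ₑ ∂D.measure ≤ ENNReal.ofReal M) : Ctrl D.measure M z := by
  intro y _
  have := lintegral_translate D (g := fun x => ‖z x‖ₑ) hz.enorm (hf.comp _) (-y)
  simp only [← sub_eq_add_neg] at this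
  rw [this]
  exact hM

/-! ### Mollifiers -/

/-- A smooth probability density supported in the ball of radius `ε`, whose first derivatives
have `L¹` norms at most `J / ε`. -/
structure IsMollifier (J ε : ℝ) (k : Plane → ℝ) : Prop where
  isTest : IsTest k
  nonneg : ∀ y, 0 ≤ k y
  integral_eq : ∫ y, k y = 1
  support : ∀ y, ε < ‖y‖ → k y = 0
  deriv_le : ∀ i, ∫ y, |pd i k y| ≤ J / ε

/-- The rescalings ε⁻² η(y / ε) of one bump. The factor ε⁻² cancels the Jacobian, so a first
derivative costs exactly 1 / ε in L¹, with `J` independent of ε. -/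
lemma exists_isMollifier : ∃ J : ℝ, 0 ≤ J ∧ ∀ ε : ℝ, 0 < ε → ∃ k, IsMollifier J ε k := by
  let b : ContDiffBump (0 : Plane) := ⟨1/2, 1, by norm_num, by norm_num⟩
  let η : Plane → ℝ := b.normed volume
  have hη : IsTest η := ⟨b.contDiff_normed, b.hasCompactSupport_normed⟩
  have hdim : Module.finrank ℝ Plane = 2 := by simp
  have hscale : ∀ (f : Plane → ℝ) (ε : ℝ), 0 < ε →
      ∫ y, f (ε⁻¹ • y) = ε ^ 2 * ∫ y, f y := by
    intro f ε hε
    rw [Measure.integral_comp_inv_smul, hdim, smul_eq_mul, abs_of_nonneg (by positivity)]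
  refine ⟨∑ i, ∫ y, |pd i η y|, by positivity, fun ε hε => ?_⟩
  refine ⟨fun y => (ε ^ 2)⁻¹ * η (ε⁻¹ • y), ?_⟩
  have hpd : ∀ i y, pd i (fun y => (ε ^ 2)⁻¹ * η (ε⁻¹ • y)) y
      = (ε ^ 2)⁻¹ * (ε⁻¹ * pd i η (ε⁻¹ • y)) := by
    intro i y
    have h1 := (hη.1.differentiable (by simp) (ε⁻¹ • y)).hasFDerivAt
    have h2 : HasFDerivAt (fun y : Plane => ε⁻¹ • y) (ε⁻¹ • ContinuousLinearMap.id ℝ Plane) y := by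
      exact (ε⁻¹ • ContinuousLinearMap.id ℝ Plane).hasFDerivAt
    have h3 := ((h1.comp y h2).const_mul (ε ^ 2)⁻¹).fderiv
    simp only [Function.comp_def] at h3
    simp [pd, h3]
  refine ⟨⟨?_, ?_⟩, ?_, ?_, ?_, ?_⟩
  · exact contDiff_const.mul (hη.1.comp (contDiff_const_smul _))
  · exact HasCompactSupport.mul_left (hη.2.comp_smul (inv_ne_zero hε.ne'))
  · intro y
    have : 0 ≤ η (ε⁻¹ • y) := b.nonneg_normed _
    positivity
  · rw [integral_const_mul, hscale η ε hε]
    have : ∫ y, η y = 1 := b.integral_normed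
    rw [this]; field_simp
  · intro y hy
    have : η (ε⁻¹ • y) = 0 := by
      have : ε⁻¹ • y ∉ Function.support η := by
        rw [b.support_normed_eq, mem_ball_zero_iff, norm_smul, Real.norm_of_nonneg (by positivity)]
        rw [not_lt, inv_mul_eq_div, one_le_div hε]
        exact hy.le
      simpa using this
    simp [this]
  · intro i
    simp only [hpd]
    calc ∫ y, |(ε ^ 2)⁻¹ * (ε⁻¹ * pd i η (ε⁻¹ • y))|
        = ∫ y, (ε ^ 2)⁻¹ * (ε⁻¹ * |pd i η (ε⁻¹ • y)|) := by
          refine integral_congr_ae (ae_of_all _ fun y => ?_)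
          simp only
          rw [abs_mul, abs_mul, abs_of_pos (by positivity : 0 < (ε ^ 2)⁻¹),
            abs_of_pos (by positivity : 0 < ε⁻¹)]
      _ = (∫ y, |pd i η y|) / ε := by
          rw [integral_const_mul, integral_const_mul, hscale (fun y => |pd i η y|) ε hε]
          field_simp
      _ ≤ _ := by
          gcongr
          exact Finset.single_le_sum (f := fun i => ∫ y, |pd i η y|)
            (fun i _ => by positivity) (Finset.mem_univ i)

lemma IsMollifier.lintegral_eq {J ε : ℝ} {k : Plane → ℝ} (hk : IsMollifier J ε k) :
    ∫⁻ y, ‖k y‖ₑ = 1 := by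
  have : ∫⁻ y, ‖k y‖ₑ = ∫⁻ y, ENNReal.ofReal (k y) := by
    refine lintegral_congr fun y => ?_
    rw [Real.enorm_of_nonneg (hk.nonneg y)]
  rw [this, ← ofReal_integral_eq_lintegral_ofReal hk.isTest.integrable (ae_of_all _ hk.nonneg),
    hk.integral_eq, ENNReal.ofReal_one]

lemma IsMollifier.integral_abs {J ε : ℝ} {k : Plane → ℝ} (hk : IsMollifier J ε k) :
    ∫ y, |k y| = 1 := by
  rw [← hk.integral_eq]
  exact integral_congr_ae (ae_of_all _ fun y => abs_of_nonneg (hk.nonneg y))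

/-- Stated for an arbitrary kernel because it is used twice: with the mollifier itself for the
mollification error, and with its derivatives for the commutator. -/
lemma lintegral_diff_le {μ : Measure Plane} [SFinite μ] {k z : Plane → ℝ} (hk : Measurable k)
    {ε : ℝ} (hs : ∀ y, ε < ‖y‖ → k y = 0) (hz : Measurable z) {δ : ℝ≥0∞}
    (hδ : ∀ y, ‖y‖ ≤ ε → ∫⁻ x, ‖z (x - y) - z x‖ₑ ∂μ ≤ δ) :
    ∫⁻ x, ∫⁻ y, ‖k y‖ₑ * ‖z (x - y) - z x‖ₑ ∂volume ∂μ ≤ (∫⁻ y, ‖k y‖ₑ) * δ := by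
  calc ∫⁻ x, ∫⁻ y, ‖k y‖ₑ * ‖z (x - y) - z x‖ₑ ∂volume ∂μ
      = ∫⁻ y, ∫⁻ x, ‖k y‖ₑ * ‖z (x - y) - z x‖ₑ ∂μ := by
        refine lintegral_lintegral_swap ?_
        apply Measurable.aemeasurable
        fun_prop
    _ ≤ ∫⁻ y, ‖k y‖ₑ * δ := by
        refine lintegral_mono fun y => ?_
        rw [lintegral_const_mul _ (by fun_prop)]
        by_cases hy : ‖y‖ ≤ ε
        · gcongr
          exact hδ y hy
        · simp [hs y (not_le.1 hy)]
    _ = _ := lintegral_mul_const _ (by fun_prop)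

lemma lintegral_cv_sub_le {μ : Measure Plane} [SFinite μ] {J ε : ℝ} {k z : Plane → ℝ}
    (hk : IsMollifier J ε k) (hz : Measurable z) {C : ℝ} (hC : ∀ x, |z x| ≤ C) {δ : ℝ≥0∞}
    (hδ : ∀ y, ‖y‖ ≤ ε → ∫⁻ x, ‖z (x - y) - z x‖ₑ ∂μ ≤ δ) :
    ∫⁻ x, ‖cv k z x - z x‖ₑ ∂μ ≤ δ := by
  refine le_trans ?_ ((lintegral_diff_le hk.isTest.continuous.measurable hk.support hz hδ).trans
    (by rw [hk.lintegral_eq, one_mul]))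
  refine lintegral_mono fun x => ?_
  have : cv k z x - z x = ∫ y, k y * (z (x - y) - z x) := by
    simp only [mul_sub]
    rw [integral_sub (cv_integrand hk.isTest hz hC x) (hk.isTest.integrable.mul_const _),
      integral_mul_const, hk.integral_eq, one_mul]
    rfl
  rw [this]
  refine (enorm_integral_le_lintegral_enorm _).trans (le_of_eq ?_)
  simp [enorm_mul]

lemma integral_pd_test {k : Plane → ℝ} (hk : IsTest k) (i : Fin 2) : ∫ y, pd i k y = 0 :=
  integral_pd_eq_zero .plane (hk.1.of_le (by simp)) trivial hk.integrable i (hk.pd i).integrable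

/-! ### Lipschitz incompressible fields and the commutator estimate -/

/-- Components of a bounded Lipschitz incompressible field. -/
structure IsField (K L : ℝ) (v : Plane → Plane) : Prop where
  measurable : Measurable v
  lip : ∀ x y, ‖v x - v y‖ ≤ K * ‖x - y‖
  bdd : ∀ x, ‖v x‖ ≤ L
  incompressible : Incompressible v

lemma abs_apply_le_norm (w : Plane) (i : Fin 2) : |w i| ≤ ‖w‖ := PiLp.norm_apply_le w i

namespace IsField

variable {K L : ℝ} {v : Plane → Plane}

lemma K_nonneg (hv : IsField K L v) : 0 ≤ K := by
  have := hv.lip (bv 0) 0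
  simp only [sub_zero] at this
  have h1 : ‖(bv 0 : Plane)‖ = 1 := by simp
  rw [h1] at this
  linarith [norm_nonneg (v (bv 0) - v 0)]

lemma measurable_apply (hv : IsField K L v) (i : Fin 2) : Measurable (fun x => v x i) := by
  have := hv.measurable
  fun_prop

lemma abs_apply_le (hv : IsField K L v) (i : Fin 2) (x : Plane) : |v x i| ≤ L :=
  (abs_apply_le_norm _ i).trans (hv.bdd x)

lemma integral_eq_zero (hv : IsField K L v) {ψ : Plane → ℝ} (hψ : IsTest ψ) :
    ∑ i, ∫ x, v x i * pd i ψ x = 0 := by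
  rw [← integral_finsetSum _ fun i _ => (hψ.pd i).integrable_mul (hv.measurable_apply i)
    (hv.abs_apply_le i), ← hv.incompressible ψ hψ]
  refine integral_congr_ae (ae_of_all _ fun x => ?_)
  simp only [fderiv_eq_sum]

/-- The mollified field. -/
lemma sum_pd_cv (hv : IsField K L v) {k : Plane → ℝ} (hk : IsTest k) (x : Plane) :
    ∑ i, pd i (cv k fun x => v x i) x = 0 := by
  -- Testing distributional incompressibility with y ↦ k(x - y) gives the divergence of the
  -- mollified field at x.
  have := hv.integral_eq_zero (hk.reflect x)
  simp only [pd_reflect hk.1, mul_neg, integral_neg, Finset.sum_neg_distrib, neg_eq_zero] at this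
  rw [← this]
  refine Finset.sum_congr rfl fun i _ => ?_
  rw [pd_cv hk (hv.measurable_apply i) (hv.abs_apply_le i),
    ← cv_swap (pd i k) (fun x => v x i)]

lemma abs_cv_sub_le (hv : IsField K L v) {J ε : ℝ} {k : Plane → ℝ} (hk : IsMollifier J ε k)
    (i : Fin 2) (x : Plane) : |cv k (fun x => v x i) x - v x i| ≤ K * ε := by
  have : cv k (fun x => v x i) x - v x i = ∫ y, k y * (v (x - y) i - v x i) := by
    simp only [mul_sub]
    rw [integral_sub (cv_integrand hk.isTest (hv.measurable_apply i) (hv.abs_apply_le i) x)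
      (hk.isTest.integrable.mul_const _), integral_mul_const, hk.integral_eq, one_mul]
    rfl
  rw [this, ← Real.norm_eq_abs]
  calc ‖∫ y, k y * (v (x - y) i - v x i)‖ ≤ ∫ y, k y * (K * ε) := by
        refine norm_integral_le_of_norm_le (hk.isTest.integrable.mul_const _)
          (ae_of_all _ fun y => ?_)
        rw [norm_mul, Real.norm_of_nonneg (hk.nonneg y)]
        by_cases hy : ‖y‖ ≤ ε
        · gcongr
          · exact hk.nonneg y
          · rw [Real.norm_eq_abs, ← PiLp.sub_apply]
            refine (abs_apply_le_norm _ i).trans ((hv.lip _ _).trans ?_)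
            have h0 := hv.K_nonneg
            gcongr
            simpa using hy
        · simp [hk.support y (not_le.1 hy)]
    _ = K * ε := by rw [integral_mul_const, hk.integral_eq, one_mul]

/-- The commutator of mollification and transport. -/
def commutator (v : Plane → Plane) (k z : Plane → ℝ) (x : Plane) : ℝ :=
  ∑ i, (cv k (fun x => v x i) x * pd i (cv k z) x - cv (pd i k) (fun y => z y * v y i) x)

/-- Since ∫ ∂_i k = 0 and the mollified field v_ε is divergence-free, the commutator equals Σ ∫ ∂_i
k(y) (v_ε(x) - v(x - y))_i (z(x - y) - z(x)) dy. In this double difference the first bracket is at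
most 2Kε by the Lipschitz bound, which makes up for the singular kernel ∂_i k. -/
lemma enorm_commutator_le (hv : IsField K L v) {J ε : ℝ} {k z : Plane → ℝ}
    (hk : IsMollifier J ε k) (hz : Measurable z) {C : ℝ} (hC : ∀ x, |z x| ≤ C) (x : Plane) :
    ‖commutator v k z x‖ₑ ≤ ∑ i, ENNReal.ofReal (2 * K * ε) *
      ∫⁻ y, ‖pd i k y‖ₑ * ‖z (x - y) - z x‖ₑ := by
  have hVt := hk.isTest
  have e1 : ∀ i, cv k (fun x => v x i) x * pd i (cv k z) x - cv (pd i k) (fun y => z y * v y i) x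
      = (∫ y, pd i k y * ((cv k (fun x => v x i) x - v (x - y) i) * (z (x - y) - z x)))
        - z x * pd i (cv k fun x => v x i) x := by
    intro i
    have hvb : ∀ y, |v y i| ≤ L := hv.abs_apply_le i
    have hzv : ∀ y, |z y * v y i| ≤ C * L := fun y => by
      rw [abs_mul]
      exact mul_le_mul (hC y) (hvb y) (abs_nonneg _) ((abs_nonneg _).trans (hC y))
    have i1 := cv_integrand (hVt.pd i) hz hC x
    have i2 : Integrable (fun y => pd i k y * (z (x - y) * v (x - y) i)) :=
      cv_integrand (hVt.pd i) (hz.mul (hv.measurable_apply i)) hzv x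
    have i3 := cv_integrand (hVt.pd i) (hv.measurable_apply i) hvb x
    have i4 := (hVt.pd i).integrable
    have : ∀ y, pd i k y * ((cv k (fun x => v x i) x - v (x - y) i) * (z (x - y) - z x))
        = cv k (fun x => v x i) x * (pd i k y * z (x - y))
          - pd i k y * (z (x - y) * v (x - y) i)
          - (cv k (fun x => v x i) x * z x) * pd i k y
          + z x * (pd i k y * v (x - y) i) := by intro y; ring
    simp only [this]
    have j1 : Integrable (fun y => cv k (fun x => v x i) x * (pd i k y * z (x - y))
        - pd i k y * (z (x - y) * v (x - y) i)) := (i1.const_mul _).sub i2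
    have j2 : Integrable (fun y => cv k (fun x => v x i) x * (pd i k y * z (x - y))
        - pd i k y * (z (x - y) * v (x - y) i)
        - (cv k (fun x => v x i) x * z x) * pd i k y) := j1.sub (i4.const_mul _)
    rw [integral_add j2 (i3.const_mul _), integral_sub j1 (i4.const_mul _),
      integral_sub (i1.const_mul _) i2, integral_const_mul, integral_const_mul, integral_const_mul,
      integral_pd_test hVt i, pd_cv hVt hz hC, pd_cv hVt (hv.measurable_apply i) hvb]
    unfold cv
    ring
  have e2 : commutator v k z x = ∑ i,
      ∫ y, pd i k y * ((cv k (fun x => v x i) x - v (x - y) i) * (z (x - y) - z x)) := by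
    unfold commutator
    simp only [e1, Finset.sum_sub_distrib, ← Finset.mul_sum]
    rw [hv.sum_pd_cv hVt]
    ring
  rw [e2]
  refine (enorm_sum_le _ _).trans (Finset.sum_le_sum fun i _ => ?_)
  refine (enorm_integral_le_lintegral_enorm _).trans ?_
  rw [← lintegral_const_mul' _ _ ENNReal.ofReal_ne_top]
  refine lintegral_mono fun y => ?_
  rw [enorm_mul, enorm_mul]
  by_cases hy : ‖y‖ ≤ ε
  · have : ‖cv k (fun x => v x i) x - v (x - y) i‖ₑ ≤ ENNReal.ofReal (2 * K * ε) := by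
      rw [Real.enorm_eq_ofReal_abs]
      refine ENNReal.ofReal_le_ofReal ?_
      have h1 := hv.abs_cv_sub_le hk i x
      have h2 : |v x i - v (x - y) i| ≤ K * ε := by
        rw [← PiLp.sub_apply]
        refine (abs_apply_le_norm _ i).trans ((hv.lip _ _).trans ?_)
        have h0 := hv.K_nonneg
        gcongr
        simpa using hy
      calc _ = |(cv k (fun x => v x i) x - v x i) + (v x i - v (x - y) i)| := by ring_nf
        _ ≤ _ := (abs_add_le _ _).trans (by linarith)
    calc _ ≤ ‖pd i k y‖ₑ * (ENNReal.ofReal (2 * K * ε) * ‖z (x - y) - z x‖ₑ) := by gcongr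
      _ = _ := by ring
  · simp [pd_eq_zero_of_support hk.support i y (not_le.1 hy)]

/-- The powers of ε cancel: two components, each contributing 2Kε from the field and J / ε from ∂_i
k, give 4KJ. What is left is the L¹ modulus of continuity of `z`, so the commutator vanishes in the
limit although `z` has no derivatives. -/
lemma lintegral_commutator_le (hv : IsField K L v) {μ : Measure Plane} [SFinite μ] {J ε : ℝ}
    (hε : 0 < ε) {k z : Plane → ℝ}
    (hk : IsMollifier J ε k) (hz : Measurable z) {C : ℝ} (hC : ∀ x, |z x| ≤ C) {δ : ℝ≥0∞}
    (hδ : ∀ y, ‖y‖ ≤ ε → ∫⁻ x, ‖z (x - y) - z x‖ₑ ∂μ ≤ δ) :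
    ∫⁻ x, ‖commutator v k z x‖ₑ ∂μ ≤ ENNReal.ofReal (4 * K * J) * δ := by
  have hpm : ∀ i, Measurable (pd i k) := fun i => (hk.isTest.pd i).continuous.measurable
  have hm : ∀ i, Measurable fun x => ∫⁻ y, ‖pd i k y‖ₑ * ‖z (x - y) - z x‖ₑ := by
    intro i
    have := hpm i
    refine Measurable.lintegral_prod_right' (f := fun p : Plane × Plane =>
      ‖pd i k p.2‖ₑ * ‖z (p.1 - p.2) - z p.1‖ₑ) ?_
    fun_prop
  have hK := hv.K_nonneg
  calc ∫⁻ x, ‖commutator v k z x‖ₑ ∂μ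
      ≤ ∫⁻ x, ∑ i, ENNReal.ofReal (2 * K * ε) *
        ∫⁻ y, ‖pd i k y‖ₑ * ‖z (x - y) - z x‖ₑ ∂volume ∂μ :=
        lintegral_mono fun x => hv.enorm_commutator_le hk hz hC x
    _ = ∑ i, ENNReal.ofReal (2 * K * ε) *
        ∫⁻ x, ∫⁻ y, ‖pd i k y‖ₑ * ‖z (x - y) - z x‖ₑ ∂volume ∂μ := by
        rw [lintegral_finsetSum _ fun i _ => (hm i).const_mul _]
        exact Finset.sum_congr rfl fun i _ => lintegral_const_mul _ (hm i)
    _ ≤ ∑ i : Fin 2, ENNReal.ofReal (2 * K * ε) * (ENNReal.ofReal (J / ε) * δ) := by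
        gcongr with i
        refine (lintegral_diff_le (hpm i) (pd_eq_zero_of_support hk.support i) hz hδ).trans ?_
        gcongr
        have : ∫⁻ y, ‖pd i k y‖ₑ = ENNReal.ofReal (∫ y, |pd i k y|) := by
          rw [ofReal_integral_eq_lintegral_ofReal (hk.isTest.pd i).integrable.abs
            (ae_of_all _ fun _ => abs_nonneg _)]
          exact lintegral_congr fun y => Real.enorm_eq_ofReal_abs _
        rw [this]
        exact ENNReal.ofReal_le_ofReal (hk.deriv_le i)
    _ = ENNReal.ofReal (4 * K * J) * δ := by
        rw [Finset.sum_const, Finset.card_univ, Fintype.card_fin, ← mul_assoc,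
          ← ENNReal.ofReal_mul (by positivity), nsmul_eq_mul, ← mul_assoc]
        congr 1
        rw [show ((2 : ℕ) : ℝ≥0∞) = ENNReal.ofReal 2 by norm_num,
          ← ENNReal.ofReal_mul (by norm_num)]
        congr 1
        field_simp
        ring

end IsField

/-! ### Profiles and the energy identity for mollified solutions -/

/-- A twice continuously differentiable function vanishing at zero, with its first two derivatives
and a bound for them on `[-C, C]`. -/
structure Profile (B B1 B2 : ℝ → ℝ) (C L : ℝ) : Prop where
  hasDerivAt : ∀ x, HasDerivAt B (B1 x) x
  hasDerivAt' : ∀ x, HasDerivAt B1 (B2 x) x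
  continuous : Continuous B2
  zero : B 0 = 0
  bound : ∀ x, |x| ≤ C → |B1 x| ≤ L
  bound' : ∀ x, |x| ≤ C → |B2 x| ≤ L

namespace Profile

variable {B B1 B2 : ℝ → ℝ} {C L : ℝ}

lemma continuous_one (h : Profile B B1 B2 C L) : Continuous B1 :=
  continuous_iff_continuousAt.2 fun x => (h.hasDerivAt' x).continuousAt

lemma continuous_zero (h : Profile B B1 B2 C L) : Continuous B :=
  continuous_iff_continuousAt.2 fun x => (h.hasDerivAt x).continuousAt

lemma contDiff_one (h : Profile B B1 B2 C L) : ContDiff ℝ 1 B1 := by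
  rw [contDiff_one_iff_deriv]
  refine ⟨fun x => (h.hasDerivAt' x).differentiableAt, ?_⟩
  rw [funext fun x => (h.hasDerivAt' x).deriv]
  exact h.continuous

lemma contDiff (h : Profile B B1 B2 C L) : ContDiff ℝ 1 B := by
  rw [contDiff_one_iff_deriv]
  refine ⟨fun x => (h.hasDerivAt x).differentiableAt, ?_⟩
  rw [funext fun x => (h.hasDerivAt x).deriv]
  exact h.continuous_one

lemma abs_sub_le (h : Profile B B1 B2 C L) {x y : ℝ} (hx : |x| ≤ C) (hy : |y| ≤ C) :
    |B x - B y| ≤ L * |x - y| := by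
  have := (convex_Icc (-C) C).norm_image_sub_le_of_norm_hasDerivWithin_le (f := B) (f' := B1)
    (C := L) (x := y) (y := x) (fun z _ => (h.hasDerivAt z).hasDerivWithinAt)
    (fun z hz => h.bound z (abs_le.2 hz)) (abs_le.1 hy) (abs_le.1 hx)
  simpa using this

lemma abs_sub_le' (h : Profile B B1 B2 C L) {x y : ℝ} (hx : |x| ≤ C) (hy : |y| ≤ C) :
    |B1 x - B1 y| ≤ L * |x - y| := by
  have := (convex_Icc (-C) C).norm_image_sub_le_of_norm_hasDerivWithin_le (f := B1) (f' := B2)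
    (C := L) (x := y) (y := x) (fun z _ => (h.hasDerivAt' z).hasDerivWithinAt)
    (fun z hz => h.bound' z (abs_le.2 hz)) (abs_le.1 hy) (abs_le.1 hx)
  simpa using this

lemma abs_le (h : Profile B B1 B2 C L) {x : ℝ} (hx : |x| ≤ C) : |B x| ≤ L * |x| := by
  have := h.abs_sub_le hx (y := 0) (by simpa using (abs_nonneg x).trans hx)
  simpa [h.zero] using this

lemma L_nonneg (h : Profile B B1 B2 C L) (hC : 0 ≤ C) : 0 ≤ L :=
  (abs_nonneg _).trans (h.bound 0 (by simpa using hC))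

/-- The chain rule for primitives of bounded measurable functions. -/
lemma comp_integral (h : Profile B B1 B2 C L) {F f : ℝ → ℝ} {F0 τ : ℝ} (hτ : 0 ≤ τ)
    (hf : Measurable f) {M : ℝ} (hM : ∀ s, |f s| ≤ M)
    (hF : ∀ t ∈ Icc (0 : ℝ) τ, F t = F0 + ∫ s in (0:ℝ)..t, f s) :
    B (F τ) = B F0 + ∫ s in (0:ℝ)..τ, B1 (F s) * f s := by
  have hint : ∀ a b, IntervalIntegrable f volume a b := fun a b => by
    rw [intervalIntegrable_iff]
    exact Measure.integrableOn_of_bounded (M := M) (by simp) hf.aestronglyMeasurable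
      (ae_of_all _ hM)
  let G : ℝ → ℝ := fun t => F0 + ∫ s in (0:ℝ)..t, f s
  have hM0 : 0 ≤ M := (abs_nonneg _).trans (hM 0)
  have hG : LipschitzWith M.toNNReal G := by
    refine LipschitzWith.of_dist_le_mul fun x y => ?_
    rw [Real.dist_eq, Real.dist_eq, Real.coe_toNNReal _ hM0]
    have : G x - G y = ∫ s in y..x, f s := by
      simp only [G]
      rw [← intervalIntegral.integral_interval_sub_left (hint 0 x) (hint 0 y)]; ring
    rw [this]
    exact intervalIntegral.norm_integral_le_of_norm_le_const
      (fun s _ => (Real.norm_eq_abs (f s)).trans_le (hM s))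
  have hGb : ∀ t ∈ Icc 0 τ, G t ∈ Metric.closedBall F0 (M * τ) := by
    intro t ht
    have h1 := hG.dist_le_mul t 0
    have h2 : G 0 = F0 := by simp [G]
    rw [h2, Real.dist_eq t 0, sub_zero, abs_of_nonneg ht.1, Real.coe_toNNReal _ hM0] at h1
    exact h1.trans (by gcongr; exact ht.2)
  obtain ⟨K, hK⟩ : ∃ K, LipschitzOnWith K B (Metric.closedBall F0 (M * τ)) :=
    (h.contDiff.contDiffOn (s := Metric.closedBall F0 (M * τ))).exists_lipschitzOnWith (by simp)
      (convex_closedBall _ _) (isCompact_closedBall _ _)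
  have hLip : LipschitzOnWith (K * M.toNNReal) (fun t => B (G t)) (uIcc 0 τ) := by
    rw [uIcc_of_le hτ]
    exact hK.comp hG.lipschitzOnWith hGb
  -- The composition is Lipschitz on the interval, hence absolutely continuous, and is recovered
  -- from its almost everywhere derivative. That derivative is computed by the usual chain rule at
  -- the points where the primitive of `f` is differentiable.
  have hac := hLip.absolutelyContinuousOnInterval
  have hkey := hac.integral_deriv_eq_sub
  have hd : ∀ᵐ s, s ∈ uIcc 0 τ → deriv (fun t => B (G t)) s = B1 (F s) * f s := by
    filter_upwards [(hint 0 τ).ae_hasDerivAt_integral] with s hs hmem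
    have h1 : HasDerivAt G (f s) s := (hs hmem 0 (by simp)).const_add F0
    rw [uIcc_of_le hτ] at hmem
    rw [hF s hmem]
    exact ((h.hasDerivAt (G s)).comp s h1).deriv
  have : ∫ s in (0:ℝ)..τ, deriv (fun t => B (G t)) s = ∫ s in (0:ℝ)..τ, B1 (F s) * f s := by
    refine intervalIntegral.integral_congr_ae ?_
    filter_upwards [hd] with s hs hmem
    exact hs (uIoc_subset_uIcc hmem)
  rw [this] at hkey
  rw [hkey, hF τ ⟨hτ, le_rfl⟩]
  simp [G]

end Profile

/-! ### Weak solutions and the mollified equation -/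

/-- `z` is on `[0, τ]` a weak solution, bounded by `C`, of `z_t + v · ∇z = Δz + g` with
initial datum `z0`, written with partial derivatives. -/
structure WSol (v : Plane → Plane) (τ C : ℝ) (g : ℝ → Plane → ℝ) (z0 : Plane → ℝ)
    (z : ℝ → Plane → ℝ) : Prop where
  measurable : Measurable (Function.uncurry z)
  measurable_source : Measurable (Function.uncurry g)
  measurable_zero : Measurable z0
  bound : ∀ t x, |z t x| ≤ C
  bound_source : ∀ t x, |g t x| ≤ C
  bound_zero : ∀ x, |z0 x| ≤ C
  weak : ∀ t ∈ Icc (0 : ℝ) τ, ∀ ψ : Plane → ℝ, IsTest ψ →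
    ∫ x, z t x * ψ x = (∫ x, z0 x * ψ x) + ∫ s in (0 : ℝ)..t, ∫ x,
      (z s x * (∑ i, pd i (pd i ψ) x + ∑ i, v x i * pd i ψ x) + g s x * ψ x)

/-- The right-hand side of the mollified equation. -/
def mollifiedRHS (v : Plane → Plane) (k z g : Plane → ℝ) (x : Plane) : ℝ :=
  ∑ i, cv (pd i (pd i k)) z x - ∑ i, cv (pd i k) (fun y => z y * v y i) x + cv k g x

namespace WSol

variable {v : Plane → Plane} {τ C K L : ℝ} {g : ℝ → Plane → ℝ} {z0 : Plane → ℝ}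
  {z : ℝ → Plane → ℝ}

lemma C_nonneg (h : WSol v τ C g z0 z) : 0 ≤ C := (abs_nonneg _).trans (h.bound 0 0)

lemma measurable_apply (h : WSol v τ C g z0 z) (t : ℝ) : Measurable (z t) :=
  h.measurable.comp measurable_prodMk_left

lemma measurable_source_apply (h : WSol v τ C g z0 z) (t : ℝ) : Measurable (g t) :=
  h.measurable_source.comp measurable_prodMk_left

lemma bound_mul (h : WSol v τ C g z0 z) (hv : IsField K L v) (i : Fin 2) (s : ℝ) (y : Plane) :
    |z s y * v y i| ≤ C * L := by
  rw [abs_mul]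
  exact mul_le_mul (h.bound s y) (hv.abs_apply_le i y) (abs_nonneg _) h.C_nonneg

lemma measurable_mul (h : WSol v τ C g z0 z) (hv : IsField K L v) (i : Fin 2) :
    Measurable (Function.uncurry fun s y => z s y * v y i) :=
  h.measurable.mul ((hv.measurable_apply i).comp measurable_snd)

lemma measurable_mollifiedRHS (h : WSol v τ C g z0 z) (hv : IsField K L v) {k : Plane → ℝ}
    (hk : IsTest k) :
    Measurable (Function.uncurry fun s x => mollifiedRHS v k (z s) (g s) x) := by
  have h1 : ∀ i, Measurable (Function.uncurry fun s x => cv (pd i (pd i k)) (z s) x) := fun i =>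
    measurable_cv_uncurry ((hk.pd i).pd i).continuous.measurable h.measurable
  have h2 : ∀ i, Measurable
      (Function.uncurry fun s x => cv (pd i k) (fun y => z s y * v y i) x) := fun i =>
    measurable_cv_uncurry (hk.pd i).continuous.measurable (h.measurable_mul hv i)
  have h3 : Measurable (Function.uncurry fun s x => cv k (g s) x) :=
    measurable_cv_uncurry hk.continuous.measurable h.measurable_source
  exact ((Finset.measurable_fun_sum _ fun i _ => h1 i).sub
    (Finset.measurable_fun_sum _ fun i _ => h2 i)).add h3

lemma abs_mollifiedRHS_le (h : WSol v τ C g z0 z) (hv : IsField K L v) {k : Plane → ℝ}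
    (hk : IsTest k) (s : ℝ) (x : Plane) : |mollifiedRHS v k (z s) (g s) x| ≤
      ∑ i, C * (∫ y, |pd i (pd i k) y|) + ∑ i, C * L * (∫ y, |pd i k y|) + C * ∫ y, |k y| := by
  unfold mollifiedRHS
  refine (abs_add_le _ _).trans (add_le_add ((abs_sub _ _).trans (add_le_add ?_ ?_)) ?_)
  · exact (Finset.abs_sum_le_sum_abs _ _).trans (Finset.sum_le_sum fun i _ =>
      abs_cv_le ((hk.pd i).pd i) (h.bound s) x)
  · exact (Finset.abs_sum_le_sum_abs _ _).trans (Finset.sum_le_sum fun i _ =>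
      abs_cv_le (hk.pd i) (h.bound_mul hv i s) x)
  · exact abs_cv_le hk (h.bound_source s) x

/-- Use y ↦ k(x - y) as test function. Each derivative of the reflected kernel costs a sign, so the
diffusion term keeps its sign while the transport term changes it. -/
lemma cv_eq (h : WSol v τ C g z0 z) (hv : IsField K L v) {k : Plane → ℝ} (hk : IsTest k)
    (x : Plane) {t : ℝ} (ht : t ∈ Icc 0 τ) :
    cv k (z t) x = cv k z0 x + ∫ s in (0:ℝ)..t, mollifiedRHS v k (z s) (g s) x := by
  have := h.weak t ht _ (hk.reflect x)
  rw [cv_swap, cv_swap] at this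
  rw [this]
  congr 1
  refine intervalIntegral.integral_congr fun s _ => ?_
  simp only [pd_reflect hk.1]
  have hpd2 : ∀ i, pd i (fun y => - pd i k (x - y)) = fun y => pd i (pd i k) (x - y) := by
    intro i
    have h1 := pd_reflect (contDiff_pd hk.1 i) x i
    funext y
    have h2 : pd i (fun y => - pd i k (x - y)) y = - pd i (fun y => pd i k (x - y)) y := by
      simp only [pd]
      rw [fderiv_fun_neg]; rfl
    rw [h2, h1, neg_neg]
  simp only [hpd2]
  have e : ∀ y, z s y * (∑ i, pd i (pd i k) (x - y) + ∑ i, v y i * -pd i k (x - y))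
      + g s y * k (x - y)
      = ∑ i, z s y * pd i (pd i k) (x - y) - ∑ i, (z s y * v y i) * pd i k (x - y)
        + g s y * k (x - y) := by
    intro y
    simp only [Fin.sum_univ_two]
    ring
  simp only [e]
  have i1 : ∀ i, Integrable (fun y => z s y * pd i (pd i k) (x - y)) := fun i =>
    (((hk.pd i).pd i).reflect x).integrable_mul (h.measurable_apply s) (h.bound s)
  have i2 : ∀ i, Integrable (fun y => (z s y * v y i) * pd i k (x - y)) := fun i =>
    ((hk.pd i).reflect x).integrable_mul
      ((h.measurable_apply s).mul (hv.measurable_apply i)) (h.bound_mul hv i s)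
  have i3 : Integrable (fun y => g s y * k (x - y)) :=
    (hk.reflect x).integrable_mul (h.measurable_source_apply s) (h.bound_source s)
  have i4 : Integrable (fun y => ∑ i, z s y * pd i (pd i k) (x - y)) :=
    integrable_finsetSum _ fun i _ => i1 i
  have i5 : Integrable (fun y => ∑ i, (z s y * v y i) * pd i k (x - y)) :=
    integrable_finsetSum _ fun i _ => i2 i
  have i6 : Integrable (fun y => ∑ i, z s y * pd i (pd i k) (x - y)
      - ∑ i, (z s y * v y i) * pd i k (x - y)) := i4.sub i5
  rw [integral_add i6 i3, integral_sub i4 i5, integral_finsetSum _ fun i _ => i1 i,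
    integral_finsetSum _ fun i _ => i2 i]
  simp only [cv_swap (pd _ (pd _ k)) (z s), cv_swap k (g s)]
  congr 2
  refine Finset.sum_congr rfl fun i _ => ?_
  rw [← cv_swap (pd i k) (fun y => z s y * v y i)]

/-- The transport term is rewritten with the mollified field, which is smooth and exactly
divergence-free; classical integration by parts then applies, and the whole discrepancy is the
commutator. -/
lemma mollifiedRHS_eq (h : WSol v τ C g z0 z) {k : Plane → ℝ}
    (hk : IsTest k) (s : ℝ) (x : Plane) :
    mollifiedRHS v k (z s) (g s) x = ∑ i, pd i (pd i (cv k (z s))) x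
      - ∑ i, cv k (fun x => v x i) x * pd i (cv k (z s)) x
      + IsField.commutator v k (z s) x + cv k (g s) x := by
  unfold mollifiedRHS IsField.commutator
  rw [Finset.sum_sub_distrib]
  have : ∀ i, pd i (pd i (cv k (z s))) = cv (pd i (pd i k)) (z s) := fun i => by
    rw [pd_cv hk (h.measurable_apply s) (h.bound s),
      pd_cv (hk.pd i) (h.measurable_apply s) (h.bound s)]
  simp only [this]
  ring

lemma integrable_prod_cv {μ : Measure Plane} [SFinite μ] {M b : ℝ} {k : Plane → ℝ}
    (hk : IsTest k) (hs : ∀ y, 1 < ‖y‖ → k y = 0) {z : ℝ → Plane → ℝ}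
    (hz : Measurable (Function.uncurry z)) (hM : ∀ s, Ctrl μ M (z s)) (t : ℝ) :
    Integrable (Function.uncurry fun s x => b * cv k (z s) x)
      ((volume.restrict (Ioc 0 t)).prod μ) := by
  refine Integrable.const_mul ⟨(measurable_cv_uncurry hk.continuous.measurable hz).aestronglyMeasurable, ?_⟩ b
  rw [HasFiniteIntegral, lintegral_prod _
    (measurable_cv_uncurry hk.continuous.measurable hz).enorm.aemeasurable]
  calc _ ≤ ∫⁻ s in Ioc 0 t, (∫⁻ y, ‖k y‖ₑ) * ENNReal.ofReal M := by
        refine lintegral_mono fun s => ?_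
        exact lintegral_cv_le hk hs (hz.comp measurable_prodMk_left) (hM s)
    _ < ⊤ := by
        rw [lintegral_const]
        refine ENNReal.mul_lt_top (ENNReal.mul_lt_top hk.lintegral_ne_top.lt_top
          ENNReal.ofReal_lt_top) ?_
        simp

lemma integrable_mollifiedRHS (h : WSol v τ C g z0 z) (hv : IsField K L v) {μ : Measure Plane}
    [SFinite μ] {M : ℝ} {k : Plane → ℝ} (hk : IsTest k) (hs : ∀ y, 1 < ‖y‖ → k y = 0)
    (hM : ∀ s, Ctrl μ M (z s)) (hg : ∀ s, Ctrl μ M (g s)) (t : ℝ) :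
    Integrable (Function.uncurry fun s x => mollifiedRHS v k (z s) (g s) x)
      ((volume.restrict (Ioc 0 t)).prod μ) := by
  have hs' := fun i => pd_eq_zero_of_support hs i
  have h1 : ∀ i, Integrable (Function.uncurry fun s x => cv (pd i (pd i k)) (z s) x)
      ((volume.restrict (Ioc 0 t)).prod μ) := fun i => by
    simpa using integrable_prod_cv (b := 1) ((hk.pd i).pd i)
      (pd_eq_zero_of_support (hs' i) i) h.measurable hM t
  have h2 : ∀ i, Integrable (Function.uncurry fun s x => cv (pd i k) (fun y => z s y * v y i) x)
      ((volume.restrict (Ioc 0 t)).prod μ) := fun i => by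
    simpa using integrable_prod_cv (b := 1) (hk.pd i) (hs' i) (h.measurable_mul hv i)
      (fun s => (hM s).mul_bdd (hv.abs_apply_le i)) t
  have h3 : Integrable (Function.uncurry fun s x => cv k (g s) x)
      ((volume.restrict (Ioc 0 t)).prod μ) := by
    simpa using integrable_prod_cv (b := 1) hk hs h.measurable_source hg t
  exact ((integrable_finsetSum _ fun i _ => h1 i).sub
    (integrable_finsetSum _ fun i _ => h2 i)).add h3

lemma abs_cv_le_of_mollifier (h : WSol v τ C g z0 z) {J ε : ℝ} {k : Plane → ℝ}
    (hk : IsMollifier J ε k) (s : ℝ) (x : Plane) : |cv k (z s) x| ≤ C := by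
  simpa [hk.integral_abs] using abs_cv_le hk.isTest (h.bound s) x

/-- For fixed x the mollified solution is a primitive in time of a bounded measurable function, so
the chain rule `Profile.comp_integral` holds pointwise in x. Integration in x and Fubini finish the
proof. -/
lemma integral_profile_cv (h : WSol v τ C g z0 z) (hv : IsField K L v) {μ : Measure Plane}
    [SFinite μ] {M : ℝ} (hM : ∀ s, Ctrl μ M (z s)) (hg : ∀ s, Ctrl μ M (g s))
    (hM0 : Ctrl μ M z0) {J ε : ℝ} (hε : ε ≤ 1) {k : Plane → ℝ} (hk : IsMollifier J ε k)
    {B B1 B2 : ℝ → ℝ} {L' : ℝ} (hB : Profile B B1 B2 C L') {ρ : Plane → ℝ} (hρ : Measurable ρ)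
    {b : ℝ} (hρ1 : ∀ x, |ρ x| ≤ b) {t : ℝ} (ht : t ∈ Icc 0 τ) :
    IntervalIntegrable (fun s => ∫ x, ρ x * (B1 (cv k (z s) x) *
        mollifiedRHS v k (z s) (g s) x) ∂μ) volume 0 t ∧
    ∫ x, ρ x * B (cv k (z t) x) ∂μ = ∫ x, ρ x * B (cv k z0 x) ∂μ
      + ∫ s in (0:ℝ)..t, ∫ x, ρ x * (B1 (cv k (z s) x) *
        mollifiedRHS v k (z s) (g s) x) ∂μ := by
  have hs : ∀ y, 1 < ‖y‖ → k y = 0 := fun y hy => hk.support y (hε.trans_lt hy)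
  have hmw : Measurable (Function.uncurry fun s x => cv k (z s) x) :=
    measurable_cv_uncurry hk.isTest.continuous.measurable h.measurable
  have hmB1 := hB.continuous_one.measurable
  have hI : Integrable (Function.uncurry fun s x => ρ x * (B1 (cv k (z s) x) *
        mollifiedRHS v k (z s) (g s) x)) ((volume.restrict (Ioc 0 t)).prod μ) := by
    refine Integrable.bdd_mul (c := b) ?_ (hρ.comp measurable_snd).aestronglyMeasurable
      (ae_of_all _ fun p => hρ1 p.2)
    exact Integrable.bdd_mul (c := L') (h.integrable_mollifiedRHS hv hk.isTest hs hM hg t)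
      (hmB1.comp hmw).aestronglyMeasurable
      (ae_of_all _ fun p => hB.bound _ (h.abs_cv_le_of_mollifier hk _ _))
  have hchain : ∀ x, B (cv k (z t) x) = B (cv k z0 x) + ∫ s in (0:ℝ)..t, B1 (cv k (z s) x) *
        mollifiedRHS v k (z s) (g s) x := fun x =>
    hB.comp_integral ht.1 ((h.measurable_mollifiedRHS hv hk.isTest).comp
      (measurable_id.prodMk measurable_const))
      (fun s => h.abs_mollifiedRHS_le hv hk.isTest s x)
      (F := fun t => cv k (z t) x) fun r hr => h.cv_eq hv hk.isTest x ⟨hr.1, hr.2.trans ht.2⟩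
  have hI0 : Integrable (fun x => ρ x * B (cv k z0 x)) μ := by
    have hc0 : ∀ x, |cv k z0 x| ≤ C := fun x => by
      simpa [hk.integral_abs] using abs_cv_le hk.isTest h.bound_zero x
    have hi := integrable_cv hk.isTest hs h.measurable_zero h.bound_zero hM0
    refine Integrable.bdd_mul (c := b) ?_ hρ.aestronglyMeasurable (ae_of_all _ hρ1)
    refine Integrable.mono' (hi.abs.const_mul L')
      (hB.continuous_zero.comp_aestronglyMeasurable hi.1) (ae_of_all _ fun x => ?_)
    exact hB.abs_le (hc0 x)
  refine ⟨?_, ?_⟩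
  · rw [intervalIntegrable_iff_integrableOn_Ioc_of_le ht.1]
    exact hI.integral_prod_left
  · have hI2 : Integrable (fun x => ∫ s in Ioc 0 t, ρ x * (B1 (cv k (z s) x) *
        mollifiedRHS v k (z s) (g s) x)) μ := hI.integral_prod_right
    rw [intervalIntegral.integral_of_le ht.1, integral_integral_swap hI, ← integral_add hI0 hI2]
    refine integral_congr_ae (ae_of_all _ fun x => ?_)
    beta_reduce
    rw [hchain x, intervalIntegral.integral_of_le ht.1, integral_const_mul, mul_add]

end WSol

/-! ### Integration by parts -/

lemma pd_mul {f g : Plane → ℝ} {x : Plane} (hf : DifferentiableAt ℝ f x)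
    (hg : DifferentiableAt ℝ g x) (i : Fin 2) :
    pd i (fun x => f x * g x) x = pd i f x * g x + f x * pd i g x := by
  simp only [pd, fderiv_fun_mul hf hg]
  simp [mul_comm]
  ring

lemma pd_sub {f g : Plane → ℝ} {x : Plane} (hf : DifferentiableAt ℝ f x)
    (hg : DifferentiableAt ℝ g x) (i : Fin 2) :
    pd i (fun x => f x - g x) x = pd i f x - pd i g x := by
  simp only [pd, fderiv_fun_sub hf hg]
  rfl

lemma pd_comp {B : ℝ → ℝ} {b : ℝ} {w : Plane → ℝ} {x : Plane} (hB : HasDerivAt B b (w x))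
    (hw : DifferentiableAt ℝ w x) (i : Fin 2) :
    pd i (fun x => B (w x)) x = b * pd i w x := by
  have := (hB.comp_hasFDerivAt x hw.hasFDerivAt).fderiv
  simp only [Function.comp_def] at this
  simp [pd, this]

lemma continuous_pd {f : Plane → ℝ} (hf : ContDiff ℝ 1 f) (i : Fin 2) : Continuous (pd i f) :=
  (hf.continuous_fderiv (by norm_num)).clm_apply continuous_const

section IntegrationByParts

variable {B B1 B2 : ℝ → ℝ} {C L : ℝ}

/-- Integration by parts over the whole domain. -/
lemma integral_transport_diffusion (D : Domain) (hB : Profile B B1 B2 C L) {w : Plane → ℝ}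
    (hw : ContDiff ℝ ∞ w) (hwf : D.IsFun w) (hwC : ∀ x, |w x| ≤ C)
    (hwi : Integrable w D.measure) {C' : ℝ} (hdC : ∀ i x, |pd i w x| ≤ C')
    (hdi : ∀ i, Integrable (pd i w) D.measure)
    (hddi : ∀ i, Integrable (pd i (pd i w)) D.measure)
    {V : Fin 2 → Plane → ℝ} (hV : ∀ i, ContDiff ℝ ∞ (V i)) (hVf : ∀ i, D.IsFun (V i))
    (hVC : ∀ i x, |V i x| ≤ C') (hdVC : ∀ i x, |pd i (V i) x| ≤ C')
    (hdiv : ∀ x, ∑ i, pd i (V i) x = 0) :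
    Integrable (fun x => B2 (w x) * ∑ i, pd i w x ^ 2) D.measure ∧
    ∫ x, B1 (w x) * (∑ i, pd i (pd i w) x - ∑ i, V i x * pd i w x) ∂D.measure
      = - ∫ x, B2 (w x) * ∑ i, pd i w x ^ 2 ∂D.measure := by
  have hwd : ∀ x, DifferentiableAt ℝ w x := hw.differentiable (by simp)
  have hdd : ∀ i x, DifferentiableAt ℝ (pd i w) x := fun i =>
    (contDiff_pd hw i).differentiable (by simp)
  have hVd : ∀ i x, DifferentiableAt ℝ (V i) x := fun i => (hV i).differentiable (by simp)
  have hBc : ContDiff ℝ 1 (fun x => B (w x)) := hB.contDiff.comp (hw.of_le (by simp))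
  have hB1c : ContDiff ℝ 1 (fun x => B1 (w x)) := hB.contDiff_one.comp (hw.of_le (by simp))
  have hB2c : Continuous (fun x => B2 (w x)) := hB.continuous.comp hw.continuous
  have hpdB : ∀ i x, pd i (fun x => B (w x)) x = B1 (w x) * pd i w x := fun i x =>
    pd_comp (hB.hasDerivAt _) (hwd x) i
  have hpdB1 : ∀ i x, pd i (fun x => B1 (w x)) x = B2 (w x) * pd i w x := fun i x =>
    pd_comp (hB.hasDerivAt' _) (hwd x) i
  have iB : Integrable (fun x => B (w x)) D.measure :=
    Integrable.mono' (hwi.abs.const_mul L) hBc.continuous.aestronglyMeasurable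
      (ae_of_all _ fun x => hB.abs_le (hwC x))
  have i1 : ∀ i, Integrable (fun x => B1 (w x) * pd i w x) D.measure := fun i =>
    (hdi i).bdd_mul (c := L) hB1c.continuous.aestronglyMeasurable
      (ae_of_all _ fun x => hB.bound _ (hwC x))
  have i2 : ∀ i, Integrable (fun x => V i x * B (w x)) D.measure := fun i =>
    iB.bdd_mul (c := C') (hV i).continuous.aestronglyMeasurable (ae_of_all _ (hVC i))
  have i3 : ∀ i, Integrable (fun x => B2 (w x) * (pd i w x * pd i w x)) D.measure := fun i =>
    ((hdi i).bdd_mul (c := C') (contDiff_pd hw i).continuous.aestronglyMeasurable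
      (ae_of_all _ (hdC i))).bdd_mul (c := L) hB2c.aestronglyMeasurable
      (ae_of_all _ fun x => hB.bound' _ (hwC x))
  have i4 : ∀ i, Integrable (fun x => B1 (w x) * pd i (pd i w) x) D.measure := fun i =>
    (hddi i).bdd_mul (c := L) hB1c.continuous.aestronglyMeasurable
      (ae_of_all _ fun x => hB.bound _ (hwC x))
  have i5 : ∀ i, Integrable (fun x => pd i (V i) x * B (w x)) D.measure := fun i =>
    iB.bdd_mul (c := C') (contDiff_pd (hV i) i).continuous.aestronglyMeasurable
      (ae_of_all _ (hdVC i))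
  have i6 : ∀ i, Integrable (fun x => V i x * (B1 (w x) * pd i w x)) D.measure := fun i =>
    (i1 i).bdd_mul (c := C') (hV i).continuous.aestronglyMeasurable (ae_of_all _ (hVC i))
  have hpdF : ∀ i x, pd i (fun x => B1 (w x) * pd i w x - V i x * B (w x)) x
      = (B2 (w x) * (pd i w x * pd i w x) + B1 (w x) * pd i (pd i w) x)
        - (pd i (V i) x * B (w x) + V i x * (B1 (w x) * pd i w x)) := by
    intro i x
    have d1 := (hB1c.differentiable (by simp)) x
    have d2 := (hBc.differentiable (by simp)) x
    rw [pd_sub (d1.fun_mul (hdd i x)) ((hVd i x).fun_mul d2), pd_mul d1 (hdd i x), pd_mul (hVd i x) d2,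
      hpdB, hpdB1]
    ring
  have hFi : ∀ i, Integrable (fun x => (B2 (w x) * (pd i w x * pd i w x)
      + B1 (w x) * pd i (pd i w) x)
        - (pd i (V i) x * B (w x) + V i x * (B1 (w x) * pd i w x))) D.measure := fun i =>
    ((i3 i).add (i4 i)).sub ((i5 i).add (i6 i))
  have hzero : ∀ i, ∫ x, ((B2 (w x) * (pd i w x * pd i w x) + B1 (w x) * pd i (pd i w) x)
        - (pd i (V i) x * B (w x) + V i x * (B1 (w x) * pd i w x))) ∂D.measure = 0 := by
    intro i
    -- The divergence of B'(w) ∇w - V B(w) integrates to zero. Each component is treated separately;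
    -- div V = 0 can only be used after summation over i.
    have h := integral_pd_eq_zero D (F := fun x => B1 (w x) * pd i w x - V i x * B (w x))
      ((hB1c.mul ((contDiff_pd hw i).of_le (by simp))).sub (((hV i).of_le (by simp)).mul hBc))
      (Domain.IsFun.comp₂ (((hwf.comp B1).comp₂ (hwf.pd i) (· * ·)))
        ((hVf i).comp₂ (hwf.comp B) (· * ·)) (· - ·))
      ((i1 i).sub (i2 i)) i (by
        rw [funext (hpdF i)]; exact hFi i)
    simp only [hpdF] at h
    exact h
  have i3' : Integrable (fun x => B2 (w x) * ∑ i, pd i w x ^ 2) D.measure := by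
    have : (fun x => B2 (w x) * ∑ i, pd i w x ^ 2)
        = fun x => ∑ i, B2 (w x) * (pd i w x * pd i w x) := by
      funext x; rw [Finset.mul_sum]; exact Finset.sum_congr rfl fun i _ => by ring
    rw [this]
    exact integrable_finsetSum _ fun i _ => i3 i
  refine ⟨i3', ?_⟩
  have hsum : ∫ x, ∑ i, ((B2 (w x) * (pd i w x * pd i w x) + B1 (w x) * pd i (pd i w) x)
        - (pd i (V i) x * B (w x) + V i x * (B1 (w x) * pd i w x))) ∂D.measure = 0 := by
    rw [integral_finsetSum _ fun i _ => hFi i]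
    simp [hzero]
  have e : ∀ x, B1 (w x) * (∑ i, pd i (pd i w) x - ∑ i, V i x * pd i w x)
      = ∑ i, ((B2 (w x) * (pd i w x * pd i w x) + B1 (w x) * pd i (pd i w) x)
        - (pd i (V i) x * B (w x) + V i x * (B1 (w x) * pd i w x)))
        - B2 (w x) * ∑ i, pd i w x ^ 2 := by
    intro x
    have := hdiv x
    simp only [Fin.sum_univ_two] at *
    linear_combination B (w x) * this
  simp only [e]
  rw [integral_sub (integrable_finsetSum _ fun i _ => hFi i) i3', hsum, zero_sub]

/-- Integration by parts against a nonnegative test function, for a convex profile. -/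
lemma integral_test_transport_diffusion_le (hB : Profile B B1 B2 C L) (hB2 : ∀ x, 0 ≤ B2 x)
    {ρ : Plane → ℝ} (hρ : IsTest ρ) (hρ0 : ∀ x, 0 ≤ ρ x) {w : Plane → ℝ}
    (hw : ContDiff ℝ ∞ w) {V : Fin 2 → Plane → ℝ} (hV : ∀ i, ContDiff ℝ ∞ (V i))
    (hdiv : ∀ x, ∑ i, pd i (V i) x = 0) :
    ∫ x, ρ x * (B1 (w x) * (∑ i, pd i (pd i w) x - ∑ i, V i x * pd i w x))
      ≤ ∫ x, B (w x) * (∑ i, pd i (pd i ρ) x + ∑ i, V i x * pd i ρ x) := by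
  have hwd : ∀ x, DifferentiableAt ℝ w x := hw.differentiable (by simp)
  have hdd : ∀ i x, DifferentiableAt ℝ (pd i w) x := fun i =>
    (contDiff_pd hw i).differentiable (by simp)
  have hρd : ∀ x, DifferentiableAt ℝ ρ x := hρ.1.differentiable (by simp)
  have hρdd : ∀ i x, DifferentiableAt ℝ (pd i ρ) x := fun i =>
    (hρ.pd i).1.differentiable (by simp)
  have hVd : ∀ i x, DifferentiableAt ℝ (V i) x := fun i => (hV i).differentiable (by simp)
  have hBc : ContDiff ℝ 1 (fun x => B (w x)) := hB.contDiff.comp (hw.of_le (by simp))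
  have hB1c : ContDiff ℝ 1 (fun x => B1 (w x)) := hB.contDiff_one.comp (hw.of_le (by simp))
  have hB2c : Continuous (fun x => B2 (w x)) := hB.continuous.comp hw.continuous
  have hpdB : ∀ i x, pd i (fun x => B (w x)) x = B1 (w x) * pd i w x := fun i x =>
    pd_comp (hB.hasDerivAt _) (hwd x) i
  have hpdB1 : ∀ i x, pd i (fun x => B1 (w x)) x = B2 (w x) * pd i w x := fun i x =>
    pd_comp (hB.hasDerivAt' _) (hwd x) i
  -- As div V = 0, the divergence of this compactly supported field is ρ B'(w)(Δw - V · ∇w) + ρ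
  -- B''(w)|∇w|² - B(w)(Δρ + V · ∇ρ). It integrates to zero, and convexity allows the gradient
  -- square to be dropped.
  let F : Fin 2 → Plane → ℝ := fun i x =>
    ρ x * (B1 (w x) * pd i w x) - B (w x) * pd i ρ x - ρ x * (V i x * B (w x))
  have hFc : ∀ i, ContDiff ℝ 1 (F i) := fun i =>
    (((hρ.1.of_le (by simp)).mul (hB1c.mul ((contDiff_pd hw i).of_le (by simp)))).sub
      (hBc.mul ((hρ.pd i).1.of_le (by simp)))).sub
      ((hρ.1.of_le (by simp)).mul (((hV i).of_le (by simp)).mul hBc))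
  have hFs : ∀ i, HasCompactSupport (F i) := fun i =>
    ((hρ.2.mul_right).sub ((hρ.pd i).2.mul_left)).sub hρ.2.mul_right
  have hpdF : ∀ i x, pd i (F i) x = pd i ρ x * (B1 (w x) * pd i w x)
      + ρ x * (B2 (w x) * pd i w x * pd i w x + B1 (w x) * pd i (pd i w) x)
      - (B1 (w x) * pd i w x * pd i ρ x + B (w x) * pd i (pd i ρ) x)
      - (pd i ρ x * (V i x * B (w x)) + ρ x * (pd i (V i) x * B (w x)
        + V i x * (B1 (w x) * pd i w x))) := by
    intro i x
    have d1 := (hB1c.differentiable (by simp)) x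
    have d2 := (hBc.differentiable (by simp)) x
    simp only [F]
    rw [pd_sub (((hρd x).fun_mul (d1.fun_mul (hdd i x))).fun_sub (d2.fun_mul (hρdd i x)))
      ((hρd x).fun_mul ((hVd i x).fun_mul d2)), pd_sub ((hρd x).fun_mul (d1.fun_mul (hdd i x)))
      (d2.fun_mul (hρdd i x)), pd_mul (hρd x) (d1.fun_mul (hdd i x)), pd_mul d1 (hdd i x),
      pd_mul d2 (hρdd i x), pd_mul (hρd x) ((hVd i x).fun_mul d2), pd_mul (hVd i x) d2, hpdB, hpdB1]
  have hpdFs : ∀ i, HasCompactSupport (pd i (F i)) := fun i =>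
    ((hFs i).fderiv (𝕜 := ℝ)).comp_left (g := fun A : Plane →L[ℝ] ℝ => A (bv i)) (by simp)
  have hpdFi : ∀ i, Integrable (pd i (F i)) := fun i =>
    (continuous_pd (hFc i) i).integrable_of_hasCompactSupport (hpdFs i)
  have hzero : ∀ i, ∫ x, pd i (F i) x = 0 := fun i =>
    integral_pd_eq_zero .plane (hFc i) trivial
      ((hFc i).continuous.integrable_of_hasCompactSupport (μ := volume) (hFs i)) i (hpdFi i)
  have hc1 := hB.continuous_one
  have hc0 := hB.continuous_zero
  have hcw0 := hw.continuous
  have hcw : ∀ i, Continuous (pd i w) := fun i => (contDiff_pd hw i).continuous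
  have hcww : ∀ i, Continuous (pd i (pd i w)) := fun i =>
    (contDiff_pd (contDiff_pd hw i) i).continuous
  have hcρ : ∀ i, Continuous (pd i ρ) := fun i => (hρ.pd i).continuous
  have hcρρ : ∀ i, Continuous (pd i (pd i ρ)) := fun i => ((hρ.pd i).pd i).continuous
  have hcV : ∀ i, Continuous (V i) := fun i => (hV i).continuous
  have hcρ0 := hρ.continuous
  have iL : Integrable (fun x => ρ x * (B1 (w x) *
      (∑ i, pd i (pd i w) x - ∑ i, V i x * pd i w x))) :=
    Continuous.integrable_of_hasCompactSupport (by fun_prop) hρ.2.mul_right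
  have iR : Integrable (fun x => B (w x) * (∑ i, pd i (pd i ρ) x + ∑ i, V i x * pd i ρ x)) := by
    refine Continuous.integrable_of_hasCompactSupport (by fun_prop) ?_
    simp only [Fin.sum_univ_two]
    exact ((((hρ.pd 0).pd 0).2.add ((hρ.pd 1).pd 1).2).add
      ((hρ.pd 0).2.mul_left.add (hρ.pd 1).2.mul_left)).mul_left
  have hsum : ∫ x, ∑ i, pd i (F i) x = 0 := by
    rw [integral_finsetSum _ fun i _ => hpdFi i]
    simp [hzero]
  have : ∫ x, ρ x * (B1 (w x) * (∑ i, pd i (pd i w) x - ∑ i, V i x * pd i w x))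
      ≤ ∫ x, (B (w x) * (∑ i, pd i (pd i ρ) x + ∑ i, V i x * pd i ρ x)
        + ∑ i, pd i (F i) x) := by
    refine integral_mono iL (iR.add (integrable_finsetSum _ fun i _ => hpdFi i)) fun x => ?_
    have hd := hdiv x
    have hnn : 0 ≤ ρ x * (B2 (w x) * (pd 0 w x ^ 2 + pd 1 w x ^ 2)) :=
      mul_nonneg (hρ0 x) (mul_nonneg (hB2 _) (by positivity))
    simp only [hpdF, Fin.sum_univ_two] at *
    nlinarith [congrArg (fun r => ρ x * B (w x) * r) hd]
  rwa [integral_add iR (integrable_finsetSum _ fun i _ => hpdFi i), hsum, add_zero] at this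

end IntegrationByParts

/-! ### Mollifier sequences and passage to the limit -/

section Limits

/-- A sequence of mollifiers at scales tending to zero. -/
lemma exists_mollifier_seq : ∃ (J : ℝ) (k : ℕ → Plane → ℝ), 0 ≤ J ∧
    ∀ n : ℕ, IsMollifier J (1 / ((n : ℝ) + 1)) (k n) := by
  obtain ⟨J, hJ, h⟩ := exists_isMollifier
  choose k hk using fun n : ℕ => h (1 / ((n : ℝ) + 1)) (by positivity)
  exact ⟨J, k, hJ, hk⟩

lemma TransCont.eventually {μ : Measure Plane} {z : Plane → ℝ} (hz : TransCont μ z) {δ : ℝ≥0∞} (hδ : 0 < δ) :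
    ∀ᶠ n : ℕ in atTop, ∀ y : Plane, ‖y‖ ≤ 1 / ((n : ℝ) + 1) →
      ∫⁻ x, ‖z (x - y) - z x‖ₑ ∂μ ≤ δ := by
  have h1 : ∀ᶠ y in 𝓝 (0 : Plane), ∫⁻ x, ‖z (x - y) - z x‖ₑ ∂μ ≤ δ :=
    (hz.eventually_lt_const hδ).mono fun _ h => h.le
  obtain ⟨r, hr, h2⟩ := Metric.eventually_nhds_iff_ball.1 h1
  filter_upwards [tendsto_one_div_add_atTop_nhds_zero_nat.eventually_lt_const hr] with n hn y hy
  exact h2 y (by rw [mem_ball_zero_iff]; exact hy.trans_lt hn)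

variable {μ : Measure Plane} [SFinite μ] {J K L C : ℝ} {k : ℕ → Plane → ℝ}

lemma tendsto_lintegral_cv_sub (hk : ∀ n : ℕ, IsMollifier J (1 / ((n : ℝ) + 1)) (k n))
    {z : Plane → ℝ} (hz : Measurable z) (hC : ∀ x, |z x| ≤ C) (ht : TransCont μ z) :
    Tendsto (fun n => ∫⁻ x, ‖cv (k n) z x - z x‖ₑ ∂μ) atTop (𝓝 0) := by
  rw [ENNReal.tendsto_nhds_zero]
  intro δ hδ
  filter_upwards [ht.eventually hδ] with n hn
  exact lintegral_cv_sub_le (hk n) hz hC hn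

/-- The commutator is bounded by a constant times the modulus of continuity at the scale of the
mollifier. The `+ 1` in the quotient only avoids division by zero. -/
lemma tendsto_lintegral_commutator {v : Plane → Plane} (hv : IsField K L v)
    (hk : ∀ n : ℕ, IsMollifier J (1 / ((n : ℝ) + 1)) (k n))
    {z : Plane → ℝ} (hz : Measurable z) (hC : ∀ x, |z x| ≤ C) (ht : TransCont μ z) :
    Tendsto (fun n => ∫⁻ x, ‖IsField.commutator v (k n) z x‖ₑ ∂μ) atTop (𝓝 0) := by
  rw [ENNReal.tendsto_nhds_zero]
  intro δ hδ
  have hpos : 0 < δ / (ENNReal.ofReal (4 * K * J) + 1) :=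
    ENNReal.div_pos hδ.ne' (by simp)
  filter_upwards [ht.eventually hpos] with n hn
  refine (hv.lintegral_commutator_le (by positivity) (hk n) hz hC hn).trans ?_
  calc _ ≤ (ENNReal.ofReal (4 * K * J) + 1) * (δ / (ENNReal.ofReal (4 * K * J) + 1)) := by
        gcongr; exact le_self_add
    _ ≤ δ := ENNReal.mul_div_le

/-- Passage to the limit in an integrated differential inequality. -/
lemma le_add_integral_of_tendsto {t b Yt Y0 : ℝ} (ht : 0 ≤ t) {Ynt Yn0 : ℕ → ℝ}
    {I F : ℕ → ℝ → ℝ} {f : ℝ → ℝ}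
    (heq : ∀ n, Ynt n = Yn0 n + ∫ s in (0:ℝ)..t, I n s)
    (hI : ∀ n, IntervalIntegrable (I n) volume 0 t)
    (hIF : ∀ n, ∀ s ∈ Icc 0 t, I n s ≤ F n s) (hFm : ∀ n, Measurable (F n))
    (hFb : ∀ n s, |F n s| ≤ b)
    (hF : ∀ s, Tendsto (fun n => F n s) atTop (𝓝 (f s)))
    (hYt : Tendsto Ynt atTop (𝓝 Yt)) (hY0 : Tendsto Yn0 atTop (𝓝 Y0)) :
    Yt ≤ Y0 + ∫ s in (0:ℝ)..t, f s := by
  have hlim : Tendsto (fun n => ∫ s in (0:ℝ)..t, F n s) atTop (𝓝 (∫ s in (0:ℝ)..t, f s)) := by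
    refine intervalIntegral.tendsto_integral_filter_of_dominated_convergence (fun _ => b)
      (Eventually.of_forall fun n => (hFm n).aestronglyMeasurable)
      (Eventually.of_forall fun n => ae_of_all _ fun s _ => hFb n s) ?_ (ae_of_all _ fun s _ => hF s)
    exact intervalIntegrable_const
  refine le_of_tendsto_of_tendsto' hYt (hY0.add hlim) fun n => ?_
  rw [heq n]
  gcongr
  refine intervalIntegral.integral_mono_on ht (hI n) ?_ (hIF n)
  rw [intervalIntegrable_iff]
  exact Measure.integrableOn_of_bounded (M := b) (by simp) (hFm n).aestronglyMeasurable
    (ae_of_all _ (hFb n))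

end Limits

/-! ### Limits of mollified quantities -/

section Limits

variable {μ : Measure Plane} [SFinite μ] {J K L C M L' : ℝ} {k : ℕ → Plane → ℝ}
  {B B1 B2 : ℝ → ℝ}

lemma mollifier_support_one (hk : ∀ n : ℕ, IsMollifier J (1 / ((n : ℝ) + 1)) (k n)) (n : ℕ) :
    ∀ y, 1 < ‖y‖ → k n y = 0 := fun y hy => (hk n).support y (by
  refine lt_of_le_of_lt ?_ hy
  rw [div_le_one (by positivity)]
  linarith [(Nat.cast_nonneg n : (0:ℝ) ≤ n)])

lemma abs_cv_mollifier_le {J ε : ℝ} {k z : Plane → ℝ} (hk : IsMollifier J ε k)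
    (hC : ∀ x, |z x| ≤ C) (x : Plane) : |cv k z x| ≤ C := by
  simpa [hk.integral_abs] using abs_cv_le hk.isTest hC x

lemma Ctrl.lintegral_sub_le {μ : Measure Plane} {z : Plane → ℝ} (hM : Ctrl μ M z)
    (hz : Measurable z) {y : Plane} (hy : ‖y‖ ≤ 1) :
    ∫⁻ x, ‖z (x - y) - z x‖ₑ ∂μ ≤ 2 * ENNReal.ofReal M := by
  calc ∫⁻ x, ‖z (x - y) - z x‖ₑ ∂μ ≤ ∫⁻ x, (‖z (x - y)‖ₑ + ‖z x‖ₑ) ∂μ :=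
        lintegral_mono fun x => enorm_sub_le
    _ = ∫⁻ x, ‖z (x - y)‖ₑ ∂μ + ∫⁻ x, ‖z x‖ₑ ∂μ := lintegral_add_right _ (by fun_prop)
    _ ≤ ENNReal.ofReal M + ENNReal.ofReal M := by
        gcongr
        · exact hM y hy
        · simpa using hM 0 (by simp)
    _ = _ := (two_mul _).symm

lemma continuous_commutator {v : Plane → Plane} (hv : IsField K L v) {k z : Plane → ℝ}
    (hk : IsTest k) (hz : Measurable z) (hC : ∀ x, |z x| ≤ C) :
    Continuous (IsField.commutator v k z) := by
  refine continuous_finsetSum _ fun i _ => ?_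
  have h1 : Continuous (cv k fun x => v x i) :=
    (contDiff_cv hk (hv.measurable_apply i) (hv.abs_apply_le i)).continuous
  have h2 : Continuous (pd i (cv k z)) := (contDiff_pd (contDiff_cv hk hz hC) i).continuous
  have h3 : Continuous (cv (pd i k) fun y => z y * v y i) :=
    (contDiff_cv (hk.pd i) (hz.mul (hv.measurable_apply i)) (C := C * L) fun y => by
      rw [Pi.mul_apply, abs_mul]
      exact mul_le_mul (hC y) (hv.abs_apply_le i y) (abs_nonneg _)
        ((abs_nonneg _).trans (hC y))).continuous
  exact (h1.mul h2).sub h3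

lemma lintegral_commutator_le_of_ctrl {v : Plane → Plane} (hv : IsField K L v)
    (hk : ∀ n : ℕ, IsMollifier J (1 / ((n : ℝ) + 1)) (k n)) {z : Plane → ℝ} (hz : Measurable z)
    (hC : ∀ x, |z x| ≤ C) (hM : Ctrl μ M z) (n : ℕ) :
    ∫⁻ x, ‖IsField.commutator v (k n) z x‖ₑ ∂μ
      ≤ ENNReal.ofReal (4 * K * J) * (2 * ENNReal.ofReal M) :=
  hv.lintegral_commutator_le (by positivity) (hk n) hz hC fun y hy =>
    hM.lintegral_sub_le hz (hy.trans (by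
      rw [div_le_one (by positivity)]
      linarith [(Nat.cast_nonneg n : (0:ℝ) ≤ n)]))

lemma integrable_commutator {v : Plane → Plane} (hv : IsField K L v)
    (hk : ∀ n : ℕ, IsMollifier J (1 / ((n : ℝ) + 1)) (k n)) {z : Plane → ℝ} (hz : Measurable z)
    (hC : ∀ x, |z x| ≤ C) (hM : Ctrl μ M z) (n : ℕ) :
    Integrable (IsField.commutator v (k n) z) μ :=
  ⟨(continuous_commutator hv (hk n).isTest hz hC).aestronglyMeasurable,
    (lintegral_commutator_le_of_ctrl hv hk hz hC hM n).trans_lt (ENNReal.mul_lt_top (by simp)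
      (ENNReal.mul_lt_top (by simp) (by simp)))⟩

lemma integral_abs_eq_toReal {μ : Measure Plane} {f : Plane → ℝ} (hf : AEStronglyMeasurable f μ) :
    ∫ x, |f x| ∂μ = (∫⁻ x, ‖f x‖ₑ ∂μ).toReal := by
  rw [← integral_norm_eq_lintegral_enorm hf]; rfl

lemma integral_abs_commutator_le {v : Plane → Plane} (hv : IsField K L v)
    (hk : ∀ n : ℕ, IsMollifier J (1 / ((n : ℝ) + 1)) (k n)) {z : Plane → ℝ} (hz : Measurable z)
    (hC : ∀ x, |z x| ≤ C) (hM : Ctrl μ M z) (n : ℕ) :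
    ∫ x, |IsField.commutator v (k n) z x| ∂μ
      ≤ (ENNReal.ofReal (4 * K * J) * (2 * ENNReal.ofReal M)).toReal := by
  rw [integral_abs_eq_toReal (integrable_commutator hv hk hz hC hM n).1]
  refine ENNReal.toReal_mono ?_ (lintegral_commutator_le_of_ctrl hv hk hz hC hM n)
  exact (ENNReal.mul_lt_top (by simp) (ENNReal.mul_lt_top (by simp) (by simp))).ne

lemma tendsto_integral_abs_commutator {v : Plane → Plane} (hv : IsField K L v)
    (hk : ∀ n : ℕ, IsMollifier J (1 / ((n : ℝ) + 1)) (k n)) {z : Plane → ℝ} (hz : Measurable z)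
    (hC : ∀ x, |z x| ≤ C) (hM : Ctrl μ M z) (ht : TransCont μ z) :
    Tendsto (fun n => ∫ x, |IsField.commutator v (k n) z x| ∂μ) atTop (𝓝 0) := by
  have h := (ENNReal.tendsto_toReal ENNReal.zero_ne_top).comp
    (tendsto_lintegral_commutator hv hk hz hC ht)
  simp only [ENNReal.toReal_zero] at h
  refine h.congr fun n => ?_
  rw [integral_abs_eq_toReal (integrable_commutator hv hk hz hC hM n).1]
  rfl

lemma Profile.integrable_comp (hB : Profile B B1 B2 C L') {μ : Measure Plane} {w : Plane → ℝ}
    (hw : Integrable w μ) (hC : ∀ x, |w x| ≤ C) : Integrable (fun x => B (w x)) μ :=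
  Integrable.mono' (hw.abs.const_mul L') (hB.continuous_zero.comp_aestronglyMeasurable hw.1)
    (ae_of_all _ fun x => hB.abs_le (hC x))

lemma tendsto_of_lintegral_sub {F : ℕ → Plane → ℝ} {f : Plane → ℝ} {μ : Measure Plane}
    (hF : ∀ n, Integrable (F n) μ) (hf : Integrable f μ) {G : ℕ → ℝ≥0∞}
    (hG : ∀ n, ∫⁻ x, ‖F n x - f x‖ₑ ∂μ ≤ G n) (ht : Tendsto G atTop (𝓝 0)) :
    Tendsto (fun n => ∫ x, F n x ∂μ) atTop (𝓝 (∫ x, f x ∂μ)) :=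
  tendsto_integral_of_L1 f hf.1 (Eventually.of_forall hF)
    (tendsto_of_tendsto_of_tendsto_of_le_of_le tendsto_const_nhds ht (fun _ => zero_le) hG)

/-- Mollification preserves the bound `C`, and `B` is Lipschitz on [-C, C]; the error is thus at
most a constant times the L¹ mollification error. -/
lemma tendsto_integral_profile (hk : ∀ n : ℕ, IsMollifier J (1 / ((n : ℝ) + 1)) (k n))
    (hB : Profile B B1 B2 C L') {z : Plane → ℝ} (hz : Measurable z)
    (hC : ∀ x, |z x| ≤ C) (hM : Ctrl μ M z) (ht : TransCont μ z) {ρ : Plane → ℝ}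
    (hρ : Measurable ρ) (hρ1 : ∀ x, |ρ x| ≤ 1) :
    Tendsto (fun n => ∫ x, ρ x * B (cv (k n) z x) ∂μ) atTop (𝓝 (∫ x, ρ x * B (z x) ∂μ)) := by
  refine tendsto_of_lintegral_sub (G := fun n => ENNReal.ofReal L' *
    ∫⁻ x, ‖cv (k n) z x - z x‖ₑ ∂μ) (fun n => ?_) ?_ (fun n => ?_) ?_
  · exact (hB.integrable_comp (integrable_cv (hk n).isTest (mollifier_support_one hk n) hz hC hM)
      fun x => abs_cv_mollifier_le (hk n) hC x).bdd_mul (c := 1) hρ.aestronglyMeasurable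
      (ae_of_all _ hρ1)
  · exact (hB.integrable_comp (hM.integrable hz) hC).bdd_mul (c := 1) hρ.aestronglyMeasurable
      (ae_of_all _ hρ1)
  · rw [← lintegral_const_mul' _ _ ENNReal.ofReal_ne_top]
    refine lintegral_mono fun x => ?_
    have h1 := hB.abs_sub_le (abs_cv_mollifier_le (hk n) hC x) (hC x)
    have hL : 0 ≤ L' := hB.L_nonneg ((abs_nonneg _).trans (hC 0))
    rw [Real.enorm_eq_ofReal_abs, Real.enorm_eq_ofReal_abs, ← ENNReal.ofReal_mul hL, ← mul_sub,
      abs_mul]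
    refine ENNReal.ofReal_le_ofReal ?_
    calc _ ≤ 1 * |B (cv (k n) z x) - B (z x)| := by gcongr; exact hρ1 x
      _ ≤ _ := by rw [one_mul]; exact h1
  · simpa using ENNReal.Tendsto.const_mul (tendsto_lintegral_cv_sub hk hz hC ht)
      (Or.inr ENNReal.ofReal_ne_top) (a := ENNReal.ofReal L')

/-- Write the difference as B'(z_n)(g_n - g) + (B'(z_n) - B'(z)) g: in each product one factor is
bounded and the other tends to zero in L¹. -/
lemma tendsto_integral_profile_mul (hk : ∀ n : ℕ, IsMollifier J (1 / ((n : ℝ) + 1)) (k n))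
    (hB : Profile B B1 B2 C L') {z g : Plane → ℝ} (hz : Measurable z)
    (hC : ∀ x, |z x| ≤ C) (ht : TransCont μ z) (hg : Measurable g)
    (hgC : ∀ x, |g x| ≤ C) (hgM : Ctrl μ M g) (hgt : TransCont μ g) {ρ : Plane → ℝ}
    (hρ : Measurable ρ) (hρ1 : ∀ x, |ρ x| ≤ 1) :
    Tendsto (fun n => ∫ x, ρ x * (B1 (cv (k n) z x) * cv (k n) g x) ∂μ) atTop
      (𝓝 (∫ x, ρ x * (B1 (z x) * g x) ∂μ)) := by
  have hC0 : 0 ≤ C := (abs_nonneg _).trans (hC 0)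
  have hL : 0 ≤ L' := hB.L_nonneg hC0
  have hcc : ∀ n, Continuous (cv (k n) z) := fun n => (contDiff_cv (hk n).isTest hz hC).continuous
  refine tendsto_of_lintegral_sub (G := fun n => ENNReal.ofReal L' *
    ∫⁻ x, ‖cv (k n) g x - g x‖ₑ ∂μ + ENNReal.ofReal (L' * C) *
    ∫⁻ x, ‖cv (k n) z x - z x‖ₑ ∂μ) (fun n => ?_) ?_ (fun n => ?_) ?_
  · exact ((integrable_cv (hk n).isTest (mollifier_support_one hk n) hg hgC hgM).bdd_mul
      (c := L') (hB.continuous_one.comp (hcc n)).aestronglyMeasurable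
      (ae_of_all _ fun x => hB.bound _ (abs_cv_mollifier_le (hk n) hC x))).bdd_mul (c := 1)
      hρ.aestronglyMeasurable (ae_of_all _ hρ1)
  · exact ((hgM.integrable hg).bdd_mul
      (c := L') (hB.continuous_one.measurable.comp hz).aestronglyMeasurable
      (ae_of_all _ fun x => hB.bound _ (hC x))).bdd_mul (c := 1)
      hρ.aestronglyMeasurable (ae_of_all _ hρ1)
  · have hmg : Measurable fun x => ‖cv (k n) g x - g x‖ₑ :=
      ((contDiff_cv (hk n).isTest hg hgC).continuous.measurable.sub hg).enorm
    rw [← lintegral_const_mul' _ _ ENNReal.ofReal_ne_top,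
      ← lintegral_const_mul' _ _ ENNReal.ofReal_ne_top,
      ← lintegral_add_left (hmg.const_mul _)]
    refine lintegral_mono fun x => ?_
    have h1 := hB.abs_sub_le' (abs_cv_mollifier_le (hk n) hC x) (hC x)
    have h2 := hB.bound _ (abs_cv_mollifier_le (hk n) hC x)
    simp only [Real.enorm_eq_ofReal_abs]
    rw [← ENNReal.ofReal_mul hL, ← ENNReal.ofReal_mul (by positivity),
      ← ENNReal.ofReal_add (by positivity) (by positivity)]
    refine ENNReal.ofReal_le_ofReal ?_
    rw [← mul_sub, abs_mul]
    have e : B1 (cv (k n) z x) * cv (k n) g x - B1 (z x) * g x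
        = B1 (cv (k n) z x) * (cv (k n) g x - g x) + (B1 (cv (k n) z x) - B1 (z x)) * g x := by ring
    calc _ ≤ 1 * |B1 (cv (k n) z x) * cv (k n) g x - B1 (z x) * g x| := by gcongr; exact hρ1 x
      _ ≤ |B1 (cv (k n) z x)| * |cv (k n) g x - g x|
          + |B1 (cv (k n) z x) - B1 (z x)| * |g x| := by
          rw [one_mul, e, ← abs_mul, ← abs_mul]; exact abs_add_le _ _
      _ ≤ L' * |cv (k n) g x - g x| + (L' * |cv (k n) z x - z x|) * C := by
          gcongr
          exact hgC x
      _ = _ := by ring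
  · have h1 := ENNReal.Tendsto.const_mul (tendsto_lintegral_cv_sub hk hg hgC hgt)
      (Or.inr ENNReal.ofReal_ne_top) (a := ENNReal.ofReal L')
    have h2 := ENNReal.Tendsto.const_mul (tendsto_lintegral_cv_sub hk hz hC ht)
      (Or.inr ENNReal.ofReal_ne_top) (a := ENNReal.ofReal (L' * C))
    simpa using h1.add h2

end Limits

lemma measurable_commutator_uncurry {v : Plane → Plane} {K L : ℝ} (hv : IsField K L v)
    {k : Plane → ℝ} (hk : IsTest k) {z : ℝ → Plane → ℝ} (hz : Measurable (Function.uncurry z))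
    {C : ℝ} (hC : ∀ s x, |z s x| ≤ C) :
    Measurable (Function.uncurry fun s x => IsField.commutator v k (z s) x) := by
  unfold IsField.commutator
  refine Finset.measurable_fun_sum _ fun i _ => ?_
  have h1 : Measurable (cv k fun x => v x i) :=
    (contDiff_cv hk (hv.measurable_apply i) (hv.abs_apply_le i)).continuous.measurable
  have h2 : Measurable (Function.uncurry fun s x => pd i (cv k (z s)) x) := by
    have : ∀ s, pd i (cv k (z s)) = cv (pd i k) (z s) := fun s =>
      pd_cv hk (hz.comp measurable_prodMk_left) (hC s) i
    simp only [this]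
    exact measurable_cv_uncurry (hk.pd i).continuous.measurable hz
  have h3 : Measurable (Function.uncurry fun s x => cv (pd i k) (fun y => z s y * v y i) x) :=
    measurable_cv_uncurry (hk.pd i).continuous.measurable
      (hz.mul ((hv.measurable_apply i).comp measurable_snd))
  exact ((h1.comp measurable_snd).mul h2).sub h3

lemma measurable_integral_of_uncurry {μ : Measure Plane} [SFinite μ] {F : ℝ → Plane → ℝ}
    (hF : Measurable (Function.uncurry F)) : Measurable fun s => ∫ x, F s x ∂μ :=
  (hF.stronglyMeasurable.integral_prod_right (ν := μ)).measurable

namespace WSol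

variable {v : Plane → Plane} {τ C K L : ℝ} {g : ℝ → Plane → ℝ} {z0 : Plane → ℝ}
  {z : ℝ → Plane → ℝ} {B B1 B2 : ℝ → ℝ} {L' : ℝ}

/-- Splitting of the right-hand side of the mollified equation, tested with `ρ B'(w)`. -/
lemma integral_mollifiedRHS_eq (h : WSol v τ C g z0 z) (hv : IsField K L v) {μ : Measure Plane}
    [SFinite μ] {M J : ℝ} (hM : ∀ s, Ctrl μ M (z s)) (hg : ∀ s, Ctrl μ M (g s))
    {k : ℕ → Plane → ℝ} (hk : ∀ n : ℕ, IsMollifier J (1 / ((n : ℝ) + 1)) (k n)) (n : ℕ)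
    (hB : Profile B B1 B2 C L') {ρ : Plane → ℝ} (hρ : Measurable ρ) (hρ1 : ∀ x, |ρ x| ≤ 1) (s : ℝ) :
    ∫ x, ρ x * (B1 (cv (k n) (z s) x) * mollifiedRHS v (k n) (z s) (g s) x) ∂μ
      = ∫ x, ρ x * (B1 (cv (k n) (z s) x) * (∑ i, pd i (pd i (cv (k n) (z s))) x
        - ∑ i, cv (k n) (fun x => v x i) x * pd i (cv (k n) (z s)) x)) ∂μ
      + ∫ x, ρ x * (B1 (cv (k n) (z s) x) * IsField.commutator v (k n) (z s) x) ∂μ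
      + ∫ x, ρ x * (B1 (cv (k n) (z s) x) * cv (k n) (g s) x) ∂μ := by
  have hs := mollifier_support_one hk n
  have hs' := fun i => pd_eq_zero_of_support hs i
  have hz := h.measurable_apply s
  have hkt := (hk n).isTest
  have hw := contDiff_cv hkt hz (h.bound s)
  have key : ∀ f : Plane → ℝ, Integrable f μ →
      Integrable (fun x => ρ x * (B1 (cv (k n) (z s) x) * f x)) μ := fun f hf =>
    (hf.bdd_mul (c := L') (hB.continuous_one.comp hw.continuous).aestronglyMeasurable
      (ae_of_all _ fun x => hB.bound _ (abs_cv_mollifier_le (hk n) (h.bound s) x))).bdd_mul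
      (c := 1) hρ.aestronglyMeasurable (ae_of_all _ hρ1)
  have i1 : ∀ i, Integrable (pd i (pd i (cv (k n) (z s)))) μ := fun i => by
    rw [pd_cv hkt hz (h.bound s), pd_cv (hkt.pd i) hz (h.bound s)]
    exact integrable_cv ((hkt.pd i).pd i) (pd_eq_zero_of_support (hs' i) i) hz (h.bound s) (hM s)
  have i2 : ∀ i, Integrable (fun x => cv (k n) (fun x => v x i) x * pd i (cv (k n) (z s)) x) μ :=
    fun i => by
      rw [pd_cv hkt hz (h.bound s)]
      exact (integrable_cv (hkt.pd i) (hs' i) hz (h.bound s) (hM s)).bdd_mul (c := L)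
        (contDiff_cv hkt (hv.measurable_apply i) (hv.abs_apply_le i)).continuous.aestronglyMeasurable
        (ae_of_all _ fun x => abs_cv_mollifier_le (hk n) (hv.abs_apply_le i) x)
  have i3 := integrable_commutator hv hk hz (h.bound s) (hM s) n
  have i4 := integrable_cv hkt hs (h.measurable_source_apply s) (h.bound_source s) (hg s)
  have i5 : Integrable (fun x => ∑ i, pd i (pd i (cv (k n) (z s))) x
        - ∑ i, cv (k n) (fun x => v x i) x * pd i (cv (k n) (z s)) x) μ :=
    (integrable_finsetSum _ fun i _ => i1 i).sub (integrable_finsetSum _ fun i _ => i2 i)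
  rw [← integral_add (key _ i5) (key _ i3),
    ← integral_add ((key _ i5).fun_add (key _ i3)) (key _ i4)]
  refine integral_congr_ae (ae_of_all _ fun x => ?_)
  simp only [h.mollifiedRHS_eq hkt]
  ring

lemma abs_integral_commutator_le (h : WSol v τ C g z0 z) (hv : IsField K L v) {μ : Measure Plane}
    [SFinite μ] {M J : ℝ} (hM : ∀ s, Ctrl μ M (z s))
    {k : ℕ → Plane → ℝ} (hk : ∀ n : ℕ, IsMollifier J (1 / ((n : ℝ) + 1)) (k n)) (n : ℕ)
    (hB : Profile B B1 B2 C L') {ρ : Plane → ℝ} (hρ1 : ∀ x, |ρ x| ≤ 1) (s : ℝ) :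
    ∫ x, ρ x * (B1 (cv (k n) (z s) x) * IsField.commutator v (k n) (z s) x) ∂μ
      ≤ L' * ∫ x, |IsField.commutator v (k n) (z s) x| ∂μ := by
  rw [← integral_const_mul]
  refine (le_abs_self _).trans ?_
  rw [← Real.norm_eq_abs]
  refine norm_integral_le_of_norm_le
    ((integrable_commutator hv hk (h.measurable_apply s) (h.bound s) (hM s) n).abs.const_mul _)
    (ae_of_all _ fun x => ?_)
  have h1 := hB.bound _ (abs_cv_mollifier_le (hk n) (h.bound s) x)
  have hL := hB.L_nonneg h.C_nonneg
  rw [Real.norm_eq_abs, abs_mul, abs_mul]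
  calc _ ≤ 1 * (L' * |IsField.commutator v (k n) (z s) x|) := by
        gcongr
        exact hρ1 x
    _ = _ := one_mul _

end WSol

/-! ### The energy inequality and the comparison principle -/

lemma abs_integral_le_of_bdd {μ : Measure Plane} [IsFiniteMeasure μ] {f : Plane → ℝ} {b : ℝ}
    (hf : ∀ x, |f x| ≤ b) : |∫ x, f x ∂μ| ≤ b * μ.real univ := by
  rw [← Real.norm_eq_abs]
  exact norm_integral_le_of_norm_le_const (ae_of_all _ hf)

namespace WSol

variable {v : Plane → Plane} {τ C K L : ℝ} {g : ℝ → Plane → ℝ} {z0 : Plane → ℝ}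
  {z : ℝ → Plane → ℝ} {B B1 B2 : ℝ → ℝ} {L' : ℝ}

/-- Localized entropy inequality for a convex nondecreasing profile that controls the source. -/
lemma integral_test_le (h : WSol v τ C g z0 z) (hv : IsField K L v)
    (hB : Profile B B1 B2 C L') (hB0 : ∀ x, 0 ≤ B x) (hB2 : ∀ x, 0 ≤ B2 x)
    (hz0 : ∀ x, B (z0 x) = 0) {Q : ℝ}
    (hg : ∀ s ∈ Icc 0 τ, ∀ x, B1 (z s x) * g s x ≤ Q * B (z s x)) (hQ : 0 ≤ Q)
    {ρ : Plane → ℝ} (hρ : IsTest ρ) (hρ0 : ∀ x, 0 ≤ ρ x) (hρ1 : ∀ x, ρ x ≤ 1) {R : ℝ}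
    (hρR : tsupport ρ ⊆ Metric.ball 0 R) {A : ℝ}
    (hA : ∀ x, ∑ i, |pd i (pd i ρ) x| + ∑ i, L * |pd i ρ x| ≤ A) {t : ℝ} (ht : t ∈ Icc 0 τ) :
    ∫ x, ρ x * B (z t x) ≤ (A + Q) * ∫ s in (0:ℝ)..t, ∫ x in Metric.ball 0 R, B (z s x) := by
  obtain ⟨J, k, hJ, hk⟩ := exists_mollifier_seq
  set S : Set Plane := Metric.ball 0 R with hS
  set μ : Measure Plane := volume.restrict S with hμ
  set M : ℝ := C * volume.real S with hM
  have hC0 := h.C_nonneg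
  have hL' := hB.L_nonneg hC0
  have hL0 : 0 ≤ L := (norm_nonneg _).trans (hv.bdd 0)
  have hA0 : 0 ≤ A := le_trans (by positivity) (hA 0)
  have hzm := h.measurable_apply
  have hgm := h.measurable_source_apply
  have cz : ∀ s, Ctrl μ M (z s) := fun s => ctrl_ball (h.bound s) R
  have cg : ∀ s, Ctrl μ M (g s) := fun s => ctrl_ball (h.bound_source s) R
  have tz : ∀ s, TransCont μ (z s) := fun s => transCont_ball (hzm s) (h.bound s) R
  have tg : ∀ s, TransCont μ (g s) := fun s => transCont_ball (hgm s) (h.bound_source s) R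
  have hρm : Measurable ρ := hρ.continuous.measurable
  have hρ1' : ∀ x, |ρ x| ≤ 1 := fun x => by rw [abs_of_nonneg (hρ0 x)]; exact hρ1 x
  have hone : ∀ x : Plane, |(1:ℝ)| ≤ 1 := fun _ => by simp
  -- The L¹ theory is run on the finite measure of the ball, the integration by parts on the whole
  -- plane. The support of `ρ` makes the two compatible.
  have hrestr : ∀ f : Plane → ℝ, ∫ x, ρ x * f x ∂μ = ∫ x, ρ x * f x := fun f =>
    setIntegral_eq_integral_of_forall_compl_eq_zero fun x hx => by
      rw [image_eq_zero_of_notMem_tsupport fun hx' => hx (hρR hx'), zero_mul]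
  have hwb : ∀ n s x, |cv (k n) (z s) x| ≤ C := fun n s => abs_cv_mollifier_le (hk n) (h.bound s)
  have hwi : ∀ n s, Integrable (cv (k n) (z s)) μ := fun n s =>
    integrable_cv (hk n).isTest (mollifier_support_one hk n) (hzm s) (h.bound s) (cz s)
  have hmw : ∀ n, Measurable (Function.uncurry fun s x => cv (k n) (z s) x) := fun n =>
    measurable_cv_uncurry (hk n).isTest.continuous.measurable h.measurable
  have hmg : ∀ n, Measurable (Function.uncurry fun s x => cv (k n) (g s) x) := fun n =>
    measurable_cv_uncurry (hk n).isTest.continuous.measurable h.measurable_source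
  have hmB := hB.continuous_zero.measurable
  have hmB1 := hB.continuous_one.measurable
  -- the bound for the time derivative of the localized entropy
  let F : ℕ → ℝ → ℝ := fun n s => A * ∫ x, 1 * B (cv (k n) (z s) x) ∂μ
    + L' * ∫ x, |IsField.commutator v (k n) (z s) x| ∂μ
    + ∫ x, ρ x * (B1 (cv (k n) (z s) x) * cv (k n) (g s) x) ∂μ
  have hvol : μ.real univ = volume.real S := by simp [hμ]
  have : IsFiniteMeasure μ := ⟨by
    rw [hμ, Measure.restrict_apply_univ]; exact measure_ball_lt_top⟩
  have hkey := le_add_integral_of_tendsto (t := t)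
    (b := A * (L' * C * volume.real S) + L' * (ENNReal.ofReal (4 * K * J) *
      (2 * ENNReal.ofReal M)).toReal + L' * C * volume.real S)
    (Ynt := fun n => ∫ x, ρ x * B (cv (k n) (z t) x) ∂μ)
    (Yn0 := fun n => ∫ x, ρ x * B (cv (k n) z0 x) ∂μ)
    (I := fun n s => ∫ x, ρ x * (B1 (cv (k n) (z s) x) *
        mollifiedRHS v (k n) (z s) (g s) x) ∂μ) (F := F)
    (f := fun s => A * ∫ x, 1 * B (z s x) ∂μ + L' * 0 + ∫ x, ρ x * (B1 (z s x) * g s x) ∂μ)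
    (Yt := ∫ x, ρ x * B (z t x) ∂μ) (Y0 := ∫ x, ρ x * B (z0 x) ∂μ) ht.1
    (fun n => (h.integral_profile_cv hv cz cg (ctrl_ball h.bound_zero R)
      (by rw [div_le_one (by positivity)]; linarith [(Nat.cast_nonneg n : (0:ℝ) ≤ n)])
      (hk n) hB hρm hρ1' ht).2)
    (fun n => (h.integral_profile_cv hv cz cg (ctrl_ball h.bound_zero R)
      (by rw [div_le_one (by positivity)]; linarith [(Nat.cast_nonneg n : (0:ℝ) ≤ n)])
      (hk n) hB hρm hρ1' ht).1)
    ?_ ?_ ?_ ?_ ?_ ?_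
  · rw [hrestr] at hkey
    have hz : ∫ x, ρ x * B (z0 x) ∂μ = 0 := by simp [hz0]
    rw [hz, zero_add] at hkey
    have hBi : ∀ s, Integrable (fun x => B (z s x)) μ := fun s =>
      hB.integrable_comp ((cz s).integrable (hzm s)) (h.bound s)
    have hmBz : Measurable (Function.uncurry fun s x => B (z s x)) := hmB.comp h.measurable
    have hYm : Measurable fun s => ∫ x, B (z s x) ∂μ := measurable_integral_of_uncurry hmBz
    have hBb : ∀ s x, |B (z s x)| ≤ L' * C := fun s x =>
      (hB.abs_le (h.bound s x)).trans (by gcongr; exact h.bound s x)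
    have hYb : ∀ s, |∫ x, B (z s x) ∂μ| ≤ L' * C * volume.real S := fun s => by
      rw [← hvol]
      exact abs_integral_le_of_bdd (hBb s)
    refine hkey.trans ?_
    rw [← intervalIntegral.integral_const_mul]
    refine intervalIntegral.integral_mono_on ht.1 ?_ ?_ fun s hs => ?_
    · rw [intervalIntegrable_iff]
      have m1 : Measurable fun s => A * ∫ x, 1 * B (z s x) ∂μ + L' * 0
          + ∫ x, ρ x * (B1 (z s x) * g s x) ∂μ := by
        simp only [one_mul]
        refine ((hYm.const_mul A).add_const _).add (measurable_integral_of_uncurry ?_)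
        exact (hρm.comp measurable_snd).mul ((hmB1.comp h.measurable).mul h.measurable_source)
      refine Measure.integrableOn_of_bounded (M := A * (L' * C * volume.real S)
        + L' * C * volume.real S) (by simp) m1.aestronglyMeasurable (ae_of_all _ fun s => ?_)
      simp only [one_mul, mul_zero, add_zero]
      refine (norm_add_le _ _).trans (add_le_add ?_ ?_)
      · rw [norm_mul, Real.norm_of_nonneg hA0]
        gcongr
        exact hYb s
      · rw [← hvol]
        refine norm_integral_le_of_norm_le_const (ae_of_all _ fun x => ?_)
        rw [Real.norm_eq_abs, abs_mul, abs_mul]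
        calc _ ≤ 1 * (L' * C) := by
              gcongr
              · exact hρ1' x
              · exact hB.bound _ (h.bound s x)
              · exact h.bound_source s x
          _ = _ := one_mul _
    · rw [intervalIntegrable_iff]
      refine Measure.integrableOn_of_bounded (M := (A + Q) * (L' * C * volume.real S)) (by simp)
        (hYm.const_mul _).aestronglyMeasurable (ae_of_all _ fun s => ?_)
      rw [norm_mul, Real.norm_of_nonneg (by positivity)]
      gcongr
      exact hYb s
    · simp only [one_mul, mul_zero, add_zero]
      rw [add_mul]
      gcongr
      rw [← integral_const_mul]
      refine integral_mono ?_ ((hBi s).const_mul Q) fun x => ?_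
      · exact ((((cg s).integrable (hgm s)).bdd_mul (c := L')
          (hmB1.comp (hzm s)).aestronglyMeasurable
          (ae_of_all _ fun x => hB.bound _ (h.bound s x)))).bdd_mul (c := 1)
          hρm.aestronglyMeasurable (ae_of_all _ hρ1')
      · have h1 := hg s ⟨hs.1, hs.2.trans ht.2⟩ x
        have h2 : 0 ≤ Q * B (z s x) := mul_nonneg hQ (hB0 _)
        calc ρ x * (B1 (z s x) * g s x) ≤ ρ x * (Q * B (z s x)) := by
              gcongr
              exact hρ0 x
          _ ≤ 1 * (Q * B (z s x)) := by gcongr; exact hρ1 x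
          _ = _ := one_mul _
  · intro n s _
    simp only [F]
    rw [h.integral_mollifiedRHS_eq hv cz cg hk n hB hρm hρ1' s]
    gcongr
    · rw [hrestr]
      refine (integral_test_transport_diffusion_le hB hB2 hρ hρ0
        (contDiff_cv (hk n).isTest (hzm s) (h.bound s))
        (V := fun i => cv (k n) (fun x => v x i))
        (fun i => contDiff_cv (hk n).isTest (hv.measurable_apply i) (hv.abs_apply_le i))
        (hv.sum_pd_cv (hk n).isTest)).trans ?_
      have hpz : ∀ f : Plane → ℝ, (∀ x, x ∉ S → f x = 0) →
          ∫ x, f x = ∫ x, f x ∂μ := fun f hf =>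
        (setIntegral_eq_integral_of_forall_compl_eq_zero hf).symm
      have hsupp : ∀ x, x ∉ tsupport ρ → ∑ i, pd i (pd i ρ) x
          + ∑ i, cv (k n) (fun x => v x i) x * pd i ρ x = 0 := by
        intro x hx
        have e0 : ρ =ᶠ[𝓝 x] 0 := notMem_tsupport_iff_eventuallyEq.1 hx
        have e1 : ∀ i, pd i ρ =ᶠ[𝓝 x] 0 := fun i => by
          filter_upwards [e0.eventuallyEq_nhds] with y hy
          simp [pd, hy.fderiv_eq]
        have e2 : ∀ i, pd i (pd i ρ) x = 0 := fun i => by simp [pd, (e1 i).fderiv_eq]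
        simp [e2, (e1 _).eq_of_nhds]
      have hcont : Continuous fun x => ∑ i, pd i (pd i ρ) x
          + ∑ i, cv (k n) (fun x => v x i) x * pd i ρ x := by
        have h1 : ∀ i, Continuous (pd i ρ) := fun i => (hρ.pd i).continuous
        have h2 : ∀ i, Continuous (pd i (pd i ρ)) := fun i => ((hρ.pd i).pd i).continuous
        have h3 : ∀ i, Continuous (cv (k n) (fun x => v x i)) := fun i =>
          (contDiff_cv (hk n).isTest (hv.measurable_apply i) (hv.abs_apply_le i)).continuous
        fun_prop
      -- The mollified field obeys the same bound `L` as the field, so `A` does not depend on n.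
      have hle : ∀ x, |∑ i, pd i (pd i ρ) x + ∑ i, cv (k n) (fun x => v x i) x * pd i ρ x| ≤ A := by
        intro x
        refine le_trans ((abs_add_le _ _).trans (add_le_add (Finset.abs_sum_le_sum_abs _ _)
          ((Finset.abs_sum_le_sum_abs _ _).trans (Finset.sum_le_sum fun i _ => ?_)))) (hA x)
        rw [abs_mul]
        gcongr
        exact abs_cv_mollifier_le (hk n) (hv.abs_apply_le i) x
      have hzS : ∀ x, x ∉ S → B (cv (k n) (z s) x) * (∑ i, pd i (pd i ρ) x
          + ∑ i, cv (k n) (fun x => v x i) x * pd i ρ x) = 0 := by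
        intro x hx
        rw [hsupp x fun hx' => hx (hρR hx'), mul_zero]
      rw [hpz _ hzS]
      rw [← integral_const_mul]
      refine integral_mono ?_ ((hB.integrable_comp (hwi n s) (hwb n s)).const_mul A |>.congr
        (ae_of_all _ fun x => by simp)) fun x => ?_
      · refine (hB.integrable_comp (hwi n s) (hwb n s)).mul_bdd (c := A) hcont.aestronglyMeasurable
          (ae_of_all _ hle)
      · simp only [one_mul]
        rw [mul_comm A]
        exact mul_le_mul_of_nonneg_left ((le_abs_self _).trans (hle x)) (hB0 _)
    · exact h.abs_integral_commutator_le hv cz hk n hB hρ1' s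
  · intro n
    refine ((Measurable.const_mul (measurable_integral_of_uncurry ?_) A).add
      (Measurable.const_mul (measurable_integral_of_uncurry ?_) L')).add
      (measurable_integral_of_uncurry ?_)
    · exact (hmB.comp (hmw n)).const_mul 1
    · exact (measurable_commutator_uncurry hv (hk n).isTest h.measurable h.bound).abs
    · exact (hρm.comp measurable_snd).mul ((hmB1.comp (hmw n)).mul (hmg n))
  · intro n s
    simp only [F]
    refine (abs_add_three _ _ _).trans (add_le_add_three ?_ ?_ ?_)
    · rw [abs_mul, abs_of_nonneg hA0, ← hvol]
      gcongr
      refine abs_integral_le_of_bdd fun x => ?_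
      rw [one_mul]
      exact (hB.abs_le (hwb n s x)).trans (by gcongr; exact hwb n s x)
    · rw [abs_mul, abs_of_nonneg hL', abs_of_nonneg (by positivity)]
      gcongr
      exact integral_abs_commutator_le hv hk (hzm s) (h.bound s) (cz s) n
    · rw [← hvol]
      refine abs_integral_le_of_bdd fun x => ?_
      rw [abs_mul, abs_mul]
      calc _ ≤ 1 * (L' * C) := by
            gcongr
            · exact hρ1' x
            · exact hB.bound _ (hwb n s x)
            · exact abs_cv_mollifier_le (hk n) (h.bound_source s) x
        _ = _ := one_mul _
  · intro s
    refine ((Tendsto.const_mul A (tendsto_integral_profile hk hB (hzm s) (h.bound s) (cz s) (tz s)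
      measurable_const hone)).add (Tendsto.const_mul L' (tendsto_integral_abs_commutator hv hk
      (hzm s) (h.bound s) (cz s) (tz s)))).add ?_
    exact tendsto_integral_profile_mul hk hB (hzm s) (h.bound s) (tz s) (hgm s) (h.bound_source s)
      (cg s) (tg s) hρm hρ1'
  · exact tendsto_integral_profile hk hB (hzm t) (h.bound t) (cz t) (tz t) hρm hρ1'
  · exact tendsto_integral_profile hk hB h.measurable_zero h.bound_zero
      (ctrl_ball h.bound_zero R) (transCont_ball h.measurable_zero h.bound_zero R) hρm hρ1'

end WSol

/-! ### Cutoffs on dyadic balls and the truncation profile -/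

section Cutoff

lemma pd_comp_smul {f : Plane → ℝ} (hf : ContDiff ℝ ∞ f) (c : ℝ) (i : Fin 2) :
    pd i (fun y => f (c • y)) = fun y => c * pd i f (c • y) := by
  funext y
  have h1 := (hf.differentiable (by simp) (c • y)).hasFDerivAt
  have h2 : HasFDerivAt (fun y : Plane => c • y) (c • ContinuousLinearMap.id ℝ Plane) y :=
    (c • ContinuousLinearMap.id ℝ Plane).hasFDerivAt
  have h3 := (h1.comp y h2).fderiv
  simp only [Function.comp_def] at h3
  simp [pd, h3]

lemma IsTest.exists_bound {f : Plane → ℝ} (hf : IsTest f) : ∃ b, ∀ x, |f x| ≤ b := by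
  obtain ⟨b, hb⟩ := hf.2.exists_bound_of_continuous hf.continuous
  exact ⟨b, hb⟩

/-- Cutoff functions adapted to dyadic balls, with uniformly bounded derivatives. -/
lemma exists_cutoff (L : ℝ) : ∃ A : ℝ, ∀ n : ℕ, ∃ χ : Plane → ℝ, IsTest χ ∧ (∀ x, 0 ≤ χ x) ∧
    (∀ x, χ x ≤ 1) ∧ (∀ x ∈ Metric.ball (0 : Plane) (2 ^ n), χ x = 1) ∧
    tsupport χ ⊆ Metric.ball 0 (2 ^ (n + 1)) ∧
    ∀ x, ∑ i, |pd i (pd i χ) x| + ∑ i, |L| * |pd i χ x| ≤ A := by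
  let b : ContDiffBump (0 : Plane) := ⟨1, 3 / 2, by norm_num, by norm_num⟩
  have hb : IsTest b := ⟨b.contDiff, b.hasCompactSupport⟩
  choose b1 hb1 using fun i => (hb.pd i).exists_bound
  choose b2 hb2 using fun i => ((hb.pd i).pd i).exists_bound
  refine ⟨∑ i, b2 i + ∑ i, |L| * b1 i, fun n => ⟨fun x => b ((2 ^ n : ℝ)⁻¹ • x), ⟨?_, ?_⟩,
    fun x => b.nonneg, fun x => b.le_one, fun x hx => ?_, ?_, fun x => ?_⟩⟩
  · exact hb.1.comp (contDiff_const_smul _)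
  · exact hb.2.comp_smul (by positivity)
  · refine b.one_of_mem_closedBall ?_
    rw [mem_ball_zero_iff] at hx
    rw [mem_closedBall_zero_iff, norm_smul, Real.norm_of_nonneg (by positivity), inv_mul_eq_div]
    exact (div_le_one (by positivity)).2 hx.le
  · have : tsupport (fun x => b ((2 ^ n : ℝ)⁻¹ • x)) ⊆ Metric.closedBall 0 (3 / 2 * 2 ^ n) := by
      refine closure_minimal (fun x hx => ?_) Metric.isClosed_closedBall
      rw [mem_closedBall_zero_iff]
      by_contra hlt
      refine hx (b.zero_of_le_dist ?_)
      rw [dist_zero_right, norm_smul, Real.norm_of_nonneg (by positivity), inv_mul_eq_div,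
        le_div_iff₀ (by positivity)]
      exact (not_le.1 hlt).le
    refine this.trans (Metric.closedBall_subset_ball ?_)
    rw [pow_succ]
    have : (0:ℝ) < 2 ^ n := by positivity
    linarith
  · have hc : |((2 ^ n : ℝ)⁻¹)| ≤ 1 := by
      rw [abs_of_pos (by positivity)]
      exact inv_le_one_of_one_le₀ (one_le_pow₀ (by norm_num))
    have e1 : ∀ i, |pd i (fun x => b ((2 ^ n : ℝ)⁻¹ • x)) x| ≤ b1 i := fun i => by
      rw [pd_comp_smul hb.1]
      simp only
      rw [abs_mul]
      calc _ ≤ 1 * b1 i := by gcongr; exact hb1 i _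
        _ = _ := one_mul _
    have e2 : ∀ i, |pd i (pd i (fun x => b ((2 ^ n : ℝ)⁻¹ • x))) x| ≤ b2 i := fun i => by
      have : ∀ (f : Plane → ℝ) (c : ℝ), ContDiff ℝ ∞ f →
          pd i (fun y => c * f (c • y)) = fun y => c * (c * pd i f (c • y)) := by
        intro f c hf
        funext y
        have hd : DifferentiableAt ℝ (fun y => f (c • y)) y :=
          (hf.comp (contDiff_const_smul c)).differentiable (by simp) y
        rw [pd_mul (by fun_prop) hd, pd_comp_smul hf]
        simp [pd]
      rw [pd_comp_smul hb.1, this _ _ (hb.pd i).1]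
      simp only
      rw [abs_mul, abs_mul]
      calc _ ≤ 1 * (1 * b2 i) := by gcongr; exact hb2 i _
        _ = _ := by ring
    gcongr with i _ i _
    · exact e2 i
    · exact e1 i

/-- The truncated fourth power. -/
lemma hasDerivAt_max_pow (a : ℝ) (n : ℕ) (x : ℝ) :
    HasDerivAt (fun x : ℝ => max (x - a) 0 ^ (n + 2)) ((n + 2) * max (x - a) 0 ^ (n + 1)) x := by
  rcases lt_trichotomy x a with hx | hx | hx
  · have : (fun x : ℝ => max (x - a) 0 ^ (n + 2)) =ᶠ[𝓝 x] fun _ => 0 := by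
      filter_upwards [Iio_mem_nhds hx] with y hy
      rw [max_eq_right (by linarith [mem_Iio.1 hy])]
      simp
    rw [max_eq_right (by linarith)]
    simpa using (hasDerivAt_const x (0:ℝ)).congr_of_eventuallyEq this
  · subst hx
    rw [hasDerivAt_iff_isLittleO]
    simp only [sub_self, max_self, ne_eq, Nat.add_eq_zero_iff, one_ne_zero, OfNat.ofNat_ne_zero,
      and_false, not_false_eq_true, zero_pow, sub_zero, mul_zero, smul_zero]
    have h1 : (fun y : ℝ => max (y - x) 0 ^ (n + 2)) =O[𝓝 x] fun y => (y - x) ^ (n + 2) := by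
      refine Asymptotics.IsBigO.of_bound 1 (Eventually.of_forall fun y => ?_)
      rw [norm_pow, norm_pow, one_mul]
      gcongr
      rw [Real.norm_eq_abs, Real.norm_eq_abs, abs_of_nonneg (le_max_right _ _)]
      exact max_le (le_abs_self _) (abs_nonneg _)
    refine h1.trans_isLittleO ?_
    have h2 := Asymptotics.isLittleO_pow_pow (𝕜 := ℝ) (m := 1) (n := n + 2) (by omega)
    have h3 : Tendsto (fun y : ℝ => y - x) (𝓝 x) (𝓝 0) := by
      have h4 : Continuous fun y : ℝ => y - x := by fun_prop
      simpa using h4.tendsto x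
    simpa [Function.comp_def] using h2.comp_tendsto h3
  · have : (fun x : ℝ => max (x - a) 0 ^ (n + 2)) =ᶠ[𝓝 x] fun y => (y - a) ^ (n + 2) := by
      filter_upwards [Ioi_mem_nhds hx] with y hy
      rw [max_eq_left (by linarith [mem_Ioi.1 hy])]
    rw [max_eq_left (by linarith)]
    have h := ((hasDerivAt_id x).sub_const a).pow (n + 2)
    refine (h.congr_of_eventuallyEq this).congr_deriv ?_
    simp

/-- This entropy vanishes exactly on (-∞, a], is convex, and is twice continuously differentiable at
a, which a square would not be. Since (x - a) B'(x) = 4 B(x), a source bounded by Q (z - a)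
contributes at most 4Q B(z). The one constant bounds both derivatives. -/
lemma profile_max {a C : ℝ} (ha : 0 ≤ a) (hC : 0 ≤ C) :
    Profile (fun x => max (x - a) 0 ^ 4) (fun x => 4 * max (x - a) 0 ^ 3)
      (fun x => 12 * max (x - a) 0 ^ 2) C (4 * C ^ 3 + 12 * C ^ 2) where
  hasDerivAt x := by
    refine (hasDerivAt_max_pow a 2 x).congr_deriv ?_
    norm_num
  hasDerivAt' x := by
    refine ((hasDerivAt_max_pow a 1 x).const_mul 4).congr_deriv ?_
    norm_num
    ring
  continuous := by fun_prop
  zero := by simp [ha]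
  bound x hx := by
    have h1 : max (x - a) 0 ≤ C := max_le (by linarith [(abs_le.1 hx).2]) hC
    have h0 : 0 ≤ max (x - a) 0 := le_max_right _ _
    rw [abs_of_nonneg (by positivity)]
    have := pow_le_pow_left₀ h0 h1 3
    nlinarith [sq_nonneg C]
  bound' x hx := by
    have h1 : max (x - a) 0 ≤ C := max_le (by linarith [(abs_le.1 hx).2]) hC
    have h0 : 0 ≤ max (x - a) 0 := le_max_right _ _
    rw [abs_of_nonneg (by positivity)]
    have := pow_le_pow_left₀ h0 h1 2
    have : 0 ≤ C ^ 3 := by positivity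
    linarith

end Cutoff

namespace WSol

variable {v : Plane → Plane} {τ C K L : ℝ} {g : ℝ → Plane → ℝ} {z0 : Plane → ℝ}
  {z : ℝ → Plane → ℝ}

/-- The comparison principle. -/
theorem le_of_source_le (h : WSol v τ C g z0 z) (hv : IsField K L v) {a Q : ℝ} (ha : 0 ≤ a)
    (hQ : 0 ≤ Q) (hz0 : ∀ x, z0 x ≤ a)
    (hg : ∀ s ∈ Icc 0 τ, ∀ x, a < z s x → g s x ≤ Q * (z s x - a)) {t : ℝ} (ht : t ∈ Icc 0 τ) :
    ∀ᵐ x, z t x ≤ a := by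
  have hC0 := h.C_nonneg
  have hL0 : 0 ≤ L := (norm_nonneg _).trans (hv.bdd 0)
  set B : ℝ → ℝ := fun x => max (x - a) 0 ^ 4 with hBdef
  have hB := profile_max ha hC0
  set L' := 4 * C ^ 3 + 12 * C ^ 2
  have hB0 : ∀ x, 0 ≤ B x := fun x => by simp only [hBdef]; positivity
  obtain ⟨A, hcut⟩ := exists_cutoff L
  choose χ hχ hχ0 hχ1 hχe hχs hχA using hcut
  have hA0 : 0 ≤ A := le_trans (by positivity) (hχA 0 0)
  -- Both sides vanish where z ≤ a, so the source has to be controlled only above the level a.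
  have hgB : ∀ s ∈ Icc 0 τ, ∀ x, 4 * max (z s x - a) 0 ^ 3 * g s x ≤ (4 * Q) * B (z s x) := by
    intro s hs x
    simp only [hBdef]
    rcases le_or_gt (z s x) a with hle | hlt
    · simp [max_eq_right (sub_nonpos.2 hle)]
    · rw [max_eq_left (by linarith)]
      have := hg s hs x hlt
      have h3 : 0 ≤ 4 * (z s x - a) ^ 3 := by
        have : 0 ≤ z s x - a := by linarith
        positivity
      calc _ ≤ 4 * (z s x - a) ^ 3 * (Q * (z s x - a)) := by gcongr
        _ = _ := by ring
  have hBi : ∀ n s, IntegrableOn (fun x => B (z s x)) (Metric.ball 0 (2 ^ n)) := fun n s =>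
    hB.integrable_comp ((ctrl_ball (h.bound s) _).integrable (h.measurable_apply s)) (h.bound s)
  set q := A + 4 * Q
  have hq : 0 ≤ q := by positivity
  have hYm : ∀ n : ℕ, Measurable fun s => ∫ x in Metric.ball 0 (2 ^ n), B (z s x) := fun n =>
    measurable_integral_of_uncurry (hB.continuous_zero.measurable.comp h.measurable)
  have hYb : ∀ (n : ℕ) s, |∫ x in Metric.ball 0 (2 ^ n), B (z s x)|
      ≤ L' * C * volume.real (Metric.ball (0 : Plane) (2 ^ n)) := by
    intro n s
    have : IsFiniteMeasure (volume.restrict (Metric.ball (0 : Plane) (2 ^ n))) := ⟨by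
      rw [Measure.restrict_apply_univ]; exact measure_ball_lt_top⟩
    have e := abs_integral_le_of_bdd (μ := volume.restrict (Metric.ball (0 : Plane) (2 ^ n)))
      (f := fun x => B (z s x)) (b := L' * C) fun x =>
        (hB.abs_le (h.bound s x)).trans (by
          have := hB.L_nonneg hC0
          gcongr; exact h.bound s x)
    simpa using e
  -- The entropy on a ball is controlled by the past entropy on the doubled ball, with a factor `q`
  -- independent of n because the cutoffs have uniformly bounded derivatives. No decay at infinity
  -- is used.
  have hstep : ∀ n : ℕ, ∀ t ∈ Icc 0 τ, ∫ x in Metric.ball 0 (2 ^ n), B (z t x)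
      ≤ q * ∫ s in (0:ℝ)..t, ∫ x in Metric.ball 0 (2 ^ (n + 1)), B (z s x) := by
    intro n t ht
    have h1 := h.integral_test_le hv hB hB0 (fun x => by positivity)
      (fun x => by simp [max_eq_right (sub_nonpos.2 (hz0 x))]) hgB (by positivity) (hχ n) (hχ0 n)
      (hχ1 n) (hχs n) (A := A) (fun x => by simpa [abs_of_nonneg hL0] using hχA n x) ht
    refine le_trans ?_ h1
    have e : ∫ x in Metric.ball 0 (2 ^ n), B (z t x)
        = ∫ x in Metric.ball 0 (2 ^ n), χ n x * B (z t x) :=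
      setIntegral_congr_fun measurableSet_ball fun x hx => by
        simp only [hχe n x hx, one_mul]
    rw [e]
    refine setIntegral_le_integral ?_ (ae_of_all _ fun x => mul_nonneg (hχ0 n x) (hB0 _))
    have hm : Measurable fun x => B (z t x) :=
      hB.continuous_zero.measurable.comp (h.measurable_apply t)
    have := (hχ n).integrable_mul hm (C := L' * C) fun x =>
        (hB.abs_le (h.bound t x)).trans (by
          have := hB.L_nonneg hC0
          gcongr; exact h.bound t x)
    simpa only [mul_comm] using this
  set c0 := L' * C * volume.real (Metric.ball (0 : Plane) 1) with hc0
  have hvol : ∀ n : ℕ, L' * C * volume.real (Metric.ball (0 : Plane) (2 ^ n)) = c0 * 4 ^ n := by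
    intro n
    have : volume.real (Metric.ball (0 : Plane) (2 ^ n))
        = 4 ^ n * volume.real (Metric.ball (0 : Plane) 1) := by
      rw [Measure.real, Measure.addHaar_ball _ _ (by positivity), ENNReal.toReal_mul,
        ENNReal.toReal_ofReal (by positivity), Measure.real]
      congr 1
      simp [← pow_mul, mul_comm n 2]
      norm_num [pow_mul]
    rw [this, hc0]; ring
  -- After m doublings the crude bound has grown by the area factor 4^m, while m nested time
  -- integrations have produced t^m / m!. The factorial wins as m → ∞, and the entropy is zero.
  have hiter : ∀ m n : ℕ, ∀ t ∈ Icc 0 τ, ∫ x in Metric.ball 0 (2 ^ n), B (z t x)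
      ≤ c0 * 4 ^ (n + m) * (q ^ m * (t ^ m / m.factorial)) := by
    intro m
    induction m with
    | zero =>
      intro n t _
      simpa [hvol n] using (le_abs_self _).trans (hYb n t)
    | succ m ih =>
      intro n t ht
      refine (hstep n t ht).trans ?_
      have : ∫ s in (0:ℝ)..t, ∫ x in Metric.ball 0 (2 ^ (n + 1)), B (z s x)
          ≤ ∫ s in (0:ℝ)..t, c0 * 4 ^ (n + 1 + m) * (q ^ m * (s ^ m / m.factorial)) := by
        refine intervalIntegral.integral_mono_on ht.1 ?_ (by
          apply Continuous.intervalIntegrable; fun_prop) fun s hs =>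
          ih (n + 1) s ⟨hs.1, hs.2.trans ht.2⟩
        rw [intervalIntegrable_iff]
        exact Measure.integrableOn_of_bounded (by simp) (hYm _).aestronglyMeasurable
          (ae_of_all _ (hYb (n + 1)))
      refine (mul_le_mul_of_nonneg_left this hq).trans (le_of_eq ?_)
      rw [intervalIntegral.integral_const_mul, intervalIntegral.integral_const_mul,
        intervalIntegral.integral_div, integral_pow]
      rw [Nat.factorial_succ, show n + 1 + m = n + (m + 1) by ring]
      push_cast
      field_simp
      ring
  have hzero : ∀ n : ℕ, ∫ x in Metric.ball 0 (2 ^ n), B (z t x) = 0 := by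
    intro n
    refine le_antisymm ?_ (setIntegral_nonneg measurableSet_ball fun x _ => hB0 _)
    have hlim := (FloorSemiring.tendsto_pow_div_factorial_atTop (4 * q * t)).const_mul (c0 * 4 ^ n)
    rw [mul_zero] at hlim
    refine ge_of_tendsto' hlim fun m => (hiter m n t ht).trans (le_of_eq ?_)
    rw [mul_pow, mul_pow, pow_add]
    ring
  have hae : ∀ n : ℕ, ∀ᵐ x, x ∈ Metric.ball (0 : Plane) (2 ^ n) → z t x ≤ a := by
    intro n
    have := (setIntegral_eq_zero_iff_of_nonneg_ae (ae_of_all _ fun x => hB0 _) (hBi n t)).1 (hzero n)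
    rw [Filter.EventuallyEq, ae_restrict_iff' measurableSet_ball] at this
    filter_upwards [this] with x hx hxb
    have h4 : max (z t x - a) 0 ^ 4 = 0 := hx hxb
    have h5 := pow_eq_zero_iff (by norm_num) |>.1 h4
    have := le_max_left (z t x - a) 0
    linarith
  filter_upwards [ae_all_iff.2 hae] with x hx
  obtain ⟨n, hn⟩ := pow_unbounded_of_one_lt ‖x‖ (one_lt_two)
  exact hx n (by rwa [mem_ball_zero_iff])

end WSol

/-! ### The Nash inequality -/

section Nash

/-- If f' is integrable, then f, being integrable as well, tends to 0 at -∞ and equals the integral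
of f' up to x. If f' is not integrable there is nothing to prove. -/
lemma enorm_le_lintegral_deriv {f f' : ℝ → ℝ} (hf : ∀ x, HasDerivAt f (f' x) x)
    (hc : Continuous f') (hi : Integrable f) (x : ℝ) : ‖f x‖ₑ ≤ ∫⁻ y, ‖f' y‖ₑ := by
  by_cases h : ∫⁻ y, ‖f' y‖ₑ = ⊤
  · rw [h]; exact le_top
  have hi' : Integrable f' := ⟨hc.aestronglyMeasurable, lt_top_iff_ne_top.2 h⟩
  have h0 := tendsto_zero_of_hasDerivAt_of_integrableOn_Iic (a := x) (fun y _ => hf y)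
    hi'.integrableOn hi.integrableOn
  have h1 := integral_Iic_of_hasDerivAt_of_tendsto' (a := x) (fun y _ => hf y)
    hi'.integrableOn h0
  rw [sub_zero] at h1
  rw [← h1]
  exact (enorm_integral_le_lintegral_enorm _).trans (setLIntegral_le_lintegral _ _)

/-- On a period f need not vanish anywhere, so f(y) is compared with f(x) for every x and averaged.
The resulting term of order zero is the source of the larger exponent for the strip. -/
lemma enorm_le_lintegral_deriv_add {f f' : ℝ → ℝ} (hf : ∀ x, HasDerivAt f (f' x) x)
    (hc : Continuous f') {y : ℝ} (hy : y ∈ Ico (0:ℝ) 1) :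
    ‖f y‖ₑ ≤ ∫⁻ x in Ico (0:ℝ) 1, (‖f' x‖ₑ + ‖f x‖ₑ) := by
  have hfc : Continuous f := continuous_iff_continuousAt.2 fun x => (hf x).continuousAt
  have h1 : ∀ x ∈ Ico (0:ℝ) 1, ‖f y‖ₑ ≤ (∫⁻ x in Ico (0:ℝ) 1, ‖f' x‖ₑ) + ‖f x‖ₑ := by
    intro x hx
    have e : f y = (∫ s in x..y, f' s) + f x := by
      rw [intervalIntegral.integral_eq_sub_of_hasDerivAt (fun s _ => hf s)
        (hc.intervalIntegrable _ _)]
      ring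
    have e2 : ‖∫ s in x..y, f' s‖ₑ ≤ ∫⁻ x in Ico (0:ℝ) 1, ‖f' x‖ₑ := by
      have : ‖∫ s in x..y, f' s‖ₑ = ‖∫ s in uIoc x y, f' s‖ₑ := by
        rw [← ofReal_norm, ← ofReal_norm,
          intervalIntegral.norm_intervalIntegral_eq]
      rw [this]
      refine (enorm_integral_le_lintegral_enorm _).trans (lintegral_mono_set fun s hs => ?_)
      rw [uIoc, mem_Ioc] at hs
      exact ⟨(le_min hx.1 hy.1).trans hs.1.le, hs.2.trans_lt (max_lt hx.2 hy.2)⟩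
    rw [e]
    exact (enorm_add_le _ _).trans (by gcongr)
  calc ‖f y‖ₑ = ∫⁻ x in Ico (0:ℝ) 1, ‖f y‖ₑ := by simp
    _ ≤ ∫⁻ x in Ico (0:ℝ) 1, ((∫⁻ x in Ico (0:ℝ) 1, ‖f' x‖ₑ) + ‖f x‖ₑ) :=
        setLIntegral_mono (by fun_prop) h1
    _ = _ := by
        rw [lintegral_add_left (by fun_prop), lintegral_add_left (by fun_prop)]
        simp

/-- The correction in the Gagliardo–Nirenberg inequality due to the periodic direction. -/
def Domain.defect (D : Domain) : ℝ := D.criticalExponent - 2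

lemma hasDerivAt_coord_fst {f : Plane → ℝ} (hf : ContDiff ℝ 1 f) (x y : ℝ) :
    HasDerivAt (fun x => f (coord (x, y))) (pd 0 f (coord (x, y))) x := by
  have h1 := (hf.differentiable (by norm_num) (coord (x, y))).hasFDerivAt
  have h2 : HasDerivAt (fun x : ℝ => coord (x, y)) (bv 0) x := by
    have e : (fun x : ℝ => coord (x, y)) = fun x => x • (bv 0 : Plane) + y • bv 1 := by
      funext s; ext i; fin_cases i <;> simp
    rw [e]
    simpa using ((hasDerivAt_id x).smul_const (bv 0 : Plane)).add_const (y • (bv 1 : Plane))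
  exact h1.comp_hasDerivAt x h2

lemma hasDerivAt_coord_snd {f : Plane → ℝ} (hf : ContDiff ℝ 1 f) (x y : ℝ) :
    HasDerivAt (fun y => f (coord (x, y))) (pd 1 f (coord (x, y))) y := by
  have h1 := (hf.differentiable (by norm_num) (coord (x, y))).hasFDerivAt
  have h2 : HasDerivAt (fun y : ℝ => coord (x, y)) (bv 1) y := by
    have e : (fun y : ℝ => coord (x, y)) = fun y => y • (bv 1 : Plane) + x • bv 0 := by
      funext s; ext i; fin_cases i <;> simp
    rw [e]
    simpa using ((hasDerivAt_id y).smul_const (bv 1 : Plane)).add_const (x • (bv 0 : Plane))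
  exact h1.comp_hasDerivAt y h2

lemma continuous_coord : Continuous coord := by
  have e : (coord : ℝ × ℝ → Plane) = fun p => p.1 • (bv 0 : Plane) + p.2 • bv 1 := by
    funext s; ext i; fin_cases i <;> simp
  rw [e]
  fun_prop

/-- The Gagliardo argument: |f(x, y)| is bounded by a function a(y) through horizontal integration
and by a function b(x) through vertical integration. Integrating f² ≤ a(y) b(x) separates the
variables. -/
lemma lintegral_sq_le (D : Domain) {f : Plane → ℝ} (hf : ContDiff ℝ 1 f)
    (hi : Integrable f D.measure) :
    ∫⁻ x, ‖f x‖ₑ ^ 2 ∂D.measure ≤ (∫⁻ x, ‖pd 0 f x‖ₑ ∂D.measure) *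
      ∫⁻ x, (‖pd 1 f x‖ₑ + ENNReal.ofReal D.defect * ‖f x‖ₑ) ∂D.measure := by
  have hc0 := continuous_pd hf 0
  have hc1 := continuous_pd hf 1
  have hcf := hf.continuous
  have hcc := continuous_coord
  let a : ℝ → ℝ≥0∞ := fun y => ∫⁻ x, ‖pd 0 f (coord (x, y))‖ₑ
  let b : ℝ → ℝ≥0∞ := fun x => ∫⁻ y, (‖pd 1 f (coord (x, y))‖ₑ
    + ENNReal.ofReal D.defect * ‖f (coord (x, y))‖ₑ) ∂D.snd
  have hic : Integrable (fun p => f (coord p)) (volume.prod D.snd) :=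
    (measurePreserving_coord D).integrable_comp_of_integrable hi
  have hm0 : Measurable fun p : ℝ × ℝ => ‖pd 0 f (coord p)‖ₑ := (hc0.comp hcc).measurable.enorm
  have hmf : Measurable fun p : ℝ × ℝ => ‖f (coord p)‖ₑ := (hcf.comp hcc).measurable.enorm
  have hm1 : Measurable fun p : ℝ × ℝ => (‖pd 1 f (coord p)‖ₑ
    + ENNReal.ofReal D.defect * ‖f (coord p)‖ₑ) :=
    (hc1.comp hcc).measurable.enorm.add (hmf.const_mul _)
  have ha : Measurable a := hm0.lintegral_prod_left'
  have hb : Measurable b := hm1.lintegral_prod_right'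
  have hae1 : ∀ᵐ y ∂D.snd, ∀ x, ‖f (coord (x, y))‖ₑ ≤ a y := by
    filter_upwards [hic.prod_left_ae] with y hy x
    exact enorm_le_lintegral_deriv (f := fun x => f (coord (x, y)))
      (f' := fun x => pd 0 f (coord (x, y))) (fun x => hasDerivAt_coord_fst hf x y)
      (hc0.comp (hcc.comp (by fun_prop))) hy x
  have hae2 : ∀ᵐ x : ℝ, ∀ᵐ y ∂D.snd, ‖f (coord (x, y))‖ₑ ≤ b x := by
    filter_upwards [hic.prod_right_ae] with x hx
    cases D
    · refine ae_of_all _ fun y => ?_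
      refine (enorm_le_lintegral_deriv (f := fun y => f (coord (x, y)))
        (f' := fun y => pd 1 f (coord (x, y))) (fun y => hasDerivAt_coord_snd hf x y)
        (hc1.comp (hcc.comp (by fun_prop))) hx y).trans (lintegral_mono fun y => le_self_add)
    · simp only [Domain.snd]
      rw [ae_restrict_iff' measurableSet_Ico]
      refine ae_of_all _ fun y hy => ?_
      refine (enorm_le_lintegral_deriv_add (f := fun y => f (coord (x, y)))
        (f' := fun y => pd 1 f (coord (x, y))) (fun y => hasDerivAt_coord_snd hf x y)
        (hc1.comp (hcc.comp (by fun_prop))) hy).trans (le_of_eq ?_)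
      simp only [b, Domain.snd, Domain.defect, Domain.criticalExponent]
      norm_num
  rw [lintegral_coord, lintegral_coord, lintegral_coord]
  calc ∫⁻ p, ‖f (coord p)‖ₑ ^ 2 ∂(volume.prod D.snd)
      = ∫⁻ x, ∫⁻ y, ‖f (coord (x, y))‖ₑ ^ 2 ∂D.snd := lintegral_prod _ (hmf.pow_const 2).aemeasurable
    _ ≤ ∫⁻ x, ∫⁻ y, b x * a y ∂D.snd := by
        refine lintegral_mono_ae ?_
        filter_upwards [hae2] with x hx
        refine lintegral_mono_ae ?_
        filter_upwards [hx, hae1] with y h1 h2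
        rw [sq]
        exact mul_le_mul' h1 (h2 x)
    _ = (∫⁻ y, a y ∂D.snd) * ∫⁻ x, b x := by
        simp_rw [lintegral_const_mul _ ha]
        rw [lintegral_mul_const _ hb, mul_comm]
    _ = _ := by
        rw [lintegral_prod_symm _ hm0.aemeasurable, lintegral_prod _ hm1.aemeasurable]

lemma integral_sq_le (D : Domain) {f : Plane → ℝ} (hf : ContDiff ℝ 1 f)
    (hi : Integrable f D.measure) (hi' : ∀ i, Integrable (pd i f) D.measure) :
    ∫ x, f x ^ 2 ∂D.measure ≤ (∫ x, |pd 0 f x| ∂D.measure) *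
      (∫ x, |pd 1 f x| ∂D.measure + D.defect * ∫ x, |f x| ∂D.measure) := by
  have hσ : 0 ≤ D.defect := by cases D <;> norm_num [Domain.defect, Domain.criticalExponent]
  have h := lintegral_sq_le D hf hi
  have e1 : ∫ x, f x ^ 2 ∂D.measure = (∫⁻ x, ‖f x‖ₑ ^ 2 ∂D.measure).toReal := by
    rw [integral_eq_lintegral_of_nonneg_ae (f := fun x => f x ^ 2)
      (ae_of_all _ fun x => sq_nonneg (f x)) (hf.continuous.pow 2).aestronglyMeasurable]
    congr 1
    refine lintegral_congr fun x => ?_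
    rw [Real.enorm_eq_ofReal_abs, ← ENNReal.ofReal_pow (abs_nonneg _), sq_abs]
  have e2 : ∫⁻ x, (‖pd 1 f x‖ₑ + ENNReal.ofReal D.defect * ‖f x‖ₑ) ∂D.measure
      = ∫⁻ x, ‖pd 1 f x‖ₑ ∂D.measure + ENNReal.ofReal D.defect * ∫⁻ x, ‖f x‖ₑ ∂D.measure := by
    rw [lintegral_add_left (continuous_pd hf 1).measurable.enorm,
      lintegral_const_mul _ hf.continuous.measurable.enorm]
  have hfin : ∫⁻ x, ‖pd 1 f x‖ₑ ∂D.measure + ENNReal.ofReal D.defect * ∫⁻ x, ‖f x‖ₑ ∂D.measure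
      ≠ ⊤ := ENNReal.add_ne_top.2 ⟨(hi' 1).2.ne, ENNReal.mul_ne_top (by simp) hi.2.ne⟩
  rw [e2] at h
  have h2 := ENNReal.toReal_mono (ENNReal.mul_ne_top (hi' 0).2.ne hfin) h
  rw [e1, integral_abs_eq_toReal (hi' 0).1, integral_abs_eq_toReal (hi' 1).1,
    integral_abs_eq_toReal hi.1]
  refine h2.trans (le_of_eq ?_)
  rw [ENNReal.toReal_mul, ENNReal.toReal_add (hi' 1).2.ne
    (ENNReal.mul_ne_top (by simp) hi.2.ne), ENNReal.toReal_mul, ENNReal.toReal_ofReal hσ]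

/-- Cauchy–Schwarz with a weight. -/
lemma sq_integral_mul_le {μ : Measure Plane} {w f : Plane → ℝ} (hw : ∀ x, 0 ≤ w x)
    (h1 : Integrable w μ) (h2 : Integrable (fun x => w x * f x) μ)
    (h3 : Integrable (fun x => w x * f x ^ 2) μ) :
    (∫ x, w x * f x ∂μ) ^ 2 ≤ (∫ x, w x ∂μ) * ∫ x, w x * f x ^ 2 ∂μ := by
  have key : ∀ r : ℝ, 0 ≤ (∫ x, w x ∂μ) * (r * r) + (-2 * ∫ x, w x * f x ∂μ) * r
      + ∫ x, w x * f x ^ 2 ∂μ := by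
    intro r
    have : 0 ≤ ∫ x, w x * (f x - r) ^ 2 ∂μ :=
      integral_nonneg fun x => mul_nonneg (hw x) (sq_nonneg _)
    have e : ∀ x, w x * (f x - r) ^ 2 = w x * (r * r) + (-2 * r) * (w x * f x)
        + w x * f x ^ 2 := fun x => by ring
    simp only [e] at this
    rw [integral_add ((h1.mul_const _).fun_add (h2.const_mul _)) h3,
      integral_add (h1.mul_const _) (h2.const_mul _), integral_mul_const,
      integral_const_mul] at this
    linarith
  have := discrim_le_zero key
  unfold discrim at this
  linarith

/-- The algebra of `nash`, with E = ∫ w^p, d the dissipation, and r the level of an interpolation.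
For σ = 0 one gets E r ≲ S0 S1 ≲ d. For σ = 1 either the gradient term dominates, as before and with
r² ≤ r, or E r ≲ S0 G; squaring the latter gives E² r² ≲ d E, and a factor E cancels. So the strip
costs one more power of r. -/
lemma nash_arith {σ S0 S1 G N E d M r k : ℝ} (hk : 1 ≤ k) (hM : 1 ≤ M) (hd : 0 ≤ d) (hE : 0 ≤ E)
    (hr0 : 0 ≤ r) (hr : r ≤ 1)
    (h0 : S0 ^ 2 ≤ M * d) (h1 : S1 ^ 2 ≤ M * d) (hGE : G ^ 2 ≤ M * E)
    (hN : N ≤ k * S0 * (k * S1 + σ * G)) (hNE : E * r / 2 ≤ N) :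
    (σ = 0 → E * r / (16 * k ^ 4 * M ^ 2) ≤ d) ∧
      (σ = 1 → E * r ^ 2 / (16 * k ^ 4 * M ^ 2) ≤ d) := by
  have hk2 : 1 ≤ k ^ 2 := one_le_pow₀ hk
  have hk4 : k ^ 2 ≤ k ^ 4 := pow_le_pow_right₀ hk (by norm_num)
  have hMM : M ≤ M ^ 2 := by nlinarith
  have hkM : k ^ 2 * M ≤ k ^ 4 * M ^ 2 := by gcongr
  have hEr : 0 ≤ E * r := by positivity
  have hprod : S0 * S1 ≤ M * d := by nlinarith [sq_nonneg (S0 - S1)]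
  constructor
  · rintro rfl
    rw [div_le_iff₀ (by positivity)]
    have a1 : E * r / 2 ≤ k ^ 2 * (M * d) := by
      calc E * r / 2 ≤ k ^ 2 * (S0 * S1) := by linarith
        _ ≤ _ := by gcongr
    have a2 : k ^ 2 * M * d ≤ k ^ 4 * M ^ 2 * d := by gcongr
    have a3 : 0 ≤ k ^ 4 * M ^ 2 * d := by positivity
    linarith
  · rintro rfl
    rw [div_le_iff₀ (by positivity)]
    have hr2 : E * r ^ 2 ≤ E * r := by nlinarith
    by_cases hc : E * r / 4 ≤ k ^ 2 * (S0 * S1)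
    · have a1 : E * r / 4 ≤ k ^ 2 * (M * d) := hc.trans (by gcongr)
      have a2 : k ^ 2 * M * d ≤ k ^ 4 * M ^ 2 * d := by gcongr
      have a3 : 0 ≤ k ^ 4 * M ^ 2 * d := by positivity
      linarith
    · push Not at hc
      have a1 : E * r / 4 ≤ k * (S0 * G) := by nlinarith
      have a2 : (E * r / 4) ^ 2 ≤ (k * (S0 * G)) ^ 2 := by gcongr
      have a3 : (k * (S0 * G)) ^ 2 ≤ k ^ 2 * ((M * d) * (M * E)) := by
        calc (k * (S0 * G)) ^ 2 = k ^ 2 * (S0 ^ 2 * G ^ 2) := by ring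
          _ ≤ _ := by gcongr
      have a4 : k ^ 2 * ((M * d) * (M * E)) ≤ k ^ 4 * ((M * d) * (M * E)) := by gcongr
      rcases hE.eq_or_lt with hE0 | hE0
      · rw [← hE0]; simp; positivity
      · have a5 : E * (E * r ^ 2) ≤ E * (d * (16 * k ^ 4 * M ^ 2)) := by nlinarith
        exact le_of_mul_le_mul_left a5 hE0

/-- The rate exponent of the `L^p` decay for `p = 2 k - 1`. -/
def Domain.rate (D : Domain) (k : ℕ) : ℝ := (D.criticalExponent - 1) / (2 * k - 2)

lemma Domain.rate_pos (D : Domain) {k : ℕ} (hk : 2 ≤ k) : 0 < D.rate k := by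
  have : (2:ℝ) ≤ k := by exact_mod_cast hk
  unfold Domain.rate
  apply div_pos _ (by linarith)
  cases D <;> norm_num [Domain.criticalExponent]

/-- The constant of the Nash inequality. -/
def Domain.nashConst (D : Domain) (k : ℕ) (M : ℝ) : ℝ :=
  (2 * M) ^ (- D.rate k) / (16 * (k:ℝ) ^ 4 * M ^ 2)

lemma Domain.nashConst_pos (D : Domain) {k : ℕ} (hk : 2 ≤ k) {M : ℝ} (hM : 1 ≤ M) :
    0 < D.nashConst k M := by
  have : (0:ℝ) < k := by positivity
  unfold Domain.nashConst
  positivity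

/-- Nash inequality for `w ^ (2 k - 1)`. -/
lemma nash (D : Domain) {k : ℕ} (hk : 2 ≤ k) {M : ℝ} (hM : 1 ≤ M) {w : Plane → ℝ}
    (hw : ContDiff ℝ ∞ w) (hw0 : ∀ x, 0 ≤ w x) (hw1 : ∀ x, w x ≤ 1)
    (hi : Integrable w D.measure) (hwM : ∫ x, w x ∂D.measure ≤ M)
    (hi' : ∀ i, Integrable (pd i w) D.measure) {C' : ℝ} (hdC : ∀ i x, |pd i w x| ≤ C') :
    D.nashConst k M * (∫ x, w x ^ (2 * k - 1) ∂D.measure) ^ (1 + D.rate k)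
      ≤ ∫ x, w x ^ (2 * k - 3) * ∑ i, pd i w x ^ 2 ∂D.measure := by
  -- The Gagliardo inequality is applied to f = w^k. For odd p = 2k - 1 all the powers involved are
  -- natural: E has exponent 2m + 3, f² has 2m + 4, and the weight of the dissipation has 2m + 1.
  obtain ⟨m, rfl⟩ : ∃ m, k = m + 2 := ⟨k - 2, by omega⟩
  have n1 : 2 * (m + 2) - 1 = 2 * m + 3 := by omega
  have n2 : 2 * (m + 2) - 3 = 2 * m + 1 := by omega
  rw [n1, n2]
  have hwc := hw.continuous
  have hpc : ∀ i, Continuous (pd i w) := fun i => (contDiff_pd hw i).continuous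
  have hwn : ∀ (n : ℕ) x, |w x ^ n| ≤ 1 := fun n x => by
    rw [abs_of_nonneg (pow_nonneg (hw0 x) n)]
    exact pow_le_one₀ (hw0 x) (hw1 x)
  have ipow : ∀ n : ℕ, Integrable (fun x => w x * w x ^ n) D.measure := fun n =>
    hi.mul_bdd (c := 1) (hwc.pow n).aestronglyMeasurable (ae_of_all _ (hwn n))
  have ipow' : ∀ n : ℕ, Integrable (fun x => w x ^ (n + 1)) D.measure := fun n => by
    simpa only [pow_succ'] using ipow n
  have id1 : ∀ (n : ℕ) i, Integrable (fun x => w x ^ n * |pd i w x|) D.measure := fun n i =>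
    (hi' i).abs.bdd_mul (c := 1) (hwc.pow n).aestronglyMeasurable (ae_of_all _ (hwn n))
  have id2 : ∀ (n : ℕ) i, Integrable (fun x => w x ^ n * |pd i w x| ^ 2) D.measure := fun n i => by
    have := (id1 n i).mul_bdd (c := C') (hpc i).abs.aestronglyMeasurable
      (ae_of_all _ fun x => by rw [Real.norm_eq_abs, abs_abs]; exact hdC i x)
    refine this.congr (ae_of_all _ fun x => ?_)
    simp only; ring
  set E := ∫ x, w x ^ (2 * m + 3) ∂D.measure with hE
  set N := ∫ x, w x ^ (2 * m + 4) ∂D.measure with hN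
  set d := ∫ x, w x ^ (2 * m + 1) * ∑ i, pd i w x ^ 2 ∂D.measure with hd
  set S : Fin 2 → ℝ := fun i => ∫ x, w x ^ (m + 1) * |pd i w x| ∂D.measure with hS
  set G := ∫ x, w x ^ (m + 2) ∂D.measure with hG
  have hE0 : 0 ≤ E := integral_nonneg fun x => pow_nonneg (hw0 x) _
  have hEM : E ≤ M := by
    refine le_trans (integral_mono (ipow' _) hi fun x => ?_) hwM
    exact pow_le_of_le_one (hw0 x) (hw1 x) (by omega)
  have hd0 : 0 ≤ d := integral_nonneg fun x =>
    mul_nonneg (pow_nonneg (hw0 x) _) (Finset.sum_nonneg fun i _ => sq_nonneg _)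
  have hSM : ∀ i, S i ^ 2 ≤ M * d := by
    intro i
    -- Cauchy–Schwarz with weight w, whose total mass is at most M: one factor w is split off from
    -- w^(m+1)|∂_i w|, and the square of the rest, times w, is a part of the dissipation density.
    have h := sq_integral_mul_le (μ := D.measure) (w := w)
      (f := fun x => w x ^ m * |pd i w x|) hw0 hi
      ((id1 (m + 1) i).congr (ae_of_all _ fun x => by simp only; ring))
      ((id2 (2 * m + 1) i).congr (ae_of_all _ fun x => by simp only; ring))
    have e1 : ∫ x, w x * (w x ^ m * |pd i w x|) ∂D.measure = S i :=
      integral_congr_ae (ae_of_all _ fun x => by simp only; ring)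
    have e2 : ∫ x, w x * (w x ^ m * |pd i w x|) ^ 2 ∂D.measure ≤ d := by
      refine integral_mono ((id2 (2 * m + 1) i).congr (ae_of_all _ fun x => by simp only; ring))
        ?_ fun x => ?_
      · simp only [Finset.mul_sum]
        exact integrable_finsetSum _ fun j _ => (id2 (2 * m + 1) j).congr
          (ae_of_all _ fun x => by simp only [sq_abs])
      · have : pd i w x ^ 2 ≤ ∑ j, pd j w x ^ 2 :=
          Finset.single_le_sum (f := fun j => pd j w x ^ 2) (fun j _ => sq_nonneg _)
            (Finset.mem_univ i)
        calc w x * (w x ^ m * |pd i w x|) ^ 2 = w x ^ (2 * m + 1) * pd i w x ^ 2 := by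
              rw [mul_pow, sq_abs]; ring
          _ ≤ _ := by
              have := pow_nonneg (hw0 x) (2 * m + 1)
              gcongr
    rw [e1] at h
    have hm0 : 0 ≤ ∫ x, w x ∂D.measure := integral_nonneg hw0
    refine h.trans (mul_le_mul hwM e2 (integral_nonneg fun x => ?_) (by linarith))
    exact mul_nonneg (hw0 x) (sq_nonneg _)
  have hGE : G ^ 2 ≤ M * E := by
    have h := sq_integral_mul_le (μ := D.measure) (w := w) (f := fun x => w x ^ (m + 1)) hw0 hi
      (ipow (m + 1))
      ((ipow (2 * m + 2)).congr (ae_of_all _ fun x => by simp only; ring))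
    have e1 : ∫ x, w x * w x ^ (m + 1) ∂D.measure = G :=
      integral_congr_ae (ae_of_all _ fun x => by simp only; ring)
    have e2 : ∫ x, w x * (w x ^ (m + 1)) ^ 2 ∂D.measure = E :=
      integral_congr_ae (ae_of_all _ fun x => by simp only; ring)
    rw [e1, e2] at h
    exact h.trans (by gcongr)
  have hGN : N ≤ ((m + 2 : ℕ) : ℝ) * S 0 * (((m + 2 : ℕ) : ℝ) * S 1 + D.defect * G) := by
    have hpw : ∀ i x, pd i (fun x => w x ^ (m + 2)) x
        = ((m + 2 : ℕ) : ℝ) * w x ^ (m + 1) * pd i w x := fun i x =>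
      pd_comp (hasDerivAt_pow (m + 2) (w x)) (hw.differentiable (by simp) x) i
    have h := integral_sq_le D (f := fun x => w x ^ (m + 2)) ((hw.of_le (by simp)).pow _)
      (ipow' (m + 1)) (fun i => by
        rw [funext (hpw i)]
        have := ((hi' i).bdd_mul (c := 1) (hwc.pow (m + 1)).aestronglyMeasurable
          (ae_of_all _ (hwn (m + 1)))).const_mul ((m + 2 : ℕ) : ℝ)
        simpa only [mul_assoc, Pi.pow_apply] using this)
    have e1 : ∀ i, ∫ x, |pd i (fun x => w x ^ (m + 2)) x| ∂D.measure
        = ((m + 2 : ℕ) : ℝ) * S i := fun i => by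
      simp only [hpw, hS]
      rw [← integral_const_mul]
      refine integral_congr_ae (ae_of_all _ fun x => ?_)
      simp only
      rw [abs_mul, abs_mul, abs_of_nonneg (pow_nonneg (hw0 x) _), Nat.abs_cast, mul_assoc]
    have e2 : ∫ x, |w x ^ (m + 2)| ∂D.measure = G :=
      integral_congr_ae (ae_of_all _ fun x => abs_of_nonneg (pow_nonneg (hw0 x) _))
    have e3 : ∫ x, (w x ^ (m + 2)) ^ 2 ∂D.measure = N :=
      integral_congr_ae (ae_of_all _ fun x => by simp only; ring)
    rwa [e1, e1, e2, e3] at h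
  set a : ℝ := 1 / ((2 * m + 2 : ℕ) : ℝ) with ha
  have hapos : 0 < a := by positivity
  have hrate : D.rate (m + 2) = (1 + D.defect) * a := by
    rw [ha, Domain.rate, Domain.defect]; push_cast; rw [mul_one_div]; congr 1 <;> ring
  have hrate0 := D.rate_pos (k := m + 2) (by omega)
  rcases hE0.eq_or_lt with hE00 | hEpos
  · rw [← hE00, Real.zero_rpow (by linarith), mul_zero]
    exact hd0
  -- This level satisfies r^(p-1) = E / (2M), so the part of ∫ w^p where w ≤ r is at most E / 2 and
  -- can be absorbed. The part where w ≥ r is at most r⁻¹ ∫ w^(p+1).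
  set r : ℝ := (E / (2 * M)) ^ a with hr
  have hr0 : 0 < r := by positivity
  have hr1 : r ≤ 1 := by
    refine Real.rpow_le_one (by positivity) ?_ hapos.le
    rw [div_le_one (by positivity)]; linarith
  have hrp : r ^ (2 * m + 2) = E / (2 * M) := by
    rw [hr, ha, ← Real.rpow_natCast, ← Real.rpow_mul (by positivity), one_div,
      inv_mul_cancel₀ (by positivity), Real.rpow_one]
  have hNE : E * r / 2 ≤ N := by
    have hpt : ∀ x, w x ^ (2 * m + 3) ≤ r ^ (2 * m + 2) * w x + r⁻¹ * w x ^ (2 * m + 4) := by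
      intro x
      have h0 := hw0 x
      rcases le_total (w x) r with h | h
      · have h1 : w x ^ (2 * m + 2) ≤ r ^ (2 * m + 2) := by gcongr
        have h2 : 0 ≤ r⁻¹ * w x ^ (2 * m + 4) := by positivity
        have h3 : w x ^ (2 * m + 3) = w x ^ (2 * m + 2) * w x := by ring
        rw [h3]
        nlinarith
      · have h1 : 1 ≤ r⁻¹ * w x := by rwa [inv_mul_eq_div, one_le_div hr0]
        have h2 : 0 ≤ r ^ (2 * m + 2) * w x := by positivity
        have h3 : r⁻¹ * w x ^ (2 * m + 4) = (r⁻¹ * w x) * w x ^ (2 * m + 3) := by ring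
        have h4 : 0 ≤ w x ^ (2 * m + 3) := by positivity
        rw [h3]
        nlinarith
    have h := integral_mono (ipow' (2 * m + 2)) ((hi.const_mul _).fun_add
      ((ipow' (2 * m + 3)).const_mul r⁻¹)) hpt
    rw [integral_add (hi.const_mul _) ((ipow' (2 * m + 3)).const_mul r⁻¹), integral_const_mul,
      integral_const_mul, hrp] at h
    have h5 : E / (2 * M) * ∫ x, w x ∂D.measure ≤ E / 2 := by
      calc E / (2 * M) * ∫ x, w x ∂D.measure ≤ E / (2 * M) * M := by gcongr
        _ = E / 2 := by field_simp
    have h6 : E / 2 ≤ r⁻¹ * N := by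
      have : E ≤ E / (2 * M) * ∫ x, w x ∂D.measure + r⁻¹ * N := h
      linarith
    rw [inv_mul_eq_div, le_div_iff₀ hr0] at h6
    linarith
  have key := nash_arith (σ := D.defect) (k := ((m + 2 : ℕ) : ℝ))
    (by exact_mod_cast (by omega : 1 ≤ m + 2)) hM hd0 hE0 hr0.le hr1 (hSM 0) (hSM 1) hGE hGN hNE
  have conv : D.nashConst (m + 2) M * E ^ (1 + D.rate (m + 2))
      = E * r ^ (1 + D.defect) / (16 * ((m + 2 : ℕ) : ℝ) ^ 4 * M ^ 2) := by
    rw [Domain.nashConst, Real.rpow_add hEpos, Real.rpow_one, Real.rpow_neg (by positivity), hr,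
      ← Real.rpow_mul (by positivity), mul_comm a, ← hrate,
      Real.div_rpow (by positivity) (by positivity)]
    ring
  rw [conv]
  cases D
  · have : Domain.plane.defect = 0 := by norm_num [Domain.defect, Domain.criticalExponent]
    rw [this, add_zero, Real.rpow_one]
    exact key.1 this
  · have : Domain.strip.defect = 1 := by norm_num [Domain.defect, Domain.criticalExponent]
    rw [this, one_add_one_eq_two, Real.rpow_two]
    exact key.2 this

end Nash

/-! ### Energy inequalities on the whole domain -/

namespace WSol

variable {v : Plane → Plane} {τ K L L' M : ℝ} {z0 : Plane → ℝ} {z : ℝ → Plane → ℝ}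
  {B B1 B2 : ℝ → ℝ}

/-- Integrated energy inequality on the whole domain for solutions without source. -/
lemma integral_profile_le {D : Domain} (h : WSol v τ 1 (fun _ _ => 0) z0 z) (hv : IsField K L v)
    (hvf : D.IsFun v) (hz0f : D.IsFun z0) (hzf : ∀ t, D.IsFun (z t)) (hz : ∀ t x, 0 ≤ z t x)
    (hM : ∀ t, ∫⁻ x, ‖z t x‖ₑ ∂D.measure ≤ ENNReal.ofReal M)
    (hM0 : ∫⁻ x, ‖z0 x‖ₑ ∂D.measure ≤ ENNReal.ofReal M) (hM' : 0 ≤ M)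
    (hB : Profile B B1 B2 1 L') {Φ : ℝ → ℝ} (hΦ : Continuous Φ)
    (key : ∀ w : Plane → ℝ, ContDiff ℝ ∞ w → (∀ x, 0 ≤ w x) → (∀ x, w x ≤ 1) →
      Integrable w D.measure → ∫ x, w x ∂D.measure ≤ M → (∀ i, Integrable (pd i w) D.measure) →
      (∃ C', ∀ i x, |pd i w x| ≤ C') → 
      Integrable (fun x => B2 (w x) * ∑ i, pd i w x ^ 2) D.measure →
      Φ (∫ x, B (w x) ∂D.measure) ≤ ∫ x, B2 (w x) * ∑ i, pd i w x ^ 2 ∂D.measure)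
    {t : ℝ} (ht : t ∈ Icc 0 τ) :
    ∫ x, B (z t x) ∂D.measure
      ≤ ∫ x, B (z0 x) ∂D.measure - ∫ s in (0:ℝ)..t, Φ (∫ x, B (z s x) ∂D.measure) := by
  obtain ⟨J, k, hJ, hk⟩ := exists_mollifier_seq
  have hzm := h.measurable_apply
  have hL' : 0 ≤ L' := hB.L_nonneg zero_le_one
  have cz : ∀ s, Ctrl D.measure M (z s) := fun s => ctrl_domain (hzm s) (hzf s) (hM s)
  have cz0 : Ctrl D.measure M z0 := ctrl_domain h.measurable_zero hz0f hM0
  have cg : ∀ _ : ℝ, Ctrl D.measure M (fun _ : Plane => (0:ℝ)) := fun _ y _ => by simp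
  have tz : ∀ s, TransCont D.measure (z s) := fun s =>
    transCont_domain (hzm s) (hzf s) ((cz s).integrable (hzm s))
  have tz0 : TransCont D.measure z0 :=
    transCont_domain h.measurable_zero hz0f (cz0.integrable h.measurable_zero)
  have hone : ∀ _ : Plane, |(1:ℝ)| ≤ 1 := fun _ => by simp
  have hεle : ∀ n : ℕ, 1 / ((n:ℝ) + 1) ≤ 1 := fun n => by
    rw [div_le_one (by positivity)]; linarith [(Nat.cast_nonneg n : (0:ℝ) ≤ n)]
  have hwb : ∀ n s x, |cv (k n) (z s) x| ≤ 1 := fun n s =>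
    abs_cv_mollifier_le (hk n) (h.bound s)
  have hwi : ∀ n s, Integrable (cv (k n) (z s)) D.measure := fun n s =>
    integrable_cv (hk n).isTest (mollifier_support_one hk n) (hzm s) (h.bound s) (cz s)
  have hw0 : ∀ n s x, 0 ≤ cv (k n) (z s) x := fun n s x =>
    integral_nonneg fun y => mul_nonneg ((hk n).nonneg y) (hz s _)
  have hwM : ∀ n s, ∫ x, cv (k n) (z s) x ∂D.measure ≤ M := by
    intro n s
    have h1 := lintegral_cv_le (hk n).isTest (mollifier_support_one hk n) (hzm s) (cz s)
    rw [(hk n).lintegral_eq, one_mul] at h1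
    have h2 := integral_abs_eq_toReal (hwi n s).1
    rw [integral_congr_ae (ae_of_all _ fun x => abs_of_nonneg (hw0 n s x))] at h2
    rw [h2]
    exact ENNReal.toReal_le_of_le_ofReal hM' h1
  set Y : ℕ → ℝ → ℝ := fun n s => ∫ x, B (cv (k n) (z s) x) ∂D.measure with hY
  -- By the mass bound the entropies stay in a fixed compact interval, where Φ is bounded. This
  -- supplies the dominating constant for the limit n → ∞.
  have hYb : ∀ n s, Y n s ∈ Icc (-(L' * M)) (L' * M) := by
    intro n s
    rw [mem_Icc, ← abs_le]
    refine (abs_integral_le_integral_abs).trans ?_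
    calc ∫ x, |B (cv (k n) (z s) x)| ∂D.measure
        ≤ ∫ x, L' * cv (k n) (z s) x ∂D.measure := by
          refine integral_mono (hB.integrable_comp (hwi n s) (hwb n s)).abs
            ((hwi n s).const_mul _) fun x => ?_
          have := hB.abs_le (hwb n s x)
          rwa [abs_of_nonneg (hw0 n s x)] at this
      _ ≤ L' * M := by
          rw [integral_const_mul]
          gcongr
          exact hwM n s
  obtain ⟨b, hb⟩ := isCompact_Icc.exists_bound_of_continuousOn
    (hΦ.continuousOn (s := Icc (-(L' * M)) (L' * M)))
  have hYm : ∀ n, Measurable (Y n) := fun n => measurable_integral_of_uncurry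
    (hB.continuous_zero.measurable.comp
      (measurable_cv_uncurry (hk n).isTest.continuous.measurable h.measurable))
  set R : ℕ → ℝ → ℝ := fun n s => ∫ x, |IsField.commutator v (k n) (z s) x| ∂D.measure with hR
  set b' := (ENNReal.ofReal (4 * K * J) * (2 * ENNReal.ofReal M)).toReal
  have hRm : ∀ n, Measurable (R n) := fun n => measurable_integral_of_uncurry
    (F := fun s x => |IsField.commutator v (k n) (z s) x|)
    (measurable_commutator_uncurry hv (hk n).isTest h.measurable h.bound).abs
  have hprof := fun n => h.integral_profile_cv hv cz cg cz0 (hεle n) (hk n) hB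
    (ρ := fun _ => 1) measurable_const hone ht
  have main := le_add_integral_of_tendsto (t := t) (b := b + L' * b') ht.1
    (f := fun s => - Φ (∫ x, B (z s x) ∂D.measure))
    (F := fun n s => - Φ (Y n s) + L' * R n s)
    (fun n => (hprof n).2) (fun n => (hprof n).1) ?_ ?_ ?_ ?_
    (tendsto_integral_profile hk hB (hzm t) (h.bound t) (cz t) (tz t) measurable_const hone)
    (tendsto_integral_profile hk hB h.measurable_zero h.bound_zero cz0 tz0 measurable_const hone)
  · simp only [one_mul, intervalIntegral.integral_neg] at main
    linarith
  · intro n s hs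
    have hkt := (hk n).isTest
    have hs1 := mollifier_support_one hk n
    rw [h.integral_mollifiedRHS_eq hv cz cg hk n hB measurable_const hone s]
    have hR' := h.abs_integral_commutator_le hv cz hk n hB hone s
    have e3 : ∫ x, 1 * (B1 (cv (k n) (z s) x) * cv (k n) (fun _ => (0:ℝ)) x) ∂D.measure = 0 := by
      simp [cv]
    rw [e3, add_zero]
    refine add_le_add ?_ hR'
    set P := ∑ i, ∫ y, |pd i (k n) y| with hP
    have hPi : ∀ i, ∫ y, |pd i (k n) y| ≤ P := fun i =>
      Finset.single_le_sum (f := fun i => ∫ y, |pd i (k n) y|)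
        (fun i _ => integral_nonneg fun y => abs_nonneg _) (Finset.mem_univ i)
    have hP0 : 0 ≤ P := (integral_nonneg fun y => abs_nonneg _).trans (hPi 0)
    have hL0 : 0 ≤ L := (norm_nonneg _).trans (hv.bdd 0)
    have hw := contDiff_cv hkt (hzm s) (h.bound s)
    have hdC : ∀ i x, |pd i (cv (k n) (z s)) x| ≤ P + L + L * P := fun i x => by
      rw [pd_cv hkt (hzm s) (h.bound s)]
      refine (abs_cv_le (hkt.pd i) (h.bound s) x).trans ?_
      have := hPi i
      have : 0 ≤ L * P := by positivity
      linarith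
    have hdi : ∀ i, Integrable (pd i (cv (k n) (z s))) D.measure := fun i => by
      rw [pd_cv hkt (hzm s) (h.bound s)]
      exact integrable_cv (hkt.pd i) (pd_eq_zero_of_support hs1 i) (hzm s) (h.bound s) (cz s)
    have hid := integral_transport_diffusion D hB hw ((hzf s).cv (k n)) (hwb n s) (hwi n s) hdC hdi
      (fun i => by
        rw [pd_cv hkt (hzm s) (h.bound s), pd_cv (hkt.pd i) (hzm s) (h.bound s)]
        exact integrable_cv ((hkt.pd i).pd i) (pd_eq_zero_of_support (pd_eq_zero_of_support hs1 i) i)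
          (hzm s) (h.bound s) (cz s))
      (V := fun i => cv (k n) fun x => v x i)
      (fun i => contDiff_cv hkt (hv.measurable_apply i) (hv.abs_apply_le i))
      (fun i => (hvf.comp fun x => x i).cv (k n))
      (fun i x => by
        refine (abs_cv_mollifier_le (hk n) (hv.abs_apply_le i) x).trans ?_
        have : 0 ≤ L * P := by positivity
        linarith)
      (fun i x => by
        rw [pd_cv hkt (hv.measurable_apply i) (hv.abs_apply_le i)]
        refine (abs_cv_le (hkt.pd i) (hv.abs_apply_le i) x).trans ?_
        have := mul_le_mul_of_nonneg_left (hPi i) hL0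
        linarith)
      (hv.sum_pd_cv hkt)
    simp only [one_mul]
    -- The drift has disappeared. The hypothesis `key` is applied to the mollified solution, so the
    -- solution itself never needs derivatives; the gradient bounds depend on n, but do not enter
    -- the conclusion of `key`.
    rw [hid.2]
    exact neg_le_neg (key _ hw (hw0 n s) (fun x => (abs_le.1 (hwb n s x)).2) (hwi n s) (hwM n s) hdi
      ⟨_, hdC⟩ hid.1)
  · intro n
    exact (hΦ.measurable.comp (hYm n)).neg.add ((hRm n).const_mul _)
  · intro n s
    refine (abs_add_le _ _).trans (add_le_add ?_ ?_)
    · rw [abs_neg]; exact hb _ (hYb n s)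
    · rw [abs_mul, abs_of_nonneg hL', abs_of_nonneg (integral_nonneg fun x => abs_nonneg _)]
      gcongr
      exact integral_abs_commutator_le hv hk (hzm s) (h.bound s) (cz s) n
  · intro s
    have h1 := tendsto_integral_profile hk hB (hzm s) (h.bound s) (cz s) (tz s)
      (measurable_const (a := (1:ℝ))) hone
    simp only [one_mul] at h1
    have h2 := (tendsto_integral_abs_commutator hv hk (hzm s) (h.bound s) (cz s) (tz s)).const_mul L'
    simpa using ((hΦ.tendsto _).comp h1).neg.add h2

/-- The mass does not increase. -/
lemma integral_le {D : Domain} (h : WSol v τ 1 (fun _ _ => 0) z0 z) (hv : IsField K L v)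
    (hvf : D.IsFun v) (hz0f : D.IsFun z0) (hzf : ∀ t, D.IsFun (z t)) (hz : ∀ t x, 0 ≤ z t x)
    (hM : ∀ t, ∫⁻ x, ‖z t x‖ₑ ∂D.measure ≤ ENNReal.ofReal M)
    (hM0 : ∫⁻ x, ‖z0 x‖ₑ ∂D.measure ≤ ENNReal.ofReal M) (hM' : 0 ≤ M)
    {t : ℝ} (ht : t ∈ Icc 0 τ) : ∫ x, z t x ∂D.measure ≤ ∫ x, z0 x ∂D.measure := by
  have hB : Profile (fun x => x) (fun _ => 1) (fun _ => 0) 1 1 :=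
    ⟨hasDerivAt_id, fun x => hasDerivAt_const x 1, continuous_const, rfl, by simp, by simp⟩
  simpa using h.integral_profile_le hv hvf hz0f hzf hz hM hM0 hM' hB (Φ := fun _ => 0)
    continuous_const (by simp) ht

lemma _root_.FlowQuenching.profile_pow (m : ℕ) :
    Profile (fun x => x ^ (m + 3)) (fun x => (m + 3) * x ^ (m + 2))
      (fun x => (m + 3) * (m + 2) * x ^ (m + 1)) 1 ((m + 3) * (m + 2)) where
  hasDerivAt x := by simpa using hasDerivAt_pow (m + 3) x
  hasDerivAt' x := by
    refine ((hasDerivAt_pow (m + 2) x).const_mul ((m:ℝ) + 3)).congr_deriv ?_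
    push_cast
    ring_nf
  continuous := by fun_prop
  zero := by simp
  bound x hx := by
    rw [abs_mul, abs_pow, abs_of_nonneg (by positivity)]
    gcongr
    exact (pow_le_one₀ (abs_nonneg x) hx).trans (by linarith [(Nat.cast_nonneg m : (0:ℝ) ≤ m)])
  bound' x hx := by
    rw [abs_mul, abs_pow, abs_of_nonneg (by positivity)]
    exact mul_le_of_le_one_right (by positivity) (pow_le_one₀ (abs_nonneg x) hx)

/-- The differential inequality for the norms in `L ^ (2 k - 1)`, in integrated form. -/
lemma integral_pow_le {D : Domain} (h : WSol v τ 1 (fun _ _ => 0) z0 z) (hv : IsField K L v)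
    (hvf : D.IsFun v) (hz0f : D.IsFun z0) (hzf : ∀ t, D.IsFun (z t)) (hz : ∀ t x, 0 ≤ z t x)
    (hM : ∀ t, ∫⁻ x, ‖z t x‖ₑ ∂D.measure ≤ ENNReal.ofReal M)
    (hM0 : ∫⁻ x, ‖z0 x‖ₑ ∂D.measure ≤ ENNReal.ofReal M) (hM' : 1 ≤ M) {k : ℕ} (hk : 2 ≤ k)
    {t : ℝ} (ht : t ∈ Icc 0 τ) :
    ∫ x, z t x ^ (2 * k - 1) ∂D.measure ≤ ∫ x, z0 x ^ (2 * k - 1) ∂D.measure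
      - ∫ s in (0:ℝ)..t, D.nashConst k M * (∫ x, z s x ^ (2 * k - 1) ∂D.measure) ^ (1 + D.rate k) := by
  have hr := D.rate_pos hk
  obtain ⟨m, hm⟩ : ∃ m, 2 * k - 1 = m + 3 := ⟨2 * k - 4, by omega⟩
  have hm' : 2 * k - 3 = m + 1 := by omega
  rw [hm]
  refine h.integral_profile_le hv hvf hz0f hzf hz hM hM0 (by linarith) (profile_pow m)
    (Φ := fun E => D.nashConst k M * E ^ (1 + D.rate k))
    (continuous_const.mul (Real.continuous_rpow_const (by linarith))) ?_ ht
  rintro w hw h0 h1 hi hwM hdi ⟨C', hC'⟩ hI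
  have hn := nash D hk hM' hw h0 h1 hi hwM hdi hC'
  rw [hm, hm'] at hn
  refine hn.trans ?_
  -- The factor from the second derivative of the profile is at least one and is simply discarded.
  have hm2 : (1:ℝ) ≤ (m + 3) * (m + 2) := by
    nlinarith [(Nat.cast_nonneg m : (0:ℝ) ≤ m)]
  have e : ∀ x, ((m:ℝ) + 3) * (m + 2) * w x ^ (m + 1) * ∑ i, pd i w x ^ 2
      = ((m + 3) * (m + 2)) * (w x ^ (m + 1) * ∑ i, pd i w x ^ 2) := fun x => by ring
  simp only [e, integral_const_mul]
  refine le_mul_of_one_le_left (integral_nonneg fun x => ?_) hm2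
  exact mul_nonneg (pow_nonneg (h0 x) _) (Finset.sum_nonneg fun i _ => sq_nonneg _)

end WSol

/-! ### Decay of integral norms, uniform in the flow -/

/-- Algebraic decay from a superlinear integrated differential inequality. -/
lemma exists_decay {c β M : ℝ} (hc : 0 < c) (hβ : 0 < β) (hM : 0 < M) :
    ∃ Q : ℝ, 0 < Q ∧ ∀ (E : ℝ → ℝ) (τ : ℝ), (∀ t, 0 ≤ E t) → (∀ t ∈ Icc 0 τ, E t ≤ M) →
      (∀ s t, 0 ≤ s → s ≤ t → t ≤ τ → c * (t - s) * E t ^ (1 + β) ≤ E s) →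
      ∀ t ∈ Icc 1 τ, E t ≤ Q * t ^ (-(1 / β)) := by
  -- The second entry makes the claim hold on [1, 2]. The first closes the passage from t / 2 to t:
  -- c (t/2) E(t)^(1+β) ≤ Q (t/2)^(-1/β) must imply E(t) ≤ Q t^(-1/β), which amounts to Q^β ≥
  -- 2^((1+β)/β) / c.
  set Q := max ((2 ^ ((1 + β) / β) / c) ^ (1 / β)) (M * 2 ^ (1 / β)) with hQ
  have hQ0 : 0 < Q := lt_of_lt_of_le (by positivity) (le_max_right _ _)
  refine ⟨Q, hQ0, fun E τ hE0 hEM hE => ?_⟩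
  have hQβ : 2 ^ ((1 + β) / β) / c ≤ Q ^ β := by
    have h1 : (2 ^ ((1 + β) / β) / c) ^ (1 / β) ≤ Q := le_max_left _ _
    have h2 := Real.rpow_le_rpow (by positivity) h1 hβ.le
    rwa [← Real.rpow_mul (by positivity), one_div, inv_mul_cancel₀ hβ.ne', Real.rpow_one] at h2
  have key : ∀ n : ℕ, ∀ t ∈ Icc 1 τ, t ≤ 2 ^ (n + 1) → E t ≤ Q * t ^ (-(1 / β)) := by
    intro n
    induction n with
    | zero =>
      intro t ht h2
      have ht0 : 0 < t := one_pos.trans_le ht.1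
      calc E t ≤ M := hEM t ⟨ht0.le, ht.2⟩
        _ = M * 2 ^ (1 / β) * 2 ^ (-(1 / β)) := by
          rw [mul_assoc, ← Real.rpow_add (by norm_num)]; simp
        _ ≤ Q * t ^ (-(1 / β)) := by
          refine mul_le_mul (le_max_right _ _) (Real.rpow_le_rpow_of_nonpos ht0
            (by simpa using h2) ?_) (by positivity) hQ0.le
          rw [neg_nonpos]; positivity
    | succ n ih =>
      intro t ht h2
      have ht0 : 0 < t := one_pos.trans_le ht.1
      by_cases hle : t ≤ 2 ^ (n + 1)
      · exact ih t ht hle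
      · have h1 : 1 ≤ t / 2 := by
          have : (2:ℝ) ≤ 2 ^ (n + 1) := by
            rw [pow_succ]
            have : (1:ℝ) ≤ 2 ^ n := one_le_pow₀ (by norm_num)
            linarith
          linarith
        have h3 := ih (t / 2) ⟨h1, by linarith [ht.2]⟩ (by rw [pow_succ] at h2; linarith)
        have h4 := hE (t / 2) t (by linarith) (by linarith) ht.2
        have h5 : E t ^ (1 + β) ≤ (Q * t ^ (-(1 / β))) ^ (1 + β) := by
          have e1 : (t / 2) ^ (-(1 / β)) = t ^ (-(1 / β)) * 2 ^ (1 / β) := by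
            rw [Real.div_rpow ht0.le (by norm_num), Real.rpow_neg (by norm_num : (0:ℝ) ≤ 2), div_inv_eq_mul]
          have e2 : (t ^ (-(1 / β))) ^ (1 + β) = t ^ (-(1 / β)) * t⁻¹ := by
            rw [Real.rpow_add (by positivity), Real.rpow_one, ← Real.rpow_mul ht0.le]
            rw [show -(1 / β) * β = -1 by field_simp, Real.rpow_neg_one]
          have e3 : (2:ℝ) ^ ((1 + β) / β) = 2 * 2 ^ (1 / β) := by
            rw [show (1 + β) / β = 1 + 1 / β by field_simp; ring, Real.rpow_add (by norm_num),
              Real.rpow_one]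
          rw [Real.mul_rpow hQ0.le (by positivity), e2, Real.rpow_add hQ0, Real.rpow_one]
          rw [e1] at h3
          rw [e3, div_le_iff₀ hc] at hQβ
          have h6 : c * (t / 2) * E t ^ (1 + β) ≤ Q * (t ^ (-(1 / β)) * 2 ^ (1 / β)) := by
            have : t - t / 2 = t / 2 := by ring
            rw [this] at h4
            exact h4.trans h3
          have h7 : c * t * E t ^ (1 + β) ≤ c * t * (Q * Q ^ β * (t ^ (-(1 / β)) * t⁻¹)) := by
            calc c * t * E t ^ (1 + β) = 2 * (c * (t / 2) * E t ^ (1 + β)) := by ring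
              _ ≤ 2 * (Q * (t ^ (-(1 / β)) * 2 ^ (1 / β))) := by gcongr
              _ = (Q * t ^ (-(1 / β))) * (2 * 2 ^ (1 / β)) := by ring
              _ ≤ (Q * t ^ (-(1 / β))) * (Q ^ β * c) := by gcongr
              _ = _ := by field_simp
          exact le_of_mul_le_mul_left h7 (by positivity)
        exact (Real.rpow_le_rpow_iff (hE0 t) (by positivity) (by linarith)).1 h5
  intro t ht
  obtain ⟨n, hn⟩ := pow_unbounded_of_one_lt t (one_lt_two)
  exact key n t ht (hn.le.trans (pow_le_pow_right₀ (by norm_num) (by omega)))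

namespace WSol

variable {v : Plane → Plane} {τ C K L M : ℝ} {g : ℝ → Plane → ℝ} {z0 : Plane → ℝ}
  {z : ℝ → Plane → ℝ}

lemma exists_bound_weak (h : WSol v τ C g z0 z) (hv : IsField K L v) {ψ : Plane → ℝ}
    (hψ : IsTest ψ) :
    (Measurable fun s => ∫ x, (z s x * (∑ i, pd i (pd i ψ) x + ∑ i, v x i * pd i ψ x)
      + g s x * ψ x)) ∧
    ∃ M : ℝ, ∀ s, |∫ x, (z s x * (∑ i, pd i (pd i ψ) x + ∑ i, v x i * pd i ψ x)
      + g s x * ψ x)| ≤ M := by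
  have hm2 : ∀ i, Measurable (pd i (pd i ψ)) := fun i => ((hψ.pd i).pd i).continuous.measurable
  have hm1 : ∀ i, Measurable (pd i ψ) := fun i => (hψ.pd i).continuous.measurable
  have hm0 := hψ.continuous.measurable
  have hq : Measurable fun x => ∑ i, pd i (pd i ψ) x + ∑ i, v x i * pd i ψ x :=
    (Finset.measurable_fun_sum _ fun i _ => hm2 i).add
      (Finset.measurable_fun_sum _ fun i _ => (hv.measurable_apply i).mul (hm1 i))
  have hqi : Integrable fun x => ∑ i, pd i (pd i ψ) x + ∑ i, v x i * pd i ψ x :=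
    (integrable_finsetSum _ fun i _ => ((hψ.pd i).pd i).integrable).add
      (integrable_finsetSum _ fun i _ =>
        (hψ.pd i).integrable_mul (hv.measurable_apply i) (hv.abs_apply_le i))
  refine ⟨measurable_integral_of_uncurry ((h.measurable.mul (hq.comp measurable_snd)).add
      (h.measurable_source.mul (hm0.comp measurable_snd))),
    ∫ x, (C * |∑ i, pd i (pd i ψ) x + ∑ i, v x i * pd i ψ x| + C * |ψ x|), fun s => ?_⟩
  rw [← Real.norm_eq_abs]
  refine norm_integral_le_of_norm_le ((hqi.abs.const_mul C).fun_add
    (hψ.integrable.abs.const_mul C)) (ae_of_all _ fun x => ?_)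
  rw [Real.norm_eq_abs]
  refine (abs_add_le _ _).trans ?_
  rw [abs_mul, abs_mul]
  gcongr
  · exact h.bound s x
  · exact h.bound_source s x

lemma intervalIntegrable_weak (h : WSol v τ C g z0 z) (hv : IsField K L v) {ψ : Plane → ℝ}
    (hψ : IsTest ψ) (a b : ℝ) : IntervalIntegrable (fun s => ∫ x,
      (z s x * (∑ i, pd i (pd i ψ) x + ∑ i, v x i * pd i ψ x) + g s x * ψ x)) volume a b := by
  obtain ⟨hm, M, hM⟩ := h.exists_bound_weak hv hψ
  rw [intervalIntegrable_iff]
  exact Measure.integrableOn_of_bounded (M := M) (by simp) hm.aestronglyMeasurable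
    (ae_of_all _ hM)

/-- Restarting a solution at a later time. -/
lemma shift (h : WSol v τ C g z0 z) (hv : IsField K L v) {r : ℝ} (hr : r ∈ Icc 0 τ) :
    WSol v (τ - r) C (fun t => g (r + t)) (z r) (fun t => z (r + t)) where
  measurable := h.measurable.comp (f := fun p : ℝ × Plane => (r + p.1, p.2)) (by fun_prop)
  measurable_source :=
    h.measurable_source.comp (f := fun p : ℝ × Plane => (r + p.1, p.2)) (by fun_prop)
  measurable_zero := h.measurable_apply r
  bound t := h.bound (r + t)
  bound_source t := h.bound_source (r + t)
  bound_zero := h.bound r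
  weak t ht ψ hψ := by
    rw [h.weak (r + t) ⟨by linarith [hr.1, ht.1], by linarith [ht.2]⟩ ψ hψ, h.weak r hr ψ hψ,
      add_assoc]
    congr 1
    rw [intervalIntegral.integral_comp_add_left (fun s => ∫ x,
      (z s x * (∑ i, pd i (pd i ψ) x + ∑ i, v x i * pd i ψ x) + g s x * ψ x)) r, add_zero,
      intervalIntegral.integral_add_adjacent_intervals (h.intervalIntegrable_weak hv hψ _ _)
        (h.intervalIntegrable_weak hv hψ _ _)]

/-- The `L¹` norm is controlled by that of the initial datum. -/
lemma lintegral_le {D : Domain} (h : WSol v τ 1 (fun _ _ => 0) z0 z) (hv : IsField K L v)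
    (hvf : D.IsFun v) (hz0f : D.IsFun z0) (hzf : ∀ t, D.IsFun (z t)) (hz : ∀ t x, 0 ≤ z t x)
    (hz0 : ∀ x, 0 ≤ z0 x) {M' : ℝ}
    (hM' : ∀ t, ∫⁻ x, ‖z t x‖ₑ ∂D.measure ≤ ENNReal.ofReal M')
    (hM0 : ∫⁻ x, ‖z0 x‖ₑ ∂D.measure ≤ ENNReal.ofReal M) (hM : 0 ≤ M)
    {t : ℝ} (ht : t ∈ Icc 0 τ) : ∫⁻ x, ‖z t x‖ₑ ∂D.measure ≤ ENNReal.ofReal M := by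
  have hm := h.measurable_apply t
  have key := h.integral_le hv hvf hz0f hzf hz (M := max M M')
    (fun t => (hM' t).trans (ENNReal.ofReal_le_ofReal (le_max_right _ _)))
    (hM0.trans (ENNReal.ofReal_le_ofReal (le_max_left _ _))) (hM.trans (le_max_left _ _)) ht
  have e : ∀ f : Plane → ℝ, Measurable f → (∀ x, 0 ≤ f x) →
      ∫ x, f x ∂D.measure = (∫⁻ x, ‖f x‖ₑ ∂D.measure).toReal := fun f hf h0 => by
    rw [← integral_abs_eq_toReal hf.aestronglyMeasurable]
    exact integral_congr_ae (ae_of_all _ fun x => (abs_of_nonneg (h0 x)).symm)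
  rw [e _ hm (hz t), e _ h.measurable_zero hz0] at key
  refine le_trans ?_ hM0
  exact (ENNReal.toReal_le_toReal ((hM' t).trans_lt ENNReal.ofReal_lt_top).ne
    (hM0.trans_lt ENNReal.ofReal_lt_top).ne).1 key

end WSol

/-- Decay of the norms in `L ^ (2 k - 1)`, uniform in the flow. -/
lemma exists_integral_pow_decay (D : Domain) {k : ℕ} (hk : 2 ≤ k) {M : ℝ} (hM : 1 ≤ M) :
    ∃ Q : ℝ, 0 < Q ∧ ∀ {v : Plane → Plane} {τ K L : ℝ} {z0 : Plane → ℝ} {z : ℝ → Plane → ℝ},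
      WSol v τ 1 (fun _ _ => 0) z0 z → IsField K L v → D.IsFun v →
      (∀ t, D.IsFun (z t)) → (∀ t x, 0 ≤ z t x) →
      (∀ t, ∫⁻ x, ‖z t x‖ₑ ∂D.measure ≤ ENNReal.ofReal M) →
      ∀ t ∈ Icc 1 τ, ∫ x, z t x ^ (2 * k - 1) ∂D.measure ≤ Q * t ^ (-(1 / D.rate k)) := by
  have hβ := D.rate_pos hk
  have hc := D.nashConst_pos hk hM
  obtain ⟨Q, hQ, H⟩ := exists_decay hc hβ (by linarith : 0 < M)
  refine ⟨Q, hQ, fun {v τ K L z0 z} h hv hvf hzf hz hzM => ?_⟩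
  have hE0 : ∀ t, 0 ≤ ∫ x, z t x ^ (2 * k - 1) ∂D.measure := fun t =>
    integral_nonneg fun x => pow_nonneg (hz t x) _
  have hz1 : ∀ t x, z t x ≤ 1 := fun t x => (abs_le.1 (h.bound t x)).2
  have hzi : ∀ t, Integrable (z t) D.measure := fun t =>
    ⟨(h.measurable_apply t).aestronglyMeasurable, (hzM t).trans_lt ENNReal.ofReal_lt_top⟩
  have hEM : ∀ t, ∫ x, z t x ^ (2 * k - 1) ∂D.measure ≤ M := by
    intro t
    have h1 : ∫ x, z t x ^ (2 * k - 1) ∂D.measure ≤ ∫ x, z t x ∂D.measure := by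
      refine integral_mono_of_nonneg (ae_of_all _ fun x => pow_nonneg (hz t x) _) (hzi t)
        (ae_of_all _ fun x => pow_le_of_le_one (hz t x) (hz1 t x) (by omega))
    have h2 := integral_abs_eq_toReal (hzi t).1
    rw [integral_congr_ae (ae_of_all _ fun x => abs_of_nonneg (hz t x))] at h2
    rw [h2] at h1
    exact h1.trans (ENNReal.toReal_le_of_le_ofReal (by linarith) (hzM t))
  -- The energy inequality starts from the initial time, so the solution is restarted at time s.
  have hstep : ∀ s t, 0 ≤ s → s ≤ t → t ≤ τ → ∫ x, z t x ^ (2 * k - 1) ∂D.measure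
      ≤ ∫ x, z s x ^ (2 * k - 1) ∂D.measure - ∫ r in s..t,
        D.nashConst k M * (∫ x, z r x ^ (2 * k - 1) ∂D.measure) ^ (1 + D.rate k) := by
    intro s t hs hst ht
    have := (h.shift hv ⟨hs, hst.trans ht⟩).integral_pow_le hv hvf (hzf s) (fun t => hzf (s + t))
      (fun t => hz (s + t)) (fun t => hzM (s + t)) (hzM s) hM hk (t := t - s)
      ⟨by linarith, by linarith⟩
    rw [intervalIntegral.integral_comp_add_left (fun r =>
      D.nashConst k M * (∫ x, z r x ^ (2 * k - 1) ∂D.measure) ^ (1 + D.rate k)) s] at this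
    simpa using this
  have hanti : ∀ s t, 0 ≤ s → s ≤ t → t ≤ τ → ∫ x, z t x ^ (2 * k - 1) ∂D.measure
      ≤ ∫ x, z s x ^ (2 * k - 1) ∂D.measure := by
    intro s t hs hst ht
    refine (hstep s t hs hst ht).trans (sub_le_self _ ?_)
    exact intervalIntegral.integral_nonneg hst fun r _ =>
      mul_nonneg hc.le (Real.rpow_nonneg (hE0 r) _)
  refine H (fun t => ∫ x, z t x ^ (2 * k - 1) ∂D.measure) τ hE0 (fun t _ => hEM t) ?_
  intro s t hs hst ht
  have hm : Measurable fun r =>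
      D.nashConst k M * (∫ x, z r x ^ (2 * k - 1) ∂D.measure) ^ (1 + D.rate k) :=
    ((measurable_integral_of_uncurry (F := fun r x => z r x ^ (2 * k - 1))
      (h.measurable.pow_const _)).pow_const _).const_mul _
  have hi : IntervalIntegrable (fun r =>
      D.nashConst k M * (∫ x, z r x ^ (2 * k - 1) ∂D.measure) ^ (1 + D.rate k)) volume s t := by
    rw [intervalIntegrable_iff]
    refine Measure.integrableOn_of_bounded (M := D.nashConst k M * M ^ (1 + D.rate k)) (by simp)
      hm.aestronglyMeasurable (ae_of_all _ fun r => ?_)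
    rw [Real.norm_eq_abs, abs_of_nonneg (mul_nonneg hc.le (Real.rpow_nonneg (hE0 r) _))]
    gcongr
    · exact hE0 r
    · exact hEM r
  -- The energy is nonincreasing, so its final value bounds the integrand from below. This gives the
  -- derivative-free inequality required by `exists_decay`.
  have h1 := intervalIntegral.integral_mono_on hst
    (f := fun _ => D.nashConst k M * (∫ x, z t x ^ (2 * k - 1) ∂D.measure) ^ (1 + D.rate k))
    intervalIntegrable_const hi (fun r hr => by
      have := hanti r t (hs.trans hr.1) hr.2 ht
      gcongr
      exact hE0 t)
  rw [intervalIntegral.integral_const, smul_eq_mul] at h1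
  have h2 := hstep s t hs hst ht
  have h3 := hE0 t
  calc _ = (t - s) * (D.nashConst k M *
        (∫ x, z t x ^ (2 * k - 1) ∂D.measure) ^ (1 + D.rate k)) := by ring
    _ ≤ _ := by linarith

/-! ### The heat kernel -/

section Gauss

open ProbabilityTheory

lemma hasDerivAt_gaussianPDFReal (x : ℝ) :
    HasDerivAt (gaussianPDFReal 0 2) (-(x / 2) * gaussianPDFReal 0 2 x) x := by
  simp only [gaussianPDFReal_def]
  have h1 : HasDerivAt (fun x : ℝ => -(x - 0) ^ 2 / (2 * ((2 : ℝ≥0) : ℝ))) (-(x / 2)) x := by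
    have := (((hasDerivAt_id x).sub_const 0).pow 2).neg.div_const (2 * ((2 : ℝ≥0) : ℝ))
    refine this.congr_deriv ?_
    simp
    ring
  refine (h1.exp.const_mul _).congr_deriv ?_
  ring

lemma integrable_id_mul_gaussianPDFReal :
    Integrable fun x : ℝ => x * gaussianPDFReal 0 2 x := by
  have h := (integrable_mul_exp_neg_mul_sq (b := 1 / 4) (by norm_num)).const_mul
    (√(2 * Real.pi * (2 : ℝ≥0)))⁻¹
  refine h.congr (ae_of_all _ fun x => ?_)
  simp only [gaussianPDFReal_def]
  have e : -(x - 0) ^ 2 / (2 * ((2 : ℝ≥0) : ℝ)) = -(1 / 4) * x ^ 2 := by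
    simp
    ring
  rw [e]
  ring

/-- Gaussian integration by parts on the line. -/
lemma integral_id_mul_gaussianReal {f f' : ℝ → ℝ} (hf : ∀ x, HasDerivAt f (f' x) x)
    (hf' : Continuous f') {C : ℝ} (hC : ∀ x, |f x| ≤ C) (hC' : ∀ x, |f' x| ≤ C) :
    ∫ x, x * f x ∂(gaussianReal 0 2) = 2 * ∫ x, f' x ∂(gaussianReal 0 2) := by
  have hfc : Continuous f := continuous_iff_continuousAt.2 fun x => (hf x).continuousAt
  have ip := integrable_gaussianPDFReal 0 2
  rw [integral_gaussianReal_eq_integral_smul two_ne_zero,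
    integral_gaussianReal_eq_integral_smul two_ne_zero]
  have h := integral_mul_deriv_eq_deriv_mul_of_integrable (u := f) (u' := f')
    (v := gaussianPDFReal 0 2) (v' := fun x => -(x / 2) * gaussianPDFReal 0 2 x)
    (fun x _ => hf x) (fun x _ => hasDerivAt_gaussianPDFReal x) ?_ ?_ ?_
  · have e1 : ∫ x, gaussianPDFReal 0 2 x • (x * f x)
        = -2 * ∫ x, f x * (-(x / 2) * gaussianPDFReal 0 2 x) := by
      rw [← integral_const_mul]
      refine integral_congr_ae (ae_of_all _ fun x => ?_)
      simp only [smul_eq_mul]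
      ring
    rw [e1, h, neg_mul_neg]
    congr 1
    refine integral_congr_ae (ae_of_all _ fun x => ?_)
    simp only [smul_eq_mul]
    ring
  · refine Integrable.bdd_mul (c := C) ?_ hfc.aestronglyMeasurable (ae_of_all _ hC)
    refine (integrable_id_mul_gaussianPDFReal.const_mul (-(1 / 2))).congr (ae_of_all _ fun x => ?_)
    simp only
    ring
  · exact ip.bdd_mul (c := C) hf'.aestronglyMeasurable (ae_of_all _ hC')
  · exact ip.bdd_mul (c := C) hfc.aestronglyMeasurable (ae_of_all _ hC)

/-- The Gaussian measure on the plane with covariance `2 I`, i.e. the heat kernel at time one. -/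
def gauss : Measure Plane := ((gaussianReal 0 2).prod (gaussianReal 0 2)).map coord

instance : IsProbabilityMeasure gauss := by
  unfold gauss
  exact Measure.isProbabilityMeasure_map coord.measurable.aemeasurable

lemma integrable_id_gaussianReal : Integrable (fun x : ℝ => x) (gaussianReal 0 2) :=
  (memLp_id_gaussianReal 1).integrable le_rfl

lemma integrable_apply_gauss (i : Fin 2) : Integrable (fun z : Plane => z i) gauss := by
  unfold gauss
  rw [integrable_map_equiv coord]
  fin_cases i
  · exact integrable_id_gaussianReal.comp_fst _
  · exact integrable_id_gaussianReal.comp_snd _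

/-- Gaussian integration by parts on the plane. -/
lemma integral_apply_mul_gauss {f : Plane → ℝ} (hf : ContDiff ℝ 1 f) {C : ℝ}
    (hC : ∀ x, |f x| ≤ C) (hC' : ∀ i x, |pd i f x| ≤ C) (i : Fin 2) :
    ∫ z, z i * f z ∂gauss = 2 * ∫ z, pd i f z ∂gauss := by
  have hfc := hf.continuous
  have i1 : Integrable (fun p : ℝ × ℝ => coord p i * f (coord p))
      ((gaussianReal 0 2).prod (gaussianReal 0 2)) := by
    rw [← Function.comp_def (fun z : Plane => z i * f z) coord, ← integrable_map_equiv coord]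
    exact (integrable_apply_gauss i).mul_bdd (c := C) hfc.aestronglyMeasurable (ae_of_all _ hC)
  have i2 : Integrable (fun p : ℝ × ℝ => pd i f (coord p))
      ((gaussianReal 0 2).prod (gaussianReal 0 2)) := by
    rw [← Function.comp_def (pd i f) coord, ← integrable_map_equiv coord]
    have := Measure.isProbabilityMeasure_map (μ := (gaussianReal 0 2).prod (gaussianReal 0 2))
      coord.measurable.aemeasurable
    exact Integrable.of_bound (continuous_pd hf i).aestronglyMeasurable C (ae_of_all _ (hC' i))
  unfold gauss
  rw [integral_map_equiv, integral_map_equiv]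
  have hcc := continuous_coord
  fin_cases i
  · rw [integral_prod_symm _ i1, integral_prod_symm _ i2, ← integral_const_mul]
    refine integral_congr_ae (ae_of_all _ fun y => ?_)
    exact integral_id_mul_gaussianReal (f := fun x => f (coord (x, y)))
      (f' := fun x => pd 0 f (coord (x, y))) (fun x => hasDerivAt_coord_fst hf x y)
      ((continuous_pd hf 0).comp (hcc.comp (by fun_prop))) (fun x => hC _) fun x => hC' 0 _
  · rw [integral_prod _ i1, integral_prod _ i2, ← integral_const_mul]
    refine integral_congr_ae (ae_of_all _ fun x => ?_)
    exact integral_id_mul_gaussianReal (f := fun y => f (coord (x, y)))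
      (f' := fun y => pd 1 f (coord (x, y))) (fun y => hasDerivAt_coord_snd hf x y)
      ((continuous_pd hf 1).comp (hcc.comp (by fun_prop))) (fun x => hC _) fun x => hC' 1 _

end Gauss

/-! ### The heat semigroup as a Gaussian average -/

section Heat

/-- The heat semigroup at time `ρ ^ 2`. -/
def heat (ρ : ℝ) (ψ : Plane → ℝ) (y : Plane) : ℝ := ∫ z, ψ (y + ρ • z) ∂gauss

lemma abs_heat_le {ψ : Plane → ℝ} {C : ℝ} (hC : ∀ x, |ψ x| ≤ C) (ρ : ℝ) (y : Plane) :
    |heat ρ ψ y| ≤ C := by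
  simpa [heat] using abs_integral_le_of_bdd (μ := gauss) (f := fun z => ψ (y + ρ • z)) (b := C)
    fun z => hC _

lemma heat_zero (ψ : Plane → ℝ) (y : Plane) : heat 0 ψ y = ψ y := by simp [heat]

lemma measurable_heat {ψ : Plane → ℝ} (hψ : Measurable ψ) :
    Measurable fun p : ℝ × Plane => heat p.1 ψ p.2 := by
  have : StronglyMeasurable fun q : (ℝ × Plane) × Plane => ψ (q.1.2 + q.1.1 • q.2) :=
    (hψ.comp (by fun_prop)).stronglyMeasurable
  exact (this.integral_prod_right (ν := gauss)).measurable

lemma integrable_comp_gauss {ψ : Plane → ℝ} (hψ : Continuous ψ) {C : ℝ} (hC : ∀ x, |ψ x| ≤ C)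
    (ρ : ℝ) (y : Plane) : Integrable (fun z => ψ (y + ρ • z)) gauss :=
  Integrable.of_bound (by fun_prop) C (ae_of_all _ fun z => hC _)

lemma pd_comp_affine {f : Plane → ℝ} (hf : Differentiable ℝ f) (ρ : ℝ) (y z : Plane)
    (i : Fin 2) : pd i (fun z => f (y + ρ • z)) z = ρ * pd i f (y + ρ • z) := by
  have h1 := (hf (y + ρ • z)).hasFDerivAt
  have h2 : HasFDerivAt (fun z : Plane => y + ρ • z) (ρ • ContinuousLinearMap.id ℝ Plane) z :=
    (ρ • ContinuousLinearMap.id ℝ Plane).hasFDerivAt.const_add y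
  have h3 := (h1.comp z h2).fderiv
  simp only [Function.comp_def] at h3
  simp [pd, h3]

lemma exists_bound_pd {ψ : Plane → ℝ} (hψ : IsTest ψ) :
    ∃ C, (∀ x, |ψ x| ≤ C) ∧ ∀ i x, |pd i ψ x| ≤ C := by
  obtain ⟨a, ha⟩ := hψ.exists_bound
  choose b hb using fun i => (hψ.pd i).exists_bound
  have hb0 : ∀ i, 0 ≤ b i := fun i => (abs_nonneg _).trans (hb i 0)
  have ha0 : 0 ≤ a := (abs_nonneg _).trans (ha 0)
  refine ⟨a + ∑ i, b i, fun x => (ha x).trans ?_, fun i x => (hb i x).trans ?_⟩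
  · linarith [Finset.sum_nonneg fun i (_ : i ∈ Finset.univ) => hb0 i]
  · linarith [Finset.single_le_sum (fun i _ => hb0 i) (Finset.mem_univ i)]

/-- Up to the factor 2ρ, inserting the weight z_i is the same as differentiating the heat flow. This
gives access to the gradient of the heat semigroup without a derivative of the function it acts on.
-/
lemma integral_apply_mul_comp_gauss {ψ : Plane → ℝ} (hψ : IsTest ψ) (ρ : ℝ) (y : Plane)
    (i : Fin 2) : ∫ z, z i * ψ (y + ρ • z) ∂gauss = 2 * ρ * heat ρ (pd i ψ) y := by
  obtain ⟨C, hC, hC'⟩ := exists_bound_pd hψ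
  have hd : Differentiable ℝ ψ := hψ.1.differentiable (by simp)
  have hC0 : 0 ≤ C := (abs_nonneg _).trans (hC 0)
  have h := integral_apply_mul_gauss (f := fun z => ψ (y + ρ • z))
    ((hψ.1.of_le (by simp)).comp (contDiff_const.add (contDiff_const_smul ρ)))
    (C := C + |ρ| * C) (fun x => (hC _).trans (by linarith [mul_nonneg (abs_nonneg ρ) hC0]))
    (fun j x => by
      rw [pd_comp_affine hd, abs_mul]
      linarith [mul_le_mul_of_nonneg_left (hC' j (y + ρ • x)) (abs_nonneg ρ)]) i
  rw [h]
  simp only [pd_comp_affine hd, heat]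
  rw [integral_const_mul]
  ring

/-- Differentiation under the integral produces Σ z_i ∂_i ψ(y + ρz), and Gaussian integration by
parts turns each weight z_i into a second derivative. This is the heat equation in the variable ρ =
√time. -/
lemma hasDerivAt_heat {ψ : Plane → ℝ} (hψ : IsTest ψ) (y : Plane) (ρ : ℝ) :
    HasDerivAt (fun ρ => heat ρ ψ y) (2 * ρ * heat ρ (fun x => ∑ i, pd i (pd i ψ) x) y) ρ := by
  obtain ⟨C, hC, hC'⟩ := exists_bound_pd hψ
  choose C2 hC2 using fun i => ((hψ.pd i).pd i).exists_bound
  have hd : Differentiable ℝ ψ := hψ.1.differentiable (by simp)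
  have hC0 : 0 ≤ C := (abs_nonneg _).trans (hC 0)
  have hcψ := hψ.continuous
  have hc1 : ∀ i, Continuous (pd i ψ) := fun i => (hψ.pd i).continuous
  have hc2 : ∀ i, Continuous (pd i (pd i ψ)) := fun i => ((hψ.pd i).pd i).continuous
  have i1 : ∀ i, Integrable (fun z : Plane => z i * pd i ψ (y + ρ • z)) gauss := fun i =>
    (integrable_apply_gauss i).mul_bdd (c := C) (by fun_prop) (ae_of_all _ fun z => hC' i _)
  have h := hasDerivAt_integral_of_dominated_loc_of_deriv_le (μ := gauss) (x₀ := ρ) (s := univ)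
    (F := fun ρ z => ψ (y + ρ • z)) (F' := fun ρ z => ∑ i, z i * pd i ψ (y + ρ • z))
    (bound := fun z => ∑ i, |z i| * C) univ_mem
    (Eventually.of_forall fun ρ => by fun_prop) (integrable_comp_gauss hcψ hC ρ y)
    (by fun_prop)
    (ae_of_all _ fun z r _ => by
      rw [Real.norm_eq_abs]
      refine (Finset.abs_sum_le_sum_abs _ _).trans (Finset.sum_le_sum fun i _ => ?_)
      rw [abs_mul]
      gcongr
      exact hC' i _)
    (integrable_finsetSum _ fun i _ => (integrable_apply_gauss i).abs.mul_const C)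
    (ae_of_all _ fun z r _ => by
      have h1 := (hd (y + r • z)).hasFDerivAt
      have h2 : HasDerivAt (fun r : ℝ => y + r • z) z r := by
        simpa using ((hasDerivAt_id r).smul_const z).const_add y
      have h3 := h1.comp_hasDerivAt r h2
      rwa [fderiv_eq_sum] at h3)
  refine h.2.congr_deriv ?_
  rw [integral_finsetSum _ fun i _ => i1 i]
  simp only [integral_apply_mul_comp_gauss (hψ.pd _)]
  rw [← Finset.mul_sum]
  congr 1
  simp only [heat]
  rw [integral_finsetSum _ fun i _ => integrable_comp_gauss (hc2 i) (hC2 i) ρ y]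

/-- The factor 2ρ cancels against the derivative of the square root. As √ is not differentiable at
0, only continuity is used at the left endpoint. -/
lemma heat_sqrt_eq {ψ : Plane → ℝ} (hψ : IsTest ψ) (y : Plane) {r : ℝ} (hr : 0 ≤ r) :
    heat (√r) ψ y = ψ y + ∫ σ in (0:ℝ)..r, heat (√σ) (fun x => ∑ i, pd i (pd i ψ) x) y := by
  choose C2 hC2 using fun i => ((hψ.pd i).pd i).exists_bound
  have hcont : Continuous fun σ => heat (√σ) ψ y := by
    have : Continuous fun ρ => heat ρ ψ y :=
      continuous_iff_continuousAt.2 fun ρ => (hasDerivAt_heat hψ y ρ).continuousAt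
    exact this.comp Real.continuous_sqrt
  have hm2 : Measurable fun x => ∑ i, pd i (pd i ψ) x :=
    Finset.measurable_fun_sum _ fun i _ => ((hψ.pd i).pd i).continuous.measurable
  have h := intervalIntegral.integral_eq_sub_of_hasDerivAt_of_le hr hcont.continuousOn
    (f' := fun σ => heat (√σ) (fun x => ∑ i, pd i (pd i ψ) x) y) (fun σ hσ => by
      have h1 := (hasDerivAt_heat hψ y (√σ)).comp σ (Real.hasDerivAt_sqrt hσ.1.ne')
      refine h1.congr_deriv ?_
      have := Real.sqrt_pos.2 hσ.1
      field_simp) (by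
      rw [intervalIntegrable_iff]
      refine Measure.integrableOn_of_bounded (M := ∑ i, C2 i) (by simp) ?_ (ae_of_all _ fun σ => ?_)
      · exact ((measurable_heat hm2).comp (f := fun σ => (√σ, y))
          (by fun_prop)).aestronglyMeasurable
      · exact abs_heat_le (fun x => (Finset.abs_sum_le_sum_abs _ _).trans
          (Finset.sum_le_sum fun i _ => hC2 i x)) _ _)
  rw [h, Real.sqrt_zero, heat_zero]
  ring

end Heat

/-! ### Causal convolutions and weighted translates -/

section Triangle

/-- Fubini's theorem on a triangle. -/
lemma integral_triangle_swap {F : ℝ → ℝ → ℝ} {t C : ℝ} (ht : 0 ≤ t)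
    (hF : Measurable (Function.uncurry F)) (hC : ∀ r ≤ t, ∀ s, |F r s| ≤ C) :
    IntervalIntegrable (fun r => ∫ s in r..t, F r s) volume 0 t ∧
    IntervalIntegrable (fun s => ∫ r in (0:ℝ)..s, F r s) volume 0 t ∧
    ∫ r in (0:ℝ)..t, ∫ s in r..t, F r s = ∫ s in (0:ℝ)..t, ∫ r in (0:ℝ)..s, F r s := by
  let G : ℝ → ℝ → ℝ := fun r s => (Ioi r).indicator (fun s => F r s) s
  have hS : MeasurableSet {p : ℝ × ℝ | p.1 < p.2} := measurableSet_lt measurable_fst measurable_snd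
  have hG : Measurable (Function.uncurry G) := by
    have : Function.uncurry G = {p : ℝ × ℝ | p.1 < p.2}.indicator (Function.uncurry F) := by
      funext p
      simp only [G, Function.uncurry, indicator, mem_Ioi, mem_ofPred_eq]
    rw [this]
    exact hF.indicator hS
  have hI : Integrable (Function.uncurry G)
      ((volume.restrict (Ioc 0 t)).prod (volume.restrict (Ioc 0 t))) := by
    have hfin : IsFiniteMeasure ((volume.restrict (Ioc 0 t)).prod (volume.restrict (Ioc 0 t))) :=
      inferInstance
    have hae : ∀ᵐ p ∂((volume.restrict (Ioc 0 t)).prod (volume.restrict (Ioc 0 t))),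
        p ∈ Ioc 0 t ×ˢ Ioc 0 t := by
      rw [Measure.prod_restrict]
      exact ae_restrict_mem (measurableSet_Ioc.prod measurableSet_Ioc)
    refine Integrable.of_bound hG.aestronglyMeasurable C ?_
    filter_upwards [hae] with p hp
    have h1 := hC p.1 hp.1.2 p.2
    simp only [G, Function.uncurry, indicator]
    split_ifs
    · exact h1
    · simpa using (abs_nonneg _).trans h1
  have hswap := integral_integral_swap hI
  have e1 : ∀ r ∈ Ioc 0 t, ∫ s in r..t, F r s = ∫ s in Ioc 0 t, G r s := by
    intro r hr
    rw [intervalIntegral.integral_of_le hr.2, setIntegral_indicator measurableSet_Ioi]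
    congr 2
    ext s
    simp only [mem_Ioc, mem_inter_iff, mem_Ioi]
    constructor
    · exact fun h => ⟨⟨hr.1.trans h.1, h.2⟩, h.1⟩
    · exact fun h => ⟨h.2, h.1.2⟩
  have e2 : ∀ s ∈ Ioc 0 t, ∫ r in (0:ℝ)..s, F r s = ∫ r in Ioc 0 t, G r s := by
    intro s hs
    have : ∀ r, G r s = (Iio s).indicator (fun r => F r s) r := fun r => by
      simp only [G, indicator, mem_Ioi, mem_Iio]
    simp only [this]
    rw [intervalIntegral.integral_of_le hs.1.le, setIntegral_indicator measurableSet_Iio,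
      integral_Ioc_eq_integral_Ioo]
    congr 2
    ext r
    simp only [mem_Ioc, mem_inter_iff, mem_Iio, mem_Ioo]
    exact ⟨fun h => ⟨⟨h.1, h.2.le.trans hs.2⟩, h.2⟩, fun h => ⟨h.1.1, h.2⟩⟩
  refine ⟨?_, ?_, ?_⟩
  · rw [intervalIntegrable_iff_integrableOn_Ioc_of_le ht]
    exact IntegrableOn.congr_fun hI.integral_prod_left (fun r hr => (e1 r hr).symm)
      measurableSet_Ioc
  · rw [intervalIntegrable_iff_integrableOn_Ioc_of_le ht]
    exact IntegrableOn.congr_fun hI.integral_prod_right (fun s hs => (e2 s hs).symm)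
      measurableSet_Ioc
  · rw [intervalIntegral.integral_of_le ht, intervalIntegral.integral_of_le ht,
      setIntegral_congr_fun measurableSet_Ioc e1, setIntegral_congr_fun measurableSet_Ioc e2]
    exact hswap

lemma setIntegral_Ioi_eq {f : ℝ → ℝ} {t : ℝ} (ht : 0 ≤ t) (hf : ∀ r, t < r → f r = 0) :
    ∫ r in Ioi 0, f r = ∫ r in (0:ℝ)..t, f r := by
  rw [intervalIntegral.integral_of_le ht]
  refine setIntegral_eq_of_subset_of_forall_sdiff_eq_zero measurableSet_Ioi
    (fun r hr => hr.1) fun r hr => hf r ?_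
  by_contra hle
  exact hr.2 ⟨hr.1, not_lt.1 hle⟩

/-- The time integral of a causal convolution. -/
lemma integral_causal {h k : ℝ → ℝ → ℝ} {t C : ℝ} (ht : 0 ≤ t)
    (hk : Measurable (Function.uncurry k)) (hkC : ∀ s ≤ t, ∀ r, |k s r| ≤ C)
    (hk0 : ∀ s < 0, ∀ r, k s r = 0) (hh0 : ∀ s < 0, ∀ r, h s r = 0)
    (hhm : Measurable fun s => h s 0) (hhC : ∀ s ≤ t, |h s 0| ≤ C)
    (heq : ∀ s r, 0 ≤ r → h s r = h s 0 + ∫ σ in (0:ℝ)..r, k s σ) :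
    ∫ r in Ioi 0, h (t - r) r
      = ∫ s in (0:ℝ)..t, (h s 0 + ∫ r in Ioi 0, k (s - r) r) := by
  rw [setIntegral_Ioi_eq ht fun r hr => hh0 _ (by linarith) _]
  have e0 : ∫ r in (0:ℝ)..t, h (t - r) r = ∫ s in (0:ℝ)..t, h s (t - s) := by
    have := intervalIntegral.integral_comp_sub_left (a := 0) (b := t) (fun s => h s (t - s)) t
    simpa using this
  rw [e0]
  let F : ℝ → ℝ → ℝ := fun r s => k r (s - r)
  have hF : Measurable (Function.uncurry F) :=
    hk.comp (f := fun p : ℝ × ℝ => (p.1, p.2 - p.1)) (by fun_prop)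
  have e1 : ∀ s ∈ uIcc 0 t, h s (t - s) = h s 0 + ∫ r in s..t, F s r := by
    intro s hs
    rw [uIcc_of_le ht] at hs
    rw [heq s _ (by linarith [hs.2])]
    have := intervalIntegral.integral_comp_sub_right (a := s) (b := t) (fun r => k s r) s
    simp only [sub_self] at this
    rw [← this]
  have e2 : ∀ s ∈ uIcc 0 t, h s 0 + ∫ r in Ioi 0, k (s - r) r
      = h s 0 + ∫ r in (0:ℝ)..s, F r s := by
    intro s hs
    rw [uIcc_of_le ht] at hs
    rw [setIntegral_Ioi_eq hs.1 fun r hr => hk0 _ (by linarith) _]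
    have := intervalIntegral.integral_comp_sub_left (a := 0) (b := s) (fun r => k r (s - r)) s
    simp only [sub_zero, sub_self, sub_sub_cancel] at this
    rw [this]
  -- With F(r, s) = k(r, s - r) both sides are integrals over the same triangle, taken in the two
  -- possible orders.
  rw [intervalIntegral.integral_congr e1, intervalIntegral.integral_congr e2]
  have hFC : ∀ r ≤ t, ∀ s, |F r s| ≤ C := fun r hr s => hkC r hr _
  have ih : IntervalIntegrable (fun s => h s 0) volume 0 t := by
    rw [intervalIntegrable_iff]
    refine Measure.integrableOn_of_bounded (M := C) (by simp) hhm.aestronglyMeasurable ?_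
    rw [ae_restrict_iff' measurableSet_uIoc]
    refine ae_of_all _ fun s hs => ?_
    rw [uIoc_of_le ht] at hs
    exact hhC s hs.2
  obtain ⟨i1, i2, hsw⟩ := integral_triangle_swap ht hF hFC
  rw [intervalIntegral.integral_add ih i1, intervalIntegral.integral_add ih i2, hsw]

end Triangle

section Shift

variable {b : Plane → ℝ} {f : Plane → ℝ} {C : ℝ}

/-- Weighted average of the translates of a function at scale `ρ`. -/
def gshift (b : Plane → ℝ) (ρ : ℝ) (f : Plane → ℝ) (x : Plane) : ℝ :=
  ∫ z, b z * f (x + ρ • z) ∂gauss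

lemma heat_eq_gshift (ρ : ℝ) (f : Plane → ℝ) : heat ρ f = gshift (fun _ => 1) ρ f := by
  funext x; simp [heat, gshift]

lemma abs_gshift_le (hb : Integrable b gauss) (hC : ∀ x, |f x| ≤ C) (ρ : ℝ) (x : Plane) :
    |gshift b ρ f x| ≤ (∫ z, |b z| ∂gauss) * C := by
  rw [gshift, ← Real.norm_eq_abs, ← integral_mul_const]
  refine norm_integral_le_of_norm_le (hb.abs.mul_const C) (ae_of_all _ fun z => ?_)
  rw [Real.norm_eq_abs, abs_mul]
  gcongr
  exact hC _

lemma measurable_gshift {α : Type*} [MeasurableSpace α] (hb : Measurable b) {ρ : α → ℝ}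
    (hρ : Measurable ρ) {F : α → Plane → ℝ} (hF : Measurable (Function.uncurry F)) :
    Measurable (Function.uncurry fun a x => gshift b (ρ a) (F a) x) := by
  have : StronglyMeasurable fun q : (α × Plane) × Plane =>
      b q.2 * F q.1.1 (q.1.2 + ρ q.1.1 • q.2) :=
    ((hb.comp measurable_snd).mul (hF.comp (f := fun q : (α × Plane) × Plane =>
      (q.1.1, q.1.2 + ρ q.1.1 • q.2)) (by fun_prop))).stronglyMeasurable
  exact (this.integral_prod_right (ν := gauss)).measurable

lemma Domain.IsFun.gshift {D : Domain} (hf : D.IsFun f) (b : Plane → ℝ) (ρ : ℝ) :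
    D.IsFun (gshift b ρ f) := by
  cases D
  · trivial
  · intro x
    refine integral_congr_ae (ae_of_all _ fun z => ?_)
    simp only
    rw [add_right_comm, hf]

/-- Minkowski's inequality and translation invariance. The average runs over shifts in the whole
plane, which on the strip makes sense for lifts only. -/
lemma lintegral_gshift_le {D : Domain} (hb : Measurable b) (hm : Measurable f) (hf : D.IsFun f)
    (ρ : ℝ) : ∫⁻ x, ‖gshift b ρ f x‖ₑ ∂D.measure
      ≤ (∫⁻ z, ‖b z‖ₑ ∂gauss) * ∫⁻ x, ‖f x‖ₑ ∂D.measure := by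
  calc ∫⁻ x, ‖gshift b ρ f x‖ₑ ∂D.measure
      ≤ ∫⁻ x, ∫⁻ z, ‖b z‖ₑ * ‖f (x + ρ • z)‖ₑ ∂gauss ∂D.measure := by
        refine lintegral_mono fun x => (enorm_integral_le_lintegral_enorm _).trans (le_of_eq ?_)
        simp only [enorm_mul]
    _ = ∫⁻ z, ∫⁻ x, ‖b z‖ₑ * ‖f (x + ρ • z)‖ₑ ∂D.measure ∂gauss := by
        refine lintegral_lintegral_swap ?_
        apply Measurable.aemeasurable
        fun_prop
    _ = ∫⁻ z, ‖b z‖ₑ * ∫⁻ x, ‖f x‖ₑ ∂D.measure ∂gauss := by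
        refine lintegral_congr fun z => ?_
        rw [lintegral_const_mul _ (by fun_prop),
          lintegral_translate D (g := fun x => ‖f x‖ₑ) hm.enorm (hf.comp _)]
    _ = _ := lintegral_mul_const _ hb.enorm

lemma integrable_gshift (hb : Measurable b) (hbi : Integrable b gauss) (hm : Measurable f)
    (hi : Integrable f) (ρ : ℝ) : Integrable (gshift b ρ f) := by
  have hmeas : Measurable (gshift b ρ f) :=
    (measurable_gshift (α := Unit) hb (ρ := fun _ => ρ) measurable_const
      (F := fun _ => f) (hm.comp measurable_snd)).comp (measurable_const (a := ()) |>.prodMk measurable_id)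
  refine ⟨hmeas.aestronglyMeasurable, ?_⟩
  exact (lintegral_gshift_le (D := .plane) hb hm trivial ρ).trans_lt
    (ENNReal.mul_lt_top hbi.2 hi.2)

/-- The adjoint of a weighted average of translates. -/
lemma integral_gshift_mul (hb : Measurable b) (hbi : Integrable b gauss) (hm : Measurable f)
    (hC : ∀ x, |f x| ≤ C) {ψ : Plane → ℝ} (hψ : Measurable ψ) (hψi : Integrable ψ) (ρ : ℝ) :
    ∫ x, gshift b (-ρ) f x * ψ x = ∫ y, f y * gshift b ρ ψ y := by
  have i1 : Integrable (Function.uncurry fun x z => b z * f (x + -ρ • z) * ψ x)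
      (volume.prod gauss) := by
    have h := (hψi.mul_prod hbi).bdd_mul (c := C) (f := fun p : Plane × Plane => f (p.1 + -ρ • p.2))
      (Measurable.aestronglyMeasurable (by fun_prop)) (ae_of_all _ fun p => hC _)
    refine h.congr (ae_of_all _ fun p => ?_)
    simp only [Function.uncurry]
    ring
  have i2 : Integrable (Function.uncurry fun y z => f y * (b z * ψ (y + ρ • z)))
      (volume.prod gauss) := by
    have hmm : Measurable (Function.uncurry fun y z => f y * (b z * ψ (y + ρ • z))) := by
      unfold Function.uncurry; fun_prop
    refine ⟨hmm.aestronglyMeasurable, ?_⟩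
    rw [HasFiniteIntegral, lintegral_prod_symm _ hmm.enorm.aemeasurable]
    calc ∫⁻ z, ∫⁻ y, ‖f y * (b z * ψ (y + ρ • z))‖ₑ ∂volume ∂gauss
        ≤ ∫⁻ z, (ENNReal.ofReal C * ∫⁻ y, ‖ψ y‖ₑ) * ‖b z‖ₑ ∂gauss := by
          refine lintegral_mono fun z => ?_
          calc ∫⁻ y, ‖f y * (b z * ψ (y + ρ • z))‖ₑ
              ≤ ∫⁻ y, (ENNReal.ofReal C * ‖b z‖ₑ) * ‖ψ (y + ρ • z)‖ₑ := by
                refine lintegral_mono fun y => ?_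
                rw [enorm_mul, enorm_mul, ← mul_assoc, Real.enorm_eq_ofReal_abs (f y)]
                gcongr
                exact hC y
            _ = (ENNReal.ofReal C * ‖b z‖ₑ) * ∫⁻ y, ‖ψ y‖ₑ := by
                rw [lintegral_const_mul _ (by fun_prop),
                  lintegral_add_right_eq_self (fun y => ‖ψ y‖ₑ)]
            _ = _ := by ring
      _ < ⊤ := by
          rw [lintegral_const_mul _ hb.enorm]
          exact ENNReal.mul_lt_top (ENNReal.mul_lt_top (by simp) hψi.2) hbi.2
  calc ∫ x, gshift b (-ρ) f x * ψ x = ∫ x, ∫ z, b z * f (x + -ρ • z) * ψ x ∂gauss := by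
        simp only [gshift, integral_mul_const]
    _ = ∫ z, ∫ x, b z * f (x + -ρ • z) * ψ x ∂volume ∂gauss := integral_integral_swap i1
    _ = ∫ z, ∫ y, f y * (b z * ψ (y + ρ • z)) ∂volume ∂gauss := by
        refine integral_congr_ae (ae_of_all _ fun z => ?_)
        simp only
        rw [← integral_add_right_eq_self (fun x => b z * f (x + -ρ • z) * ψ x) (ρ • z)]
        refine integral_congr_ae (ae_of_all _ fun y => ?_)
        simp only [neg_smul, add_neg_cancel_right]
        ring
    _ = ∫ y, ∫ z, f y * (b z * ψ (y + ρ • z)) ∂gauss := (integral_integral_swap i2).symm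
    _ = _ := by simp only [gshift, integral_const_mul]

end Shift

lemma pd_comm {f : Plane → ℝ} (hf : ContDiff ℝ ∞ f) (i j : Fin 2) :
    pd i (pd j f) = pd j (pd i f) := by
  funext x
  have h1 : DifferentiableAt ℝ (fderiv ℝ f) x :=
    (hf.fderiv_right (m := ∞) (by simp)).differentiable (by simp) x
  have h2 := ((contDiff_infty.1 hf 2).contDiffAt (x := x)).isSymmSndFDerivAt (by simp)
  have e : ∀ i j, pd i (pd j f) x = fderiv ℝ (fderiv ℝ f) x (bv i) (bv j) := by
    intro i j
    have : pd j f = fun x => fderiv ℝ f x (bv j) := rfl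
    rw [this, pd, fderiv_clm_apply h1 (by fun_prop)]
    simp
  rw [e, e]
  exact h2 _ _

/-- The Laplacian, as a sum of partial derivatives. -/
def lap (ψ : Plane → ℝ) (x : Plane) : ℝ := ∑ i, pd i (pd i ψ) x

lemma IsTest.sum {ι : Type*} {s : Finset ι} {f : ι → Plane → ℝ} (hf : ∀ i, IsTest (f i)) :
    IsTest (fun x => ∑ i ∈ s, f i x) := by
  classical
  induction s using Finset.induction_on with
  | empty => exact ⟨by simpa using contDiff_const, by simp only [Finset.sum_empty]; exact HasCompactSupport.zero⟩
  | insert a s ha ih =>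
    simp only [Finset.sum_insert ha]
    exact ⟨(hf a).1.add ih.1, (hf a).2.add ih.2⟩

lemma IsTest.lap {ψ : Plane → ℝ} (hψ : IsTest ψ) : IsTest (lap ψ) :=
  IsTest.sum fun i => (hψ.pd i).pd i

lemma pd_lap {ψ : Plane → ℝ} (hψ : IsTest ψ) (i : Fin 2) : pd i (lap ψ) = lap (pd i ψ) := by
  funext x
  have h : ∀ j x, DifferentiableAt ℝ (pd j (pd j ψ)) x := fun j =>
    ((hψ.pd j).pd j).1.differentiable (by simp)
  have e : pd i (lap ψ) x = ∑ j, pd i (pd j (pd j ψ)) x := by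
    have : pd i (lap ψ) x = fderiv ℝ (fun x => ∑ j, pd j (pd j ψ) x) x (bv i) := rfl
    rw [this, fderiv_fun_sum fun j _ => h j x]
    simp [pd]
  rw [e]
  refine Finset.sum_congr rfl fun j _ => ?_
  rw [pd_comm (hψ.pd j).1 i j, pd_comm hψ.1 i j]

/-! ### The Duhamel operator -/

/-- Functions of time and space on the domain, vanishing for negative times, whose `L^∞` and `L¹`
norms grow at most exponentially. -/
structure Growth (D : Domain) (lam A : ℝ) (f : ℝ → Plane → ℝ) : Prop where
  measurable : Measurable (Function.uncurry f)
  isFun : ∀ t, D.IsFun (f t)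
  zero : ∀ t < 0, ∀ x, f t x = 0
  bound : ∀ t x, |f t x| ≤ A * Real.exp (lam * t)
  mass : ∀ t, ∫⁻ x, ‖f t x‖ₑ ∂D.measure ≤ ENNReal.ofReal (A * Real.exp (lam * t))

lemma Growth.measurable_apply {D : Domain} {lam A : ℝ} {f : ℝ → Plane → ℝ} (h : Growth D lam A f)
    (t : ℝ) : Measurable (f t) := h.measurable.comp measurable_prodMk_left

lemma Growth.nonneg {D : Domain} {lam A : ℝ} {f : ℝ → Plane → ℝ} (h : Growth D lam A f) : 0 ≤ A :=
  by simpa using (abs_nonneg _).trans (h.bound 0 0)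

/-- The first absolute moment of the Gaussian measure. -/
def gaussMoment : ℝ := ∑ i : Fin 2, ∫ z, |z i| ∂gauss

/-- The gradient of the heat semigroup at time `ρ ^ 2` applied to `v f`, times `- 2 ρ`. -/
def transport (v : Plane → Plane) (ρ : ℝ) (f : Plane → ℝ) (x : Plane) : ℝ :=
  ∑ i, gshift (fun z => z i) (-ρ) (fun y => v y i * f y) x

/-- The Duhamel integral for the transport term. -/
def duhamel (v : Plane → Plane) (f : ℝ → Plane → ℝ) (t : ℝ) (x : Plane) : ℝ :=
  ∫ ρ in Ioi (0:ℝ), transport v ρ (f (t - ρ ^ 2)) x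

variable {D : Domain} {K L lam A : ℝ} {v : Plane → Plane} {f : ℝ → Plane → ℝ}

lemma measurable_apply_plane (i : Fin 2) : Measurable fun z : Plane => z i := by fun_prop

lemma abs_transport_le (hv : IsField K L v) {g : Plane → ℝ} {C : ℝ} (hC : ∀ x, |g x| ≤ C)
    (ρ : ℝ) (x : Plane) : |transport v ρ g x| ≤ gaussMoment * L * C := by
  refine (Finset.abs_sum_le_sum_abs _ _).trans ?_
  rw [gaussMoment, mul_assoc, Finset.sum_mul]
  refine Finset.sum_le_sum fun i _ => ?_
  refine abs_gshift_le (integrable_apply_gauss i) (fun y => ?_) _ _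
  rw [abs_mul]
  exact mul_le_mul (hv.abs_apply_le i y) (hC y) (abs_nonneg _)
    ((abs_nonneg _).trans (hv.abs_apply_le i y))

lemma lintegral_transport_le (hv : IsField K L v) (hvf : D.IsFun v) {g : Plane → ℝ}
    (hg : Measurable g) (hgf : D.IsFun g) (ρ : ℝ) :
    ∫⁻ x, ‖transport v ρ g x‖ₑ ∂D.measure
      ≤ ENNReal.ofReal (gaussMoment * L) * ∫⁻ x, ‖g x‖ₑ ∂D.measure := by
  have hL0 : 0 ≤ L := (norm_nonneg _).trans (hv.bdd 0)
  have hm : ∀ i, Measurable fun y => v y i * g y := fun i => (hv.measurable_apply i).mul hg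
  have hmg : ∀ i, Measurable (gshift (fun z => z i) (-ρ) (fun y => v y i * g y)) := fun i =>
    (measurable_gshift (α := Unit) (measurable_apply_plane i) (ρ := fun _ => -ρ) measurable_const
      (F := fun _ y => v y i * g y) ((hm i).comp measurable_snd)).comp
      (measurable_const (a := ()) |>.prodMk measurable_id)
  calc ∫⁻ x, ‖transport v ρ g x‖ₑ ∂D.measure
      ≤ ∫⁻ x, ∑ i, ‖gshift (fun z => z i) (-ρ) (fun y => v y i * g y) x‖ₑ ∂D.measure :=
        lintegral_mono fun x => enorm_sum_le _ _
    _ = ∑ i, ∫⁻ x, ‖gshift (fun z => z i) (-ρ) (fun y => v y i * g y) x‖ₑ ∂D.measure :=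
        lintegral_finsetSum _ fun i _ => (hmg i).enorm
    _ ≤ ∑ i : Fin 2, ENNReal.ofReal ((∫ z, |z i| ∂gauss) * L) * ∫⁻ x, ‖g x‖ₑ ∂D.measure := by
        refine Finset.sum_le_sum fun i _ => ?_
        refine (lintegral_gshift_le (measurable_apply_plane i) (hm i)
          ((hvf.comp fun x => x i).comp₂ hgf (· * ·)) _).trans ?_
        rw [ENNReal.ofReal_mul (integral_nonneg fun z => abs_nonneg _), mul_assoc]
        have e : ∫⁻ z : Plane, ‖z i‖ₑ ∂gauss = ENNReal.ofReal (∫ z, |z i| ∂gauss) := by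
          rw [integral_abs_eq_toReal (integrable_apply_gauss i).1,
            ENNReal.ofReal_toReal (integrable_apply_gauss i).2.ne]
        rw [e, ← lintegral_const_mul _ hg.enorm]
        gcongr with x
        rw [enorm_mul, Real.enorm_eq_ofReal_abs (v x i)]
        gcongr
        exact hv.abs_apply_le i x
    _ = _ := by
        rw [← Finset.sum_mul, ← ENNReal.ofReal_sum_of_nonneg, gaussMoment, Finset.sum_mul]
        exact fun i _ => mul_nonneg (integral_nonneg fun z => abs_nonneg _) hL0

lemma Domain.IsFun.transport (hvf : D.IsFun v) {g : Plane → ℝ} (hg : D.IsFun g) (ρ : ℝ) :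
    D.IsFun (transport v ρ g) := by
  have h := fun i => ((hvf.comp fun x => x i).comp₂ hg (· * ·)).gshift (fun z => z i) (-ρ)
  cases D
  · trivial
  · intro x
    exact Finset.sum_congr rfl fun i _ => h i x

lemma measurable_transport {α : Type*} [MeasurableSpace α] (hv : IsField K L v) {ρ : α → ℝ}
    (hρ : Measurable ρ) {F : α → Plane → ℝ} (hF : Measurable (Function.uncurry F)) :
    Measurable (Function.uncurry fun a x => transport v (ρ a) (F a) x) := by
  unfold transport
  exact Finset.measurable_fun_sum _ fun i _ => measurable_gshift (measurable_apply_plane i)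
    (ρ := fun a => -ρ a) hρ.neg (F := fun a y => v y i * F a y)
    (((hv.measurable_apply i).comp measurable_snd).mul hF)

lemma measurable_transport_time (hv : IsField K L v) (hf : Measurable (Function.uncurry f)) :
    Measurable fun q : (ℝ × Plane) × ℝ => transport v q.2 (f (q.1.1 - q.2 ^ 2)) q.1.2 := by
  have h := measurable_transport (α := ℝ × ℝ) hv (ρ := fun a => a.2) measurable_snd
    (F := fun a => f (a.1 - a.2 ^ 2)) (hf.comp
      (f := fun p : (ℝ × ℝ) × Plane => (p.1.1 - p.1.2 ^ 2, p.2)) (by fun_prop))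
  exact h.comp (f := fun q : (ℝ × Plane) × ℝ => ((q.1.1, q.2), q.1.2)) (by fun_prop)

lemma integral_exp_neg_sq {lam : ℝ} (hlam : 0 < lam) (t : ℝ) :
    IntegrableOn (fun ρ => Real.exp (lam * (t - ρ ^ 2))) (Ioi 0) ∧
    ∫ ρ in Ioi (0:ℝ), Real.exp (lam * (t - ρ ^ 2))
      = Real.exp (lam * t) * (√(Real.pi / lam) / 2) := by
  have e : ∀ ρ : ℝ, Real.exp (lam * (t - ρ ^ 2))
      = Real.exp (lam * t) * Real.exp (-lam * ρ ^ 2) := fun ρ => by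
    rw [← Real.exp_add]; congr 1; ring
  simp only [e]
  exact ⟨((integrable_exp_neg_mul_sq hlam).integrableOn).const_mul _, by
    rw [integral_const_mul, integral_gaussian_Ioi]⟩

/-- The Duhamel integral is a contraction for exponentially weighted norms. -/
lemma Growth.duhamel (h : Growth D lam A f) (hv : IsField K L v) (hvf : D.IsFun v)
    (hlam : 0 < lam) :
    Growth D lam (gaussMoment * L * (√(Real.pi / lam) / 2) * A) (duhamel v f) := by
  have hL0 : 0 ≤ L := (norm_nonneg _).trans (hv.bdd 0)
  have hA := h.nonneg
  have hm0 : 0 ≤ gaussMoment :=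
    Finset.sum_nonneg fun i _ => integral_nonneg fun z => abs_nonneg _
  have hmt := measurable_transport_time hv h.measurable
  have hexp := integral_exp_neg_sq hlam
  have hint : ∀ t, ∫ ρ in Ioi (0:ℝ), gaussMoment * L * (A * Real.exp (lam * (t - ρ ^ 2)))
      = gaussMoment * L * (√(Real.pi / lam) / 2) * A * Real.exp (lam * t) := fun t => by
    rw [integral_const_mul, integral_const_mul, (hexp t).2]; ring
  refine ⟨?_, fun t => ?_, fun t ht x => ?_, fun t x => ?_, fun t => ?_⟩
  · exact (hmt.stronglyMeasurable.integral_prod_right' (ν := volume.restrict (Ioi 0))).measurable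
  · have h1 := fun ρ : ℝ => hvf.transport (h.isFun (t - ρ ^ 2)) ρ
    cases D
    · trivial
    · intro x
      exact integral_congr_ae (ae_of_all _ fun ρ => h1 ρ x)
  · refine integral_eq_zero_of_ae (ae_of_all _ fun ρ => ?_)
    have : f (t - ρ ^ 2) = fun _ => 0 := funext (h.zero _ (by nlinarith [sq_nonneg ρ]))
    simp [FlowQuenching.transport, gshift, this]
  · rw [← hint t, ← Real.norm_eq_abs]
    refine norm_integral_le_of_norm_le (((hexp t).1.const_mul A).const_mul _)
      (ae_of_all _ fun ρ => ?_)
    exact abs_transport_le hv (h.bound _) ρ x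
  · calc ∫⁻ x, ‖FlowQuenching.duhamel v f t x‖ₑ ∂D.measure
        ≤ ∫⁻ x, (∫⁻ ρ in Ioi (0:ℝ), ‖transport v ρ (f (t - ρ ^ 2)) x‖ₑ) ∂D.measure :=
          lintegral_mono fun x => enorm_integral_le_lintegral_enorm _
      _ = ∫⁻ ρ in Ioi (0:ℝ), ∫⁻ x, ‖transport v ρ (f (t - ρ ^ 2)) x‖ₑ ∂D.measure := by
          refine lintegral_lintegral_swap ?_
          exact (hmt.comp (f := fun p : Plane × ℝ => ((t, p.1), p.2))
            (by fun_prop)).enorm.aemeasurable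
      _ ≤ ∫⁻ ρ in Ioi (0:ℝ), ENNReal.ofReal (gaussMoment * L *
            (A * Real.exp (lam * (t - ρ ^ 2)))) := by
          refine lintegral_mono fun ρ => ?_
          refine (lintegral_transport_le hv hvf (h.measurable_apply _) (h.isFun _) ρ).trans ?_
          rw [ENNReal.ofReal_mul (p := gaussMoment * L) (by positivity)]
          gcongr
          exact h.mass _
      _ = _ := by
          rw [← hint t, ofReal_integral_eq_lintegral_ofReal
            (((hexp t).1.const_mul A).const_mul _) (ae_of_all _ fun ρ => by positivity)]

/-- The transport term of the heat flow tested with a function. -/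
def pairing (v : Plane → Plane) (f : ℝ → Plane → ℝ) (ψ : Plane → ℝ) (s r : ℝ) : ℝ :=
  ∫ y, f s y * ∑ i, v y i * heat (√r) (pd i ψ) y

lemma IsTest.integrable_heat {ψ : Plane → ℝ} (hψ : IsTest ψ) (ρ : ℝ) : Integrable (heat ρ ψ) := by
  rw [heat_eq_gshift]
  exact integrable_gshift measurable_const (integrable_const 1) hψ.continuous.measurable
    hψ.integrable ρ

lemma IsTest.integral_abs_heat_le {ψ : Plane → ℝ} (hψ : IsTest ψ) (ρ : ℝ) :
    ∫ x, |heat ρ ψ x| ≤ ∫ x, |ψ x| := by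
  rw [integral_abs_eq_toReal (hψ.integrable_heat ρ).1, integral_abs_eq_toReal hψ.integrable.1]
  refine ENNReal.toReal_mono hψ.lintegral_ne_top ?_
  rw [heat_eq_gshift]
  simpa using! lintegral_gshift_le (D := .plane) (b := fun _ => 1) measurable_const
    hψ.continuous.measurable trivial ρ

/-- By duality the weights z_i move to the test function, where they become its gradient. The factor
2ρ that appears is the Jacobian of r = ρ². -/
lemma integral_transport_mul (hv : IsField K L v) {g : Plane → ℝ} (hg : Measurable g) {C : ℝ}
    (hC : ∀ x, |g x| ≤ C) {ψ : Plane → ℝ} (hψ : IsTest ψ) (ρ : ℝ) :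
    ∫ x, transport v ρ g x * ψ x
      = 2 * ρ * ∫ y, g y * ∑ i, v y i * heat ρ (pd i ψ) y := by
  have hL0 : 0 ≤ L := (norm_nonneg _).trans (hv.bdd 0)
  have hC0 : 0 ≤ C := (abs_nonneg _).trans (hC 0)
  have hm : ∀ i, Measurable fun y => v y i * g y := fun i => (hv.measurable_apply i).mul hg
  have hmC : ∀ i y, |v y i * g y| ≤ L * C := fun i y => by
    rw [abs_mul]
    exact mul_le_mul (hv.abs_apply_le i y) (hC y) (abs_nonneg _) hL0
  have hmg : ∀ i, Measurable (gshift (fun z => z i) (-ρ) (fun y => v y i * g y)) := fun i =>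
    (measurable_gshift (α := Unit) (measurable_apply_plane i) (ρ := fun _ => -ρ) measurable_const
      (F := fun _ y => v y i * g y) ((hm i).comp measurable_snd)).comp
      (measurable_const (a := ()) |>.prodMk measurable_id)
  have i1 : ∀ i, Integrable fun x => gshift (fun z => z i) (-ρ) (fun y => v y i * g y) x * ψ x :=
    fun i => hψ.integrable_mul (hmg i) (abs_gshift_le (integrable_apply_gauss i) (hmC i) _)
  have i2 : ∀ i, Integrable fun y => g y * (v y i * heat ρ (pd i ψ) y) := fun i => by
    refine (((hψ.pd i).integrable_heat ρ).bdd_mul (c := L * C) (hm i).aestronglyMeasurable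
      (ae_of_all _ (hmC i))).congr (ae_of_all _ fun y => ?_)
    simp only; ring
  simp only [transport, Finset.sum_mul, Finset.mul_sum]
  rw [integral_finsetSum _ fun i _ => i1 i, integral_finsetSum _ fun i _ => i2 i, Finset.mul_sum]
  refine Finset.sum_congr rfl fun i _ => ?_
  rw [integral_gshift_mul (measurable_apply_plane i) (integrable_apply_gauss i) (hm i) (hmC i)
    hψ.continuous.measurable hψ.integrable, ← integral_const_mul]
  refine integral_congr_ae (ae_of_all _ fun y => ?_)
  simp only [gshift]
  rw [integral_apply_mul_comp_gauss hψ]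
  ring

/-- The substitution r = ρ² returns to ordinary time. In the variable ρ the singularity r^(-1/2) of
the gradient of the heat kernel never shows up, and the infinite range is harmless since `f`
vanishes at negative times. -/
lemma integral_duhamel_mul (h : Growth D lam A f) (hv : IsField K L v) (hlam : 0 < lam)
    {ψ : Plane → ℝ} (hψ : IsTest ψ) (t : ℝ) :
    ∫ x, duhamel v f t x * ψ x = ∫ r in Ioi (0:ℝ), pairing v f ψ (t - r) r := by
  have hmt := measurable_transport_time hv h.measurable
  have hexp := integral_exp_neg_sq hlam t
  have hI : Integrable (Function.uncurry fun x ρ => transport v ρ (f (t - ρ ^ 2)) x * ψ x)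
      (volume.prod (volume.restrict (Ioi (0:ℝ)))) := by
    refine Integrable.mono' (hψ.integrable.abs.mul_prod
      ((hexp.1.const_mul A).const_mul (gaussMoment * L))) ?_ (ae_of_all _ fun p => ?_)
    · exact ((hmt.comp (f := fun p : Plane × ℝ => ((t, p.1), p.2)) (by fun_prop)).mul
        (hψ.continuous.measurable.comp measurable_fst)).aestronglyMeasurable
    · simp only [Function.uncurry]
      rw [norm_mul, mul_comm]
      exact mul_le_mul le_rfl (abs_transport_le hv (h.bound _) _ _) (norm_nonneg _) (abs_nonneg _)
  calc ∫ x, duhamel v f t x * ψ x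
      = ∫ x, ∫ ρ in Ioi (0:ℝ), transport v ρ (f (t - ρ ^ 2)) x * ψ x := by
        simp only [duhamel, integral_mul_const]
    _ = ∫ ρ in Ioi (0:ℝ), ∫ x, transport v ρ (f (t - ρ ^ 2)) x * ψ x :=
        integral_integral_swap hI
    _ = ∫ ρ in Ioi (0:ℝ), (2 * ρ ^ ((2:ℝ) - 1)) • (fun r => pairing v f ψ (t - r) r)
          (ρ ^ (2:ℝ)) := by
        refine setIntegral_congr_fun measurableSet_Ioi fun ρ hρ => ?_
        simp only
        rw [integral_transport_mul hv (h.measurable_apply _) (h.bound _) hψ]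
        have e2 : ρ ^ ((2:ℝ) - 1) = ρ := by norm_num
        rw [e2, Real.rpow_two, smul_eq_mul, pairing, Real.sqrt_sq (le_of_lt hρ)]
    _ = _ := integral_comp_rpow_Ioi_of_pos (g := fun r => pairing v f ψ (t - r) r) two_pos

lemma measurable_pairing (hf : Measurable (Function.uncurry f)) (hv : IsField K L v)
    {ψ : Plane → ℝ} (hψ : IsTest ψ) : Measurable (Function.uncurry (pairing v f ψ)) := by
  have hm : Measurable fun q : (ℝ × ℝ) × Plane =>
      f q.1.1 q.2 * ∑ i, v q.2 i * heat (√q.1.2) (pd i ψ) q.2 := by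
    refine (hf.comp (f := fun q : (ℝ × ℝ) × Plane => (q.1.1, q.2)) (by fun_prop)).mul
      (Finset.measurable_fun_sum _ fun i _ => ((hv.measurable_apply i).comp measurable_snd).mul ?_)
    exact (measurable_heat (hψ.pd i).continuous.measurable).comp
      (f := fun q : (ℝ × ℝ) × Plane => (√q.1.2, q.2)) (by fun_prop)
  exact (hm.stronglyMeasurable.integral_prod_right' (ν := volume)).measurable

lemma abs_pairing_le (hv : IsField K L v) {ψ : Plane → ℝ} (hψ : IsTest ψ) {s C : ℝ}
    (hC : ∀ x, |f s x| ≤ C) (r : ℝ) :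
    |pairing v f ψ s r| ≤ C * L * ∑ i, ∫ x, |pd i ψ x| := by
  have hL0 : 0 ≤ L := (norm_nonneg _).trans (hv.bdd 0)
  have hC0 : 0 ≤ C := (abs_nonneg _).trans (hC 0)
  have hi : ∀ i, Integrable fun y => |heat (√r) (pd i ψ) y| := fun i =>
    ((hψ.pd i).integrable_heat _).abs
  calc |pairing v f ψ s r| ≤ ∫ y, C * L * ∑ i, |heat (√r) (pd i ψ) y| := by
        rw [pairing, ← Real.norm_eq_abs]
        refine norm_integral_le_of_norm_le ((integrable_finsetSum _ fun i _ => hi i).const_mul _)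
          (ae_of_all _ fun y => ?_)
        rw [Real.norm_eq_abs, abs_mul, mul_assoc, Finset.mul_sum]
        refine mul_le_mul (hC y) ((Finset.abs_sum_le_sum_abs _ _).trans
          (Finset.sum_le_sum fun i _ => ?_)) (abs_nonneg _) hC0
        rw [abs_mul]
        gcongr
        exact hv.abs_apply_le i y
    _ ≤ _ := by
        rw [integral_const_mul, integral_finsetSum _ fun i _ => hi i]
        exact mul_le_mul_of_nonneg_left (Finset.sum_le_sum fun i _ =>
          (hψ.pd i).integral_abs_heat_le _) (by positivity)

lemma heat_integrable_prod {g : Plane → ℝ} (hg : IsTest g) (r : ℝ) :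
    Integrable (Function.uncurry fun y σ => heat (√σ) g y)
      (volume.prod (volume.restrict (Ioc 0 r))) := by
  have hm : Measurable (Function.uncurry fun y σ => heat (√σ) g y) :=
    (measurable_heat hg.continuous.measurable).comp (f := fun q : Plane × ℝ => (√q.2, q.1))
      (by fun_prop)
  refine ⟨hm.aestronglyMeasurable, ?_⟩
  rw [HasFiniteIntegral, lintegral_prod_symm _ hm.enorm.aemeasurable]
  calc _ ≤ ∫⁻ σ in Ioc 0 r, ∫⁻ y, ‖g y‖ₑ := by
        refine lintegral_mono fun σ => ?_
        simp only [Function.uncurry]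
        rw [heat_eq_gshift]
        simpa using! lintegral_gshift_le (D := .plane) (b := fun _ => 1) measurable_const
          hg.continuous.measurable trivial (√σ)
    _ < ⊤ := by
        rw [lintegral_const]
        exact ENNReal.mul_lt_top hg.lintegral_ne_top.lt_top (by simp)

/-- The heat equation for ∂_i ψ in the elapsed time r, paired with f(s) v. Since ∂_i commutes with
the Laplacian, the derivative is again a pairing. -/
lemma pairing_eq (hv : IsField K L v) {ψ : Plane → ℝ} (hψ : IsTest ψ) {s C : ℝ}
    (hm : Measurable (f s)) (hC : ∀ x, |f s x| ≤ C) {r : ℝ} (hr : 0 ≤ r) :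
    pairing v f ψ s r = pairing v f ψ s 0 + ∫ σ in (0:ℝ)..r, pairing v f (lap ψ) s σ := by
  have hL0 : 0 ≤ L := (norm_nonneg _).trans (hv.bdd 0)
  have hmv : ∀ i, Measurable fun y => f s y * v y i := fun i => hm.mul (hv.measurable_apply i)
  have hmC : ∀ i y, |f s y * v y i| ≤ C * L := fun i y => by
    rw [abs_mul]
    exact mul_le_mul (hC y) (hv.abs_apply_le i y) (abs_nonneg _) ((abs_nonneg _).trans (hC y))
  have i0 : ∀ i, Integrable fun y => f s y * v y i * pd i ψ y := fun i =>
    (hψ.pd i).integrable_mul (hmv i) (hmC i)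
  have i1 : ∀ i, Integrable (Function.uncurry fun y σ =>
      f s y * v y i * heat (√σ) (pd i (lap ψ)) y) (volume.prod (volume.restrict (Ioc 0 r))) :=
    fun i => (heat_integrable_prod (hψ.lap.pd i) r).bdd_mul (c := C * L)
      ((hmv i).comp measurable_fst).aestronglyMeasurable (ae_of_all _ fun p => hmC i p.1)
  have i2 : ∀ i, Integrable fun y => ∫ σ in Ioc 0 r,
      f s y * v y i * heat (√σ) (pd i (lap ψ)) y := fun i => (i1 i).integral_prod_left
  have i3 : ∀ i, Integrable (fun σ => ∫ y, f s y * v y i * heat (√σ) (pd i (lap ψ)) y)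
      (volume.restrict (Ioc 0 r)) := fun i => (i1 i).integral_prod_right
  have i4 : ∀ i σ, Integrable fun y => f s y * v y i * heat (√σ) (pd i (lap ψ)) y := fun i σ =>
    ((hψ.lap.pd i).integrable_heat _).bdd_mul (c := C * L) (hmv i).aestronglyMeasurable
      (ae_of_all _ (hmC i))
  have e : ∀ y, f s y * ∑ i, v y i * heat (√r) (pd i ψ) y
      = ∑ i, (f s y * v y i * pd i ψ y + ∫ σ in Ioc 0 r,
        f s y * v y i * heat (√σ) (pd i (lap ψ)) y) := by
    intro y
    rw [Finset.mul_sum]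
    refine Finset.sum_congr rfl fun i _ => ?_
    rw [heat_sqrt_eq (hψ.pd i) y hr, intervalIntegral.integral_of_le hr, integral_const_mul,
      pd_lap hψ]
    unfold lap
    ring
  have e0 : pairing v f ψ s 0 = ∑ i, ∫ y, f s y * v y i * pd i ψ y := by
    rw [← integral_finsetSum _ fun i _ => i0 i, pairing]
    refine integral_congr_ae (ae_of_all _ fun y => ?_)
    simp only [Real.sqrt_zero, heat_zero, Finset.mul_sum, mul_assoc]
  have e1 : ∀ σ, pairing v f (lap ψ) s σ
      = ∑ i, ∫ y, f s y * v y i * heat (√σ) (pd i (lap ψ)) y := fun σ => by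
    rw [← integral_finsetSum _ fun i _ => i4 i σ, pairing]
    refine integral_congr_ae (ae_of_all _ fun y => ?_)
    simp only [Finset.mul_sum, mul_assoc]
  rw [e0, pairing, intervalIntegral.integral_of_le hr]
  simp only [e, e1]
  rw [integral_finsetSum _ fun i _ => (i0 i).fun_add (i2 i), integral_finsetSum _ fun i _ => i3 i,
    ← Finset.sum_add_distrib]
  refine Finset.sum_congr rfl fun i _ => ?_
  rw [integral_add (i0 i) (i2 i), integral_integral_swap (i1 i)]

/-- The weak form of the Duhamel integral. -/
lemma integral_duhamel_eq (h : Growth D lam A f) (hv : IsField K L v) (hlam : 0 < lam)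
    {ψ : Plane → ℝ} (hψ : IsTest ψ) {t : ℝ} (ht : 0 ≤ t) :
    ∫ x, duhamel v f t x * ψ x = ∫ s in (0:ℝ)..t,
      ((∫ y, f s y * ∑ i, v y i * pd i ψ y) + ∫ y, duhamel v f s y * lap ψ y) := by
  rw [integral_duhamel_mul h hv hlam hψ]
  have hA := h.nonneg
  have hL0 : 0 ≤ L := (norm_nonneg _).trans (hv.bdd 0)
  have hb : ∀ s ≤ t, ∀ x, |f s x| ≤ A * Real.exp (lam * t) := fun s hs x =>
    (h.bound s x).trans (by gcongr)
  have hz : ∀ ψ : Plane → ℝ, ∀ s < 0, ∀ r, pairing v f ψ s r = 0 := fun ψ s hs r => by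
    simp [pairing, h.zero s hs]
  set C := A * Real.exp (lam * t) * L
  have hC : 0 ≤ C := by positivity
  have hp : ∀ ψ : Plane → ℝ, 0 ≤ ∑ i, ∫ x, |pd i ψ x| := fun ψ =>
    Finset.sum_nonneg fun i _ => integral_nonneg fun x => abs_nonneg _
  -- The tested Duhamel integral is a causal convolution, so its time evolution is known without
  -- differentiating it: the diagonal term r = 0 gives the transport term, the rest the Laplacian.
  have key := integral_causal (h := pairing v f ψ) (k := pairing v f (lap ψ)) (t := t)
    (C := C * (∑ i, ∫ x, |pd i ψ x|) + C * (∑ i, ∫ x, |pd i (lap ψ) x|)) ht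
    (measurable_pairing h.measurable hv hψ.lap)
    (fun s hs r => (abs_pairing_le hv hψ.lap (hb s hs) r).trans
      (by linarith [mul_nonneg hC (hp ψ)])) (hz _) (hz _)
    ((measurable_pairing h.measurable hv hψ).comp (f := fun s : ℝ => (s, (0:ℝ))) (by fun_prop))
    (fun s hs => (abs_pairing_le hv hψ (hb s hs) 0).trans
      (by linarith [mul_nonneg hC (hp (lap ψ))]))
    (fun s r hr => pairing_eq hv hψ (h.measurable_apply s) (h.bound s) hr)
  rw [key]
  refine intervalIntegral.integral_congr fun s _ => ?_
  simp only
  rw [integral_duhamel_mul h hv hlam hψ.lap]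
  simp only [pairing, Real.sqrt_zero, heat_zero]

/-! ### Existence for the passive scalar equation -/

section

variable {D : Domain} {K L lam A : ℝ} {v : Plane → Plane} {f : ℝ → Plane → ℝ} {φ₀ : Plane → ℝ}

lemma Growth.mono {A' : ℝ} (h : Growth D lam A f) (hA : A ≤ A') : Growth D lam A' f where
  measurable := h.measurable
  isFun := h.isFun
  zero := h.zero
  bound t x := (h.bound t x).trans (by gcongr)
  mass t := (h.mass t).trans (ENNReal.ofReal_le_ofReal (by gcongr))

/-- The solution of the heat equation, extended by zero to negative times. -/
def freeFlow (φ₀ : Plane → ℝ) (t : ℝ) (x : Plane) : ℝ := if t < 0 then 0 else heat (-√t) φ₀ x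

lemma growth_freeFlow (hm : Measurable φ₀) (hf : D.IsFun φ₀) (h1 : ∀ x, |φ₀ x| ≤ 1)
    (hA : 1 ≤ A) (hM : ∫⁻ x, ‖φ₀ x‖ₑ ∂D.measure ≤ ENNReal.ofReal A) (hlam : 0 < lam) :
    Growth D lam A (freeFlow φ₀) := by
  have hexp : ∀ t, ¬ t < 0 → A ≤ A * Real.exp (lam * t) := fun t ht =>
    le_mul_of_one_le_right (by linarith) (Real.one_le_exp (by
      have := not_lt.1 ht
      positivity))
  refine ⟨?_, fun t => ?_, fun t ht x => if_pos ht, fun t x => ?_, fun t => ?_⟩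
  · exact Measurable.ite (measurableSet_lt measurable_fst measurable_const) measurable_const
      ((measurable_heat hm).comp (f := fun p : ℝ × Plane => (-√p.1, p.2)) (by fun_prop))
  · by_cases ht : t < 0
    · have : freeFlow φ₀ t = fun _ => 0 := funext fun x => if_pos ht
      rw [this]
      cases D
      · trivial
      · exact fun _ => rfl
    · have : freeFlow φ₀ t = heat (-√t) φ₀ := funext fun x => if_neg ht
      rw [this, heat_eq_gshift]
      exact hf.gshift _ _
  · by_cases ht : t < 0
    · rw [freeFlow, if_pos ht, abs_zero]
      have : 0 ≤ A := by linarith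
      positivity
    · rw [freeFlow, if_neg ht]
      exact (abs_heat_le h1 _ _).trans (hA.trans (hexp t ht))
  · by_cases ht : t < 0
    · simp [freeFlow, ht]
    · simp only [freeFlow, if_neg ht]
      rw [heat_eq_gshift]
      refine (lintegral_gshift_le measurable_const hm hf _).trans ?_
      simp only [enorm_one, lintegral_const, measure_univ, mul_one, one_mul]
      exact hM.trans (ENNReal.ofReal_le_ofReal (hexp t ht))

/-- The heat flow is moved to the test function, which is smooth. The sign in -√t is that of the
adjoint in `integral_gshift_mul`, so the symmetry of the Gaussian need not be invoked. -/
lemma integral_freeFlow_mul (hm : Measurable φ₀) (h1 : ∀ x, |φ₀ x| ≤ 1) {ψ : Plane → ℝ}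
    (hψ : IsTest ψ) {t : ℝ} (ht : 0 ≤ t) :
    ∫ x, freeFlow φ₀ t x * ψ x
      = (∫ x, φ₀ x * ψ x) + ∫ s in (0:ℝ)..t, ∫ x, freeFlow φ₀ s x * lap ψ x := by
  have hdual : ∀ {g : Plane → ℝ}, IsTest g → ∀ s, 0 ≤ s →
      ∫ x, freeFlow φ₀ s x * g x = ∫ x, φ₀ x * heat (√s) g x := fun {g} hg s hs => by
    simp only [freeFlow, if_neg (not_lt.2 hs)]
    rw [heat_eq_gshift, heat_eq_gshift]
    exact integral_gshift_mul measurable_const (integrable_const 1) hm h1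
      hg.continuous.measurable hg.integrable _
  have i1 : Integrable (Function.uncurry fun x σ => φ₀ x * heat (√σ) (lap ψ) x)
      (volume.prod (volume.restrict (Ioc 0 t))) :=
    (heat_integrable_prod hψ.lap t).bdd_mul (c := 1) (hm.comp measurable_fst).aestronglyMeasurable
      (ae_of_all _ fun p => h1 p.1)
  have i2 : Integrable fun x => ∫ σ in Ioc 0 t, φ₀ x * heat (√σ) (lap ψ) x := i1.integral_prod_left
  rw [hdual hψ t ht]
  have e : ∀ x, φ₀ x * heat (√t) ψ x
      = φ₀ x * ψ x + ∫ σ in Ioc 0 t, φ₀ x * heat (√σ) (lap ψ) x := fun x => by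
    rw [heat_sqrt_eq hψ x ht, intervalIntegral.integral_of_le ht, integral_const_mul, mul_add]
    rfl
  simp only [e]
  rw [integral_add (hψ.integrable_mul hm h1) i2, integral_integral_swap i1,
    intervalIntegral.integral_of_le ht]
  congr 1
  refine setIntegral_congr_fun measurableSet_Ioc fun s hs => ?_
  exact (hdual hψ.lap s hs.1.le).symm

lemma Growth.integrable_mul (h : Growth D lam A f) {g : Plane → ℝ} (hg : Integrable g) (t : ℝ) :
    Integrable fun x => f t x * g x :=
  hg.bdd_mul (h.measurable_apply t).aestronglyMeasurable (ae_of_all _ (h.bound t))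

lemma Growth.intervalIntegrable (h : Growth D lam A f) (hlam : 0 < lam) {g : Plane → ℝ}
    (hgm : Measurable g) (hg : Integrable g) (a b : ℝ) :
    IntervalIntegrable (fun s => ∫ x, f s x * g x) volume a b := by
  have hm : Measurable fun s => ∫ x, f s x * g x :=
    measurable_integral_of_uncurry (h.measurable.mul (hgm.comp measurable_snd))
  have hA := h.nonneg
  rw [intervalIntegrable_iff]
  refine Measure.integrableOn_of_bounded (M := A * Real.exp (lam * max a b) * ∫ x, |g x|)
    (by simp) hm.aestronglyMeasurable ?_
  rw [ae_restrict_iff' measurableSet_uIoc]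
  refine ae_of_all _ fun s hs => ?_
  rw [← integral_const_mul]
  refine norm_integral_le_of_norm_le (hg.abs.const_mul _) (ae_of_all _ fun x => ?_)
  rw [norm_mul, Real.norm_eq_abs, Real.norm_eq_abs]
  gcongr
  refine (h.bound s x).trans ?_
  have := (uIoc_subset_uIcc hs).2
  gcongr

/-- The terms of the Duhamel series. -/
def duhamelTerm (v : Plane → Plane) (φ₀ : Plane → ℝ) : ℕ → ℝ → Plane → ℝ
  | 0 => freeFlow φ₀
  | n + 1 => duhamel v (duhamelTerm v φ₀ n)

/-- For a large weight `lam` the Duhamel operator halves the weighted norms, in L^∞ and in L¹ at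
once. -/
lemma growth_duhamelTerm (hv : IsField K L v) (hvf : D.IsFun v) (hm : Measurable φ₀)
    (hf : D.IsFun φ₀) (h1 : ∀ x, |φ₀ x| ≤ 1) (hA : 1 ≤ A)
    (hM : ∫⁻ x, ‖φ₀ x‖ₑ ∂D.measure ≤ ENNReal.ofReal A) (hlam : 0 < lam)
    (hsmall : gaussMoment * L * (√(Real.pi / lam) / 2) ≤ 1 / 2) (n : ℕ) :
    Growth D lam (A * (1 / 2) ^ n) (duhamelTerm v φ₀ n) := by
  induction n with
  | zero =>
    rw [pow_zero, mul_one]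
    exact growth_freeFlow hm hf h1 hA hM hlam
  | succ n ih =>
    refine (ih.duhamel hv hvf hlam).mono ?_
    rw [pow_succ]
    have : 0 ≤ A * (1 / 2) ^ n := ih.nonneg
    nlinarith

/-! ### Convergence of the Duhamel series -/

section Series

variable {d : ℕ → ℝ → Plane → ℝ}

lemma sum_growth (hd : ∀ n, Growth D lam (A * (1 / 2) ^ n) (d n)) (hA : 0 ≤ A) (N : ℕ) (t : ℝ)
    (x : Plane) : |∑ n ∈ Finset.range N, d n t x| ≤ 2 * A * Real.exp (lam * t) := by
  calc |∑ n ∈ Finset.range N, d n t x|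
      ≤ ∑ n ∈ Finset.range N, A * Real.exp (lam * t) * (1 / 2) ^ n := by
        refine (Finset.abs_sum_le_sum_abs _ _).trans (Finset.sum_le_sum fun n _ => ?_)
        exact ((hd n).bound t x).trans (le_of_eq (by ring))
    _ ≤ A * Real.exp (lam * t) * 2 := by
        rw [← Finset.mul_sum]
        gcongr
        exact (summable_geometric_two.sum_le_tsum _ fun n _ => by positivity).trans_eq
          tsum_geometric_two
    _ = _ := by ring

lemma summable_growth (hd : ∀ n, Growth D lam (A * (1 / 2) ^ n) (d n)) (t : ℝ) (x : Plane) :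
    Summable fun n => d n t x := by
  refine Summable.of_norm_bounded (g := fun n => A * Real.exp (lam * t) * (1 / 2) ^ n)
    (summable_geometric_two.mul_left _) fun n => ?_
  exact ((hd n).bound t x).trans (le_of_eq (by ring))

lemma tendsto_growth (hd : ∀ n, Growth D lam (A * (1 / 2) ^ n) (d n)) (t : ℝ) (x : Plane) :
    Tendsto (fun N => ∑ n ∈ Finset.range N, d n t x) atTop (𝓝 (∑' n, d n t x)) :=
  (summable_growth hd t x).hasSum.tendsto_sum_nat

lemma growth_tsum (hd : ∀ n, Growth D lam (A * (1 / 2) ^ n) (d n)) (hA : 0 ≤ A) :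
    Growth D lam (2 * A) (fun t x => ∑' n, d n t x) := by
  refine ⟨?_, fun t => ?_, fun t ht x => ?_, fun t x => ?_, fun t => ?_⟩
  · refine measurable_of_tendsto_metrizable (f := fun N (p : ℝ × Plane) =>
      ∑ n ∈ Finset.range N, d n p.1 p.2) (fun N => ?_)
      (tendsto_pi_nhds.2 fun p => tendsto_growth hd p.1 p.2)
    exact Finset.measurable_fun_sum _ fun n _ => (hd n).measurable
  · have h := fun n => (hd n).isFun t
    cases D
    · trivial
    · exact fun x => tsum_congr fun n => h n x
  · simp [(hd _).zero t ht x]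
  · exact le_of_tendsto' (tendsto_growth hd t x).abs fun N => sum_growth hd hA N t x
  · have hm : ∀ n, Measurable fun x => ‖d n t x‖ₑ := fun n => ((hd n).measurable_apply t).enorm
    calc ∫⁻ x, ‖∑' n, d n t x‖ₑ ∂D.measure ≤ ∫⁻ x, ∑' n, ‖d n t x‖ₑ ∂D.measure :=
          lintegral_mono fun x => enorm_tsum_le_tsum_enorm
      _ = ∑' n, ∫⁻ x, ‖d n t x‖ₑ ∂D.measure := lintegral_tsum fun n => (hm n).aemeasurable
      _ ≤ ∑' n : ℕ, ENNReal.ofReal (A * Real.exp (lam * t) * (1 / 2) ^ n) :=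
          ENNReal.tsum_le_tsum fun n => ((hd n).mass t).trans (le_of_eq (by ring_nf))
      _ = ENNReal.ofReal (∑' n : ℕ, A * Real.exp (lam * t) * (1 / 2) ^ n) :=
          (ENNReal.ofReal_tsum_of_nonneg (fun n => by positivity)
            (summable_geometric_two.mul_left _)).symm
      _ = _ := by
          rw [tsum_mul_left, tsum_geometric_two]
          congr 1; ring

lemma tendsto_integral_growth (hd : ∀ n, Growth D lam (A * (1 / 2) ^ n) (d n)) (hA : 0 ≤ A)
    {g : Plane → ℝ} (hg : Integrable g) (t : ℝ) :
    Tendsto (fun N => ∫ x, (∑ n ∈ Finset.range N, d n t x) * g x) atTop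
      (𝓝 (∫ x, (∑' n, d n t x) * g x)) := by
  refine tendsto_integral_of_dominated_convergence (fun x => 2 * A * Real.exp (lam * t) * |g x|)
    (fun N => ?_) (hg.abs.const_mul _) (fun N => ae_of_all _ fun x => ?_)
    (ae_of_all _ fun x => (tendsto_growth hd t x).mul_const _)
  · exact (Finset.measurable_fun_sum _ fun n _ =>
      (hd n).measurable_apply t).aestronglyMeasurable.mul hg.1
  · rw [norm_mul, Real.norm_eq_abs, Real.norm_eq_abs]
    gcongr
    exact sum_growth hd hA N t x

lemma tendsto_intervalIntegral_growth (hd : ∀ n, Growth D lam (A * (1 / 2) ^ n) (d n)) (hA : 0 ≤ A)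
    (hlam : 0 < lam) {g : Plane → ℝ} (hgm : Measurable g) (hg : Integrable g) {t : ℝ} (ht : 0 ≤ t) :
    Tendsto (fun N => ∫ s in (0:ℝ)..t, ∫ x, (∑ n ∈ Finset.range N, d n s x) * g x) atTop
      (𝓝 (∫ s in (0:ℝ)..t, ∫ x, (∑' n, d n s x) * g x)) := by
  refine intervalIntegral.tendsto_integral_filter_of_dominated_convergence
    (fun _ => 2 * A * Real.exp (lam * t) * ∫ x, |g x|) (Eventually.of_forall fun N => ?_)
    (Eventually.of_forall fun N => ae_of_all _ fun s hs => ?_) intervalIntegrable_const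
    (ae_of_all _ fun s _ => tendsto_integral_growth hd hA hg s)
  · exact (measurable_integral_of_uncurry (F := fun s x => (∑ n ∈ Finset.range N, d n s x) * g x)
      ((Finset.measurable_fun_sum _ fun n _ => (hd n).measurable).mul
        (hgm.comp measurable_snd))).aestronglyMeasurable
  · rw [uIoc_of_le ht] at hs
    rw [← integral_const_mul]
    refine norm_integral_le_of_norm_le (hg.abs.const_mul _) (ae_of_all _ fun x => ?_)
    rw [norm_mul, Real.norm_eq_abs, Real.norm_eq_abs]
    gcongr
    refine (sum_growth hd hA N s x).trans ?_
    have := hs.2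
    gcongr

end Series

/-- Existence for the passive scalar equation, with exponential bounds. -/
lemma exists_growth_solution (hv : IsField K L v) (hvf : D.IsFun v) (hm : Measurable φ₀)
    (hf : D.IsFun φ₀) (h1 : ∀ x, |φ₀ x| ≤ 1) {M : ℝ}
    (hM : ∫⁻ x, ‖φ₀ x‖ₑ ∂D.measure ≤ ENNReal.ofReal M) :
    ∃ lam A φ, 0 < lam ∧ Growth D lam A φ ∧ ∀ t, 0 ≤ t → ∀ ψ, IsTest ψ →
      ∫ x, φ t x * ψ x = (∫ x, φ₀ x * ψ x) + ∫ s in (0:ℝ)..t, ∫ x,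
        φ s x * (∑ i, pd i (pd i ψ) x + ∑ i, v x i * pd i ψ x) := by
  have hL0 : 0 ≤ L := (norm_nonneg _).trans (hv.bdd 0)
  have hm0 : 0 ≤ gaussMoment :=
    Finset.sum_nonneg fun i _ => integral_nonneg fun z => abs_nonneg _
  set A := max 1 M
  have hA : 1 ≤ A := le_max_left _ _
  have hA0 : 0 ≤ A := by linarith
  have hMA := hM.trans (ENNReal.ofReal_le_ofReal (le_max_right 1 M))
  set b := gaussMoment * L + 1
  have hb : 0 < b := by positivity
  -- Then √(π / lam) = 1 / b, and the contraction factor is gaussMoment · L / (2b) ≤ 1/2. The `+ 1`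
  -- in `b` keeps it positive when the field vanishes.
  set lam := Real.pi * b ^ 2
  have hlam : 0 < lam := by positivity
  have hsmall : gaussMoment * L * (√(Real.pi / lam) / 2) ≤ 1 / 2 := by
    have : √(Real.pi / lam) = 1 / b := by
      rw [show Real.pi / lam = (1 / b) ^ 2 by simp only [lam]; field_simp, Real.sqrt_sq (by positivity)]
    rw [this]
    have h2 : gaussMoment * L / b ≤ 1 := by
      rw [div_le_one hb]; simp only [b]; linarith
    calc gaussMoment * L * (1 / b / 2) = (gaussMoment * L / b) / 2 := by ring
      _ ≤ 1 / 2 := by linarith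
  have hd := growth_duhamelTerm hv hvf hm hf h1 hA hMA hlam hsmall
  have hgr := growth_tsum hd hA0
  refine ⟨lam, 2 * A, _, hlam, hgr, fun t ht ψ hψ => ?_⟩
  have hq : IsTest (lap ψ) := hψ.lap
  have hqm := hq.continuous.measurable
  have hpm : Measurable fun x => ∑ i, v x i * pd i ψ x := Finset.measurable_fun_sum _ fun i _ =>
    (hv.measurable_apply i).mul (hψ.pd i).continuous.measurable
  have hpi : Integrable fun x => ∑ i, v x i * pd i ψ x := integrable_finsetSum _ fun i _ =>
    (hψ.pd i).integrable_mul (hv.measurable_apply i) (hv.abs_apply_le i)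
  have iq : ∀ n s, Integrable fun x => duhamelTerm v φ₀ n s x * lap ψ x := fun n =>
    (hd n).integrable_mul hq.integrable
  have ip : ∀ n s, Integrable fun x => duhamelTerm v φ₀ n s x * ∑ i, v x i * pd i ψ x := fun n =>
    (hd n).integrable_mul hpi
  have iψ : ∀ n s, Integrable fun x => duhamelTerm v φ₀ n s x * ψ x := fun n =>
    (hd n).integrable_mul hψ.integrable
  have jq : ∀ n, IntervalIntegrable (fun s => ∫ x, duhamelTerm v φ₀ n s x * lap ψ x) volume 0 t :=
    fun n => (hd n).intervalIntegrable hlam hqm hq.integrable _ _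
  have jp : ∀ n, IntervalIntegrable (fun s => ∫ x, duhamelTerm v φ₀ n s x *
      ∑ i, v x i * pd i ψ x) volume 0 t :=
    fun n => (hd n).intervalIntegrable hlam hpm hpi _ _
  have hterm : ∀ n, ∫ x, duhamelTerm v φ₀ (n + 1) t x * ψ x
      = (∫ s in (0:ℝ)..t, ∫ x, duhamelTerm v φ₀ n s x * ∑ i, v x i * pd i ψ x)
        + ∫ s in (0:ℝ)..t, ∫ x, duhamelTerm v φ₀ (n + 1) s x * lap ψ x := fun n => by
    rw [← intervalIntegral.integral_add (jp n) (jq (n + 1))]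
    exact integral_duhamel_eq (hd n) hv hlam hψ ht
  have hsumx : ∀ (g : Plane → ℝ), (∀ n s, Integrable fun x => duhamelTerm v φ₀ n s x * g x) →
      ∀ N s, ∫ x, (∑ n ∈ Finset.range N, duhamelTerm v φ₀ n s x) * g x
        = ∑ n ∈ Finset.range N, ∫ x, duhamelTerm v φ₀ n s x * g x := fun g hg N s => by
    simp only [Finset.sum_mul]
    exact integral_finsetSum _ fun n _ => hg n s
  -- The partial sums solve the equation with the transport term lagging one index behind, as each
  -- term is driven by the transport of its predecessor. The lag disappears in the limit.
  have hpartial : ∀ N : ℕ, ∫ x, (∑ n ∈ Finset.range (N + 1), duhamelTerm v φ₀ n t x) * ψ x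
      = (∫ x, φ₀ x * ψ x)
        + ((∫ s in (0:ℝ)..t, ∫ x, (∑ n ∈ Finset.range N, duhamelTerm v φ₀ n s x) *
          ∑ i, v x i * pd i ψ x)
        + ∫ s in (0:ℝ)..t, ∫ x, (∑ n ∈ Finset.range (N + 1), duhamelTerm v φ₀ n s x) * lap ψ x) := by
    intro N
    simp only [hsumx _ iψ, hsumx _ iq, hsumx _ ip]
    rw [intervalIntegral.integral_finsetSum fun n _ => jq n,
      intervalIntegral.integral_finsetSum fun n _ => jp n, Finset.sum_range_succ',
      Finset.sum_range_succ' (fun n => ∫ s in (0:ℝ)..t, ∫ x, duhamelTerm v φ₀ n s x * lap ψ x)]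
    simp only [hterm, Finset.sum_add_distrib]
    have h0 := integral_freeFlow_mul hm h1 hψ ht
    simp only [duhamelTerm] at h0 ⊢
    rw [h0]
    ring
  have hlim := tendsto_nhds_unique
    ((tendsto_integral_growth hd hA0 hψ.integrable t).comp (tendsto_add_atTop_nat 1))
    (((tendsto_const_nhds (x := ∫ x, φ₀ x * ψ x)).add
      ((tendsto_intervalIntegral_growth hd hA0 hlam hpm hpi ht).add
        ((tendsto_intervalIntegral_growth hd hA0 hlam hqm hq.integrable ht).comp
          (tendsto_add_atTop_nat 1)))).congr fun N => (hpartial N).symm)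
  rw [hlim, ← intervalIntegral.integral_add (hgr.intervalIntegrable hlam hpm hpi _ _)
    (hgr.intervalIntegrable hlam hqm hq.integrable _ _)]
  congr 1
  refine intervalIntegral.integral_congr fun s _ => ?_
  simp only
  rw [← integral_add (hgr.integrable_mul hpi s) (hgr.integrable_mul hq.integrable s)]
  refine integral_congr_ae (ae_of_all _ fun x => ?_)
  simp only [lap]
  ring

end

/-! ### Solutions with values in the unit interval -/

section

variable {D : Domain} {K L C τ : ℝ} {v : Plane → Plane} {φ₀ : Plane → ℝ}

/-- A weak identity yields a weak solution for bounded functions which agree almost everywhere. -/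
lemma WSol.of_ae_eq {g g' z z' : ℝ → Plane → ℝ} {z0 z0' : Plane → ℝ}
    (hm : Measurable (Function.uncurry z')) (hgm : Measurable (Function.uncurry g'))
    (hm0 : Measurable z0') (hC : ∀ t x, |z' t x| ≤ C) (hgC : ∀ t x, |g' t x| ≤ C)
    (hC0 : ∀ x, |z0' x| ≤ C)
    (hz : ∀ t ∈ Icc 0 τ, z' t =ᵐ[volume] z t) (hg : ∀ t ∈ Icc 0 τ, g' t =ᵐ[volume] g t)
    (hz0 : z0' =ᵐ[volume] z0)
    (hw : ∀ t ∈ Icc (0 : ℝ) τ, ∀ ψ : Plane → ℝ, IsTest ψ →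
      ∫ x, z t x * ψ x = (∫ x, z0 x * ψ x) + ∫ s in (0 : ℝ)..t, ∫ x,
        (z s x * (∑ i, pd i (pd i ψ) x + ∑ i, v x i * pd i ψ x) + g s x * ψ x)) :
    WSol v τ C g' z0' z' where
  measurable := hm
  measurable_source := hgm
  measurable_zero := hm0
  bound := hC
  bound_source := hgC
  bound_zero := hC0
  weak t ht ψ hψ := by
    have e1 : ∫ x, z' t x * ψ x = ∫ x, z t x * ψ x :=
      integral_congr_ae ((hz t ht).mono fun x hx => by simp only [hx])
    have e2 : ∫ x, z0' x * ψ x = ∫ x, z0 x * ψ x :=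
      integral_congr_ae (hz0.mono fun x hx => by simp only [hx])
    rw [e1, e2, hw t ht ψ hψ]
    congr 1
    refine intervalIntegral.integral_congr fun s hs => ?_
    rw [uIcc_of_le ht.1] at hs
    have hs' : s ∈ Icc 0 τ := ⟨hs.1, hs.2.trans ht.2⟩
    refine integral_congr_ae ?_
    filter_upwards [hz s hs', hg s hs'] with x h1 h2
    rw [h1, h2]

lemma WSol.neg {g z : ℝ → Plane → ℝ} {z0 : Plane → ℝ} (h : WSol v τ C g z0 z) :
    WSol v τ C (fun t x => -g t x) (fun x => -z0 x) (fun t x => -z t x) where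
  measurable := h.measurable.neg
  measurable_source := h.measurable_source.neg
  measurable_zero := h.measurable_zero.neg
  bound t x := by rw [abs_neg]; exact h.bound t x
  bound_source t x := by rw [abs_neg]; exact h.bound_source t x
  bound_zero x := by rw [abs_neg]; exact h.bound_zero x
  weak t ht ψ hψ := by
    simp only [neg_mul, ← neg_add, integral_neg, intervalIntegral.integral_neg]
    rw [h.weak t ht ψ hψ, neg_add]

/-- A solution of the passive scalar equation with values in `[0, 1]` and mass at most `M`. -/
structure UnitSolution (D : Domain) (v : Plane → Plane) (M : ℝ) (φ₀ : Plane → ℝ)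
    (φ : ℝ → Plane → ℝ) : Prop where
  weakSolution : IsWeakSolution D v (fun _ => 0) φ₀ φ
  measurable_zero : Measurable φ₀
  mem_zero : ∀ x, φ₀ x ∈ Icc (0:ℝ) 1
  mem : ∀ t x, φ t x ∈ Icc (0:ℝ) 1
  mass : ∀ t, ∫⁻ x, ‖φ t x‖ₑ ∂D.measure ≤ ENNReal.ofReal M

lemma weak_integrand_eq {ψ : Plane → ℝ} (hψ : IsTest ψ) (v : Plane → Plane) (x : Plane) :
    Laplacian.laplacian ψ x + fderiv ℝ ψ x (v x)
      = ∑ i, pd i (pd i ψ) x + ∑ i, v x i * pd i ψ x := by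
  rw [laplacian_eq_sum hψ.1, fderiv_eq_sum]

lemma abs_le_one_of_mem {r : ℝ} (h : r ∈ Icc (0:ℝ) 1) : |r| ≤ 1 :=
  abs_le.2 ⟨by linarith [h.1], h.2⟩

lemma UnitSolution.wsol {M : ℝ} {φ : ℝ → Plane → ℝ} (h : UnitSolution D v M φ₀ φ) (τ : ℝ) :
    WSol v τ 1 (fun _ _ => 0) φ₀ φ where
  measurable := h.weakSolution.measurable
  measurable_source := measurable_const
  measurable_zero := h.measurable_zero
  bound t x := abs_le_one_of_mem (h.mem t x)
  bound_source t x := by simp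
  bound_zero x := abs_le_one_of_mem (h.mem_zero x)
  weak t ht ψ hψ := by
    rw [h.weakSolution.weak t ht.1 ψ hψ]
    simp only [weak_integrand_eq hψ]

lemma Domain.IsFun.indicator {φ : ℝ → Plane → ℝ} (h : ∀ t, D.IsFun (φ t)) (S : Set ℝ) (t : ℝ) :
    D.IsFun (S.indicator φ t) := by
  by_cases ht : t ∈ S
  · rw [indicator_of_mem ht]; exact h t
  · rw [indicator_of_notMem ht]
    cases D
    · trivial
    · exact fun _ => rfl

lemma measurable_uncurry_indicator {φ : ℝ → Plane → ℝ} (h : Measurable (Function.uncurry φ))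
    {S : Set ℝ} (hS : MeasurableSet S) : Measurable (Function.uncurry (S.indicator φ)) := by
  have : Function.uncurry (S.indicator φ) = (Prod.fst ⁻¹' S).indicator (Function.uncurry φ) := by
    funext p
    by_cases hp : p.1 ∈ S
    · rw [indicator_of_mem (show p ∈ Prod.fst ⁻¹' S from hp), Function.uncurry,
        indicator_of_mem hp]; rfl
    · rw [indicator_of_notMem (show p ∉ Prod.fst ⁻¹' S from hp), Function.uncurry,
        indicator_of_notMem hp]; rfl
  rw [this]
  exact h.indicator (measurable_fst hS)

/-- Existence for the passive scalar equation in the class of `[0, 1]`-valued functions. -/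
lemma exists_unitSolution (hv : IsField K L v) (hvf : D.IsFun v) (hm : Measurable φ₀)
    (hf : D.IsFun φ₀) (h0 : ∀ x, φ₀ x ∈ Icc (0:ℝ) 1) {M : ℝ} (hM0 : 0 ≤ M)
    (hM : ∫⁻ x, ‖φ₀ x‖ₑ ∂D.measure ≤ ENNReal.ofReal M) :
    ∃ φ, UnitSolution D v M φ₀ φ := by
  obtain ⟨lam, A, φ, hlam, hφ, hw⟩ :=
    exists_growth_solution hv hvf hm hf (fun x => abs_le_one_of_mem (h0 x)) hM
  have hA := hφ.nonneg
  -- `WSol` asks for a bound at all times, whereas φ may grow exponentially; hence the cutoff in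
  -- time.
  have hsol : ∀ τ, 0 ≤ τ → WSol v τ (A * Real.exp (lam * τ) + 1) (fun _ _ => 0) φ₀
      ((Icc 0 τ).indicator φ) := by
    intro τ hτ
    refine WSol.of_ae_eq (z := φ) (g := fun _ _ => 0) (z0 := φ₀)
      (measurable_uncurry_indicator hφ.measurable measurableSet_Icc)
      measurable_const hm (fun t x => ?_) (fun t x => ?_) (fun x => ?_)
      (fun t ht => ?_) (fun _ _ => EventuallyEq.rfl) EventuallyEq.rfl (fun t ht ψ hψ => ?_)
    · by_cases ht : t ∈ Icc 0 τ
      · rw [indicator_of_mem ht]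
        refine (hφ.bound t x).trans ?_
        have : A * Real.exp (lam * t) ≤ A * Real.exp (lam * τ) := by
          have := ht.2
          gcongr
        linarith
      · rw [indicator_of_notMem ht]
        simp only [Pi.zero_apply, abs_zero]
        positivity
    · rw [abs_zero]; positivity
    · have : 0 ≤ A * Real.exp (lam * τ) := by positivity
      linarith [abs_le_one_of_mem (h0 x)]
    · rw [indicator_of_mem ht]
    · rw [hw t ht.1 ψ hψ]
      simp
  have hle : ∀ t, 0 ≤ t → ∀ᵐ x, φ t x ≤ 1 := fun t ht => by
    have := (hsol t ht).le_of_source_le hv zero_le_one le_rfl (fun x => (h0 x).2)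
      (fun s _ x hx => by simp) ⟨ht, le_rfl⟩
    rwa [indicator_of_mem (show t ∈ Icc 0 t from ⟨ht, le_rfl⟩)] at this
  have hge : ∀ t, 0 ≤ t → ∀ᵐ x, 0 ≤ φ t x := fun t ht => by
    have := (hsol t ht).neg.le_of_source_le hv le_rfl le_rfl
      (fun x => by simpa using (h0 x).1) (fun s _ x hx => by simp) ⟨ht, le_rfl⟩
    rw [indicator_of_mem (show t ∈ Icc 0 t from ⟨ht, le_rfl⟩)] at this
    filter_upwards [this] with x hx
    linarith
  -- By the comparison principle, applied to φ and -φ, the truncation changes φ only on null sets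
  -- for t ≥ 0. It yields a representative with values in [0, 1] everywhere.
  let φ' : ℝ → Plane → ℝ := fun t x => max 0 (min 1 (φ t x))
  have hae : ∀ t, 0 ≤ t → φ' t =ᵐ[volume] φ t := fun t ht => by
    filter_upwards [hle t ht, hge t ht] with x h1 h2
    simp only [φ']
    rw [min_eq_right h1, max_eq_right h2]
  have hm' : Measurable (Function.uncurry φ') :=
    measurable_const.max (measurable_const.min hφ.measurable)
  have hf' : ∀ t, D.IsFun (φ' t) := fun t => (hφ.isFun t).comp fun r => max 0 (min 1 r)
  have hmem : ∀ t x, φ' t x ∈ Icc (0:ℝ) 1 := fun t x =>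
    ⟨le_max_left _ _, max_le zero_le_one (min_le_left _ _)⟩
  have hw' : ∀ τ, WSol v τ 1 (fun _ _ => 0) φ₀ φ' := fun τ =>
    WSol.of_ae_eq (z := φ) (g := fun _ _ => 0) (z0 := φ₀) hm' measurable_const hm
      (fun t x => abs_le_one_of_mem (hmem t x)) (fun _ _ => by simp)
      (fun x => abs_le_one_of_mem (h0 x)) (fun t ht => hae t ht.1)
      (fun _ _ => EventuallyEq.rfl) EventuallyEq.rfl fun t ht ψ hψ => by
        rw [hw t ht.1 ψ hψ]
        simp
  have hmono : ∀ t x, ‖φ' t x‖ₑ ≤ ‖φ t x‖ₑ := fun t x => by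
    rw [Real.enorm_eq_ofReal_abs, Real.enorm_eq_ofReal_abs, abs_of_nonneg (hmem t x).1]
    exact ENNReal.ofReal_le_ofReal (max_le (abs_nonneg _) ((min_le_right _ _).trans (le_abs_self _)))
  refine ⟨φ', ⟨hm', hf, hf', fun t ht ψ hψ => ?_⟩, hm, h0, hmem, fun t => ?_⟩
  · rw [(hw' t).weak t ⟨ht, le_rfl⟩ ψ hψ]
    simp only [weak_integrand_eq hψ]
  · by_cases ht : 0 ≤ t
    · have hind : ∀ s, ∀ x, (Icc 0 t).indicator φ' s x ∈ Icc (0:ℝ) 1 := fun s x => by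
        by_cases hs : s ∈ Icc 0 t
        · rw [indicator_of_mem hs]; exact hmem s x
        · rw [indicator_of_notMem hs]; simp
      have h1 : WSol v t 1 (fun _ _ => 0) φ₀ ((Icc 0 t).indicator φ') :=
        WSol.of_ae_eq (z := φ') (g := fun _ _ => 0) (z0 := φ₀)
          (measurable_uncurry_indicator hm' measurableSet_Icc) measurable_const hm
          (fun s x => abs_le_one_of_mem (hind s x)) (fun _ _ => by simp)
          (fun x => abs_le_one_of_mem (h0 x)) (fun s hs => by rw [indicator_of_mem hs])
          (fun _ _ => EventuallyEq.rfl) EventuallyEq.rfl (hw' t).weak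
      -- The exponential mass bound serves only as a priori finiteness; the energy inequality
      -- improves it to the mass bound of the datum.
      have h2 := h1.lintegral_le (M' := A * Real.exp (lam * t)) hv hvf hf
        (Domain.IsFun.indicator hf' _) (fun s x => (hind s x).1) (fun x => (h0 x).1)
        (fun s => by
          by_cases hs : s ∈ Icc 0 t
          · rw [indicator_of_mem hs]
            refine (lintegral_mono (hmono s)).trans ((hφ.mass s).trans
              (ENNReal.ofReal_le_ofReal ?_))
            have := hs.2
            gcongr
          · rw [indicator_of_notMem hs]; simp) hM hM0 (t := t) ⟨ht, le_rfl⟩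
      rwa [indicator_of_mem (show t ∈ Icc 0 t from ⟨ht, le_rfl⟩)] at h2
    · refine (lintegral_mono (hmono t)).trans ?_
      simp [hφ.zero t (not_le.1 ht)]

namespace UnitSolution

variable {M : ℝ} {φ : ℝ → Plane → ℝ}

lemma shift (h : UnitSolution D v M φ₀ φ) (hv : IsField K L v) {r : ℝ} (hr : 0 ≤ r) :
    UnitSolution D v M (φ r) (fun t => φ (r + t)) where
  weakSolution := by
    refine ⟨h.weakSolution.measurable.comp (f := fun p : ℝ × Plane => (r + p.1, p.2))
      (by fun_prop), h.weakSolution.isFun r, fun t => h.weakSolution.isFun _, fun t ht ψ hψ => ?_⟩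
    have := ((h.wsol (r + t)).shift hv ⟨hr, by linarith⟩).weak t ⟨ht, by linarith⟩ ψ hψ
    rw [this]
    simp only [weak_integrand_eq hψ]
  measurable_zero := h.weakSolution.measurable.comp measurable_prodMk_left
  mem_zero := h.mem r
  mem t := h.mem _
  mass t := h.mass _

lemma measurable_apply (h : UnitSolution D v M φ₀ φ) (t : ℝ) : Measurable (φ t) :=
  h.weakSolution.measurable.comp measurable_prodMk_left

end UnitSolution

/-! ### From operator norms to pointwise bounds -/

/-- Interpolation for `[0, 1]`-valued functions. -/
lemma eLpNorm_le_of_mem_Icc {μ : Measure Plane} {g : Plane → ℝ} (hg : ∀ x, g x ∈ Icc (0:ℝ) 1)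
    {M : ℝ} (hM : 1 ≤ M) (hm : ∫⁻ x, ‖g x‖ₑ ∂μ ≤ ENNReal.ofReal M) {n : ℕ} (hn : 1 ≤ n) :
    eLpNorm g n μ ≤ ENNReal.ofReal M := by
  have hn0 : (n : ℝ≥0∞) ≠ 0 := by exact_mod_cast (by omega : n ≠ 0)
  have hnr : (1:ℝ) ≤ n := by exact_mod_cast hn
  rw [eLpNorm_eq_lintegral_rpow_enorm_toReal hn0 (by simp), ENNReal.toReal_natCast]
  have h1 : ∫⁻ x, ‖g x‖ₑ ^ (n : ℝ) ∂μ ≤ ENNReal.ofReal M := by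
    refine (lintegral_mono fun x => ?_).trans hm
    have hle : ‖g x‖ₑ ≤ 1 := by
      rw [Real.enorm_eq_ofReal_abs, ← ENNReal.ofReal_one]
      exact ENNReal.ofReal_le_ofReal (abs_le_one_of_mem (hg x))
    exact (ENNReal.rpow_le_rpow_of_exponent_ge hle hnr).trans (by rw [ENNReal.rpow_one])
  refine (ENNReal.rpow_le_rpow h1 (by positivity)).trans ?_
  have hM1 : 1 ≤ ENNReal.ofReal M := by
    rw [← ENNReal.ofReal_one]; exact ENNReal.ofReal_le_ofReal hM
  refine (ENNReal.rpow_le_rpow_of_exponent_le hM1 (?_ : 1 / (n:ℝ) ≤ 1)).trans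
    (by rw [ENNReal.rpow_one])
  rw [div_le_one (by linarith)]
  exact hnr

/-- Scaling of the estimate for the solution operator. -/
lemma UnitSolution.eLpNorm_top_le {M : ℝ} {φ : ℝ → Plane → ℝ} (h : UnitSolution D v M φ₀ φ)
    (hM : 1 ≤ M) {n : ℕ} (hn : 1 ≤ n) {b : ℝ} (hb : 0 < b)
    (hφ₀ : eLpNorm φ₀ n D.measure ≤ ENNReal.ofReal b) (τ : ℝ) :
    eLpNorm (φ τ) ⊤ D.measure ≤ ENNReal.ofReal b * solutionOperatorNorm D v n ⊤ τ := by
  have hsc : ∀ (g : Plane → ℝ) (q : ℝ≥0∞), eLpNorm (fun x => b⁻¹ * g x) q D.measure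
      = ENNReal.ofReal b⁻¹ * eLpNorm g q D.measure := fun g q => by
    have := eLpNorm_const_smul (b⁻¹) g q D.measure
    rw [Real.enorm_eq_ofReal_abs, abs_of_pos (by positivity)] at this
    exact this
  have hmul : ENNReal.ofReal b * ENNReal.ofReal b⁻¹ = 1 := by
    rw [← ENNReal.ofReal_mul hb.le, mul_inv_cancel₀ hb.ne', ENNReal.ofReal_one]
  -- After division by b the solution is a competitor in the supremum defining the operator norm.
  have hsol : IsScalarSolution D v n (fun x => b⁻¹ * φ₀ x) (fun t x => b⁻¹ * φ t x) := by
    refine ⟨⟨h.weakSolution.measurable.const_mul _, h.weakSolution.isFun_zero.comp (b⁻¹ * ·),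
      fun t => (h.weakSolution.isFun t).comp (b⁻¹ * ·), fun t ht ψ hψ => ?_⟩, ?_, fun s => ?_⟩
    · have := h.weakSolution.weak t ht ψ hψ
      simp only [zero_mul, add_zero, mul_assoc, integral_const_mul,
        intervalIntegral.integral_const_mul] at this ⊢
      rw [this, mul_add]
    · refine ⟨(h.measurable_zero.const_mul _).aestronglyMeasurable, ?_⟩
      rw [hsc]
      exact ENNReal.mul_lt_top (by simp) (hφ₀.trans_lt (by simp))
    · refine ⟨(b⁻¹ * M).toNNReal, fun t _ => ?_⟩
      rw [hsc]
      refine (mul_le_mul' le_rfl (eLpNorm_le_of_mem_Icc (h.mem t) hM (h.mass t) hn)).trans ?_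
      rw [← ENNReal.ofReal_mul (by positivity)]
      exact le_rfl
  have hunit : eLpNorm (fun x => b⁻¹ * φ₀ x) n D.measure ≤ 1 := by
    rw [hsc, ← hmul, mul_comm]
    exact mul_le_mul' hφ₀ le_rfl
  have hle : eLpNorm (fun x => b⁻¹ * φ τ x) ⊤ D.measure ≤ solutionOperatorNorm D v n ⊤ τ :=
    le_iSup_of_le _ (le_iSup_of_le _ (le_iSup_of_le hsol (le_iSup_of_le hunit le_rfl)))
  rw [hsc] at hle
  calc eLpNorm (φ τ) ⊤ D.measure
      = ENNReal.ofReal b * (ENNReal.ofReal b⁻¹ * eLpNorm (φ τ) ⊤ D.measure) := by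
        rw [← mul_assoc, hmul, one_mul]
    _ ≤ _ := by gcongr

/-- A property which holds almost everywhere on the domain holds almost everywhere. -/
lemma Domain.IsFun.ae_of_ae_measure {p : Plane → Prop} (hp : D.IsFun p)
    (h : ∀ᵐ x ∂D.measure, p x) : ∀ᵐ x, p x := by
  cases D
  · exact h
  · have hS : MeasurableSet {x : Plane | x 1 ∈ Ico (0:ℝ) 1} :=
      (measurable_apply_plane 1) measurableSet_Ico
    have hper : Function.Periodic p (bv 1) := hp
    have h' : ∀ᵐ x : Plane, x 1 ∈ Ico (0:ℝ) 1 → p x := (ae_restrict_iff' hS).1 h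
    -- Countably many vertical integer translates of the fundamental domain cover the plane, so the
    -- exceptional sets still add up to a null set.
    have key : ∀ n : ℤ, ∀ᵐ x : Plane, (x - n • bv 1) 1 ∈ Ico (0:ℝ) 1 → p (x - n • bv 1) :=
      fun n => (measurePreserving_sub_right volume (n • bv 1 : Plane)).quasiMeasurePreserving.ae h'
    filter_upwards [ae_all_iff.2 key] with x hx
    have h1 := hx ⌊x 1⌋
    have h2 : (x - ⌊x 1⌋ • bv 1) 1 = Int.fract (x 1) := by
      rw [← Int.self_sub_floor]; simp
    rw [h2, hper.sub_zsmul_eq] at h1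
    exact h1 ⟨Int.fract_nonneg _, Int.fract_lt_one _⟩

lemma ae_le_of_eLpNorm_top_le {g : Plane → ℝ} (hg : D.IsFun g) {b : ℝ} (hb : 0 ≤ b)
    (h : eLpNorm g ⊤ D.measure ≤ ENNReal.ofReal b) : ∀ᵐ x, g x ≤ b := by
  refine Domain.IsFun.ae_of_ae_measure (D := D) (hg.comp fun r => r ≤ b) ?_
  filter_upwards [ae_le_eLpNormEssSup (f := g) (μ := D.measure)] with x hx
  rw [← eLpNorm_exponent_top] at hx
  have := hx.trans h
  rw [Real.enorm_eq_ofReal_abs, ENNReal.ofReal_le_ofReal_iff hb] at this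
  exact (le_abs_self _).trans this

/-- The supremum does not increase. -/
lemma UnitSolution.ae_le {M : ℝ} {φ : ℝ → Plane → ℝ} (h : UnitSolution D v M φ₀ φ)
    (hv : IsField K L v) {a r t : ℝ} (hr : 0 ≤ r) (hrt : r ≤ t) (ha : ∀ᵐ x, φ r x ≤ a)
    (ha0 : 0 ≤ a) : ∀ᵐ x, φ t x ≤ a := by
  have hs := (h.shift hv hr).wsol (t - r)
  -- The comparison principle wants the bound on the datum at every point; the minimum achieves this
  -- by a change on a null set.
  have h1 : WSol v (t - r) 1 (fun _ _ => 0) (fun x => min (φ r x) a) (fun t => φ (r + t)) :=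
    WSol.of_ae_eq (z := fun t => φ (r + t)) (g := fun _ _ => 0) (z0 := φ r) hs.measurable
      measurable_const (hs.measurable_zero.min measurable_const) hs.bound (fun _ _ => by simp)
      (fun x => abs_le_one_of_mem ⟨le_min (h.mem r x).1 ha0, (min_le_left _ _).trans (h.mem r x).2⟩)
      (fun _ _ => EventuallyEq.rfl) (fun _ _ => EventuallyEq.rfl)
      (ha.mono fun x hx => min_eq_left hx) hs.weak
  have := h1.le_of_source_le hv ha0 le_rfl (fun x => min_le_right _ _) (fun s _ x hx => by
    simp) (t := t - r) ⟨by linarith, le_rfl⟩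
  simpa using this

end

/-! ### Boundedness of periodic flows -/

section

variable {D : Domain} {u : Plane → Plane}

/-- A periodic Lipschitz flow is bounded. -/
lemma IsFlow.exists_isField (hu : IsFlow D u) :
    ∃ K L : ℝ, ∀ A : ℝ, IsField (|A| * K) (|A| * L) (fun x => A • u x) := by
  obtain ⟨K, hK⟩ := hu.lipschitz
  obtain ⟨ℓ, hℓ, hper⟩ := hu.periodic
  have hbd : ∀ x, ‖u x‖ ≤ ‖u 0‖ + K * (ℓ 0 + ℓ 1) := fun x => by
    have hp : ∀ i, Function.Periodic u (EuclideanSpace.single i (ℓ i)) := fun i => hper i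
    set y : Plane := x - ⌊x 0 / ℓ 0⌋ • EuclideanSpace.single 0 (ℓ 0)
      - ⌊x 1 / ℓ 1⌋ • EuclideanSpace.single 1 (ℓ 1) with hy
    have h1 : u y = u x := by rw [hy, (hp 1).sub_zsmul_eq, (hp 0).sub_zsmul_eq]
    have h2 : ∀ i, |y i| ≤ ℓ i := by
      have h3 : ∀ i, y i = ℓ i * Int.fract (x i / ℓ i) := by
        intro i
        have := (hℓ i).ne'
        rw [← Int.self_sub_floor, mul_sub, mul_div_cancel₀ _ this]
        fin_cases i <;> simp [hy, mul_comm]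
      intro i
      rw [h3, abs_of_nonneg (mul_nonneg (hℓ i).le (Int.fract_nonneg _))]
      exact mul_le_of_le_one_right (hℓ i).le (Int.fract_lt_one _).le
    have h4 : ‖y‖ ≤ ℓ 0 + ℓ 1 := by
      rw [plane_eq_sum y, Fin.sum_univ_two]
      refine (norm_add_le _ _).trans ?_
      simp only [norm_smul, PiLp.norm_single, norm_one, mul_one, Real.norm_eq_abs]
      exact add_le_add (h2 0) (h2 1)
    have h5 := hK.dist_le_mul y 0
    rw [dist_eq_norm, dist_zero_right] at h5
    have h6 : ‖u y‖ ≤ ‖u 0‖ + ‖u y - u 0‖ := by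
      simpa using norm_add_le (u 0) (u y - u 0)
    rw [← h1]
    have h7 : (K:ℝ) * ‖y‖ ≤ K * (ℓ 0 + ℓ 1) := by gcongr
    linarith
  refine ⟨K, ‖u 0‖ + K * (ℓ 0 + ℓ 1), fun A => ⟨?_, fun x y => ?_, fun x => ?_, fun ψ hψ => ?_⟩⟩
  · exact (hK.continuous.const_smul A).measurable
  · rw [← smul_sub, norm_smul, Real.norm_eq_abs, mul_assoc]
    have := hK.dist_le_mul x y
    rw [dist_eq_norm, dist_eq_norm] at this
    gcongr
  · rw [norm_smul, Real.norm_eq_abs]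
    exact mul_le_mul_of_nonneg_left (hbd x) (abs_nonneg _)
  · simp only [map_smul, smul_eq_mul, integral_const_mul, hu.incompressible ψ hψ, mul_zero]

/-- The product rule for integral functions. -/
lemma mul_eq_add_integral {F G f g : ℝ → ℝ} {F0 G0 τ M : ℝ} (hτ : 0 ≤ τ) (hf : Measurable f)
    (hg : Measurable g) (hfM : ∀ s, |f s| ≤ M) (hgM : ∀ s, |g s| ≤ M)
    (hF : ∀ t ∈ Icc 0 τ, F t = F0 + ∫ s in 0..t, f s)
    (hG : ∀ t ∈ Icc 0 τ, G t = G0 + ∫ s in 0..t, g s) :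
    F τ * G τ = F0 * G0 + ∫ s in 0..τ, (F s * g s + f s * G s) := by
  -- Polarization: 4FG = (F + G)² - (F - G)², with the chain rule for the square. That chain rule
  -- does not use the numerical bounds of the profile, so radius 0 suffices.
  have hB : Profile (fun x => x ^ 2) (fun x => 2 * x) (fun _ => 2) 0 2 :=
    ⟨fun x => by simpa using hasDerivAt_pow 2 x,
      fun x => by simpa using (hasDerivAt_id x).const_mul 2, continuous_const, by simp,
      fun x hx => by rw [abs_mul, abs_two]; linarith, fun x _ => by simp⟩
  have hii : ∀ {f : ℝ → ℝ}, Measurable f → (∀ s, |f s| ≤ M) → ∀ a b,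
      IntervalIntegrable f volume a b := fun hf hM a b => by
    rw [intervalIntegrable_iff]
    exact Measure.integrableOn_of_bounded (M := M) (by simp) hf.aestronglyMeasurable
      (ae_of_all _ hM)
  have hfi := hii hf hfM
  have hgi := hii hg hgM
  have hprod : ∀ {F f h : ℝ → ℝ} {F0 : ℝ}, (∀ a b, IntervalIntegrable f volume a b) →
      (∀ a b, IntervalIntegrable h volume a b) →
      (∀ t ∈ Icc 0 τ, F t = F0 + ∫ s in 0..t, f s) →
      IntervalIntegrable (fun s => F s * h s) volume 0 τ := fun {F f h F0} hf hh hF => by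
    have hc : Continuous fun t => F0 + ∫ s in 0..t, f s :=
      continuous_const.add (intervalIntegral.continuous_primitive hf 0)
    refine ((hh 0 τ).continuousOn_mul hc.continuousOn).congr fun s hs => ?_
    rw [uIoc_of_le hτ] at hs
    simp only [hF s ⟨hs.1.le, hs.2⟩]
  have ha := hB.comp_integral hτ (f := fun s => f s + g s) (F := fun s => F s + G s)
    (F0 := F0 + G0) (M := M + M) (hf.add hg)
    (fun s => (abs_add_le _ _).trans (add_le_add (hfM s) (hgM s)))
    (fun t ht => by
      rw [hF t ht, hG t ht, intervalIntegral.integral_add (hfi _ _) (hgi _ _)]; ring)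
  have hb := hB.comp_integral hτ (f := fun s => f s - g s) (F := fun s => F s - G s)
    (F0 := F0 - G0) (M := M + M) (hf.sub hg)
    (fun s => (abs_sub _ _).trans (add_le_add (hfM s) (hgM s)))
    (fun t ht => by
      rw [hF t ht, hG t ht, intervalIntegral.integral_sub (hfi _ _) (hgi _ _)]; ring)
  have e1 := hprod hfi hfi hF
  have e2 := hprod hfi hgi hF
  have e3 := hprod hgi hfi hG
  have e4 := hprod hgi hgi hG
  have hs : (∫ s in 0..τ, 2 * (F s + G s) * (f s + g s))
      - (∫ s in 0..τ, 2 * (F s - G s) * (f s - g s))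
      = 4 * ∫ s in 0..τ, (F s * g s + f s * G s) := by
    rw [← intervalIntegral.integral_sub, ← intervalIntegral.integral_const_mul]
    · congr 1; funext s; ring
    · exact ((((e1.add e2).add e3).add e4).const_mul 2).congr fun s _ => by
        ring
    · exact ((((e1.sub e2).sub e3).add e4).const_mul 2).congr fun s _ => by
        ring
  linarith

end

/-! ### Comparison with the passive scalar equation -/

section

variable {D : Domain} {v : Plane → Plane} {K L τ C : ℝ}

namespace WSol

lemma integrable_mul_operator {g z : ℝ → Plane → ℝ} {z0 : Plane → ℝ} (h : WSol v τ C g z0 z)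
    (hv : IsField K L v) {ψ : Plane → ℝ} (hψ : IsTest ψ) (s : ℝ) : Integrable fun x =>
      z s x * (∑ i, pd i (pd i ψ) x + ∑ i, v x i * pd i ψ x) := by
  have hz : Measurable (z s) := h.measurable.comp measurable_prodMk_left
  simp only [mul_add, Finset.mul_sum]
  refine Integrable.fun_add (integrable_finsetSum _ fun i _ => ?_)
    (integrable_finsetSum _ fun i _ => ?_)
  · simpa only [mul_comm] using ((hψ.pd i).pd i).integrable_mul hz (h.bound s)
  · have := (hψ.pd i).integrable_mul (hz.mul (hv.measurable_apply i)) (C := C * L)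
      (fun x => by
        rw [Pi.mul_apply, abs_mul]
        exact mul_le_mul (h.bound s x) (hv.abs_apply_le i x) (abs_nonneg _) h.C_nonneg)
    simpa only [Pi.mul_apply, mul_assoc, mul_comm, mul_left_comm] using this

lemma sub {C' : ℝ} {g g' z z' : ℝ → Plane → ℝ} {z0 z0' : Plane → ℝ} (h : WSol v τ C g z0 z)
    (h' : WSol v τ C' g' z0' z') (hv : IsField K L v) :
    WSol v τ (C + C') (fun t x => g t x - g' t x) (fun x => z0 x - z0' x)
      (fun t x => z t x - z' t x) where
  measurable := h.measurable.sub h'.measurable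
  measurable_source := h.measurable_source.sub h'.measurable_source
  measurable_zero := h.measurable_zero.sub h'.measurable_zero
  bound t x := (abs_sub _ _).trans (add_le_add (h.bound t x) (h'.bound t x))
  bound_source t x := (abs_sub _ _).trans (add_le_add (h.bound_source t x) (h'.bound_source t x))
  bound_zero x := (abs_sub _ _).trans (add_le_add (h.bound_zero x) (h'.bound_zero x))
  weak t ht ψ hψ := by
    have hqi : ∀ {g z : ℝ → Plane → ℝ} {z0 : Plane → ℝ} {C : ℝ}, WSol v τ C g z0 z → ∀ s,
        Integrable fun x => z s x * (∑ i, pd i (pd i ψ) x + ∑ i, v x i * pd i ψ x)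
          + g s x * ψ x := fun {g z z0 C} h s => by
      have hg : Measurable (g s) := h.measurable_source.comp measurable_prodMk_left
      refine (h.integrable_mul_operator hv hψ s).fun_add ?_
      simpa only [mul_comm] using hψ.integrable_mul hg (h.bound_source s)
    have e1 := hqi h
    have e2 := hqi h'
    have i1 : ∀ {f : Plane → ℝ} {C : ℝ}, Measurable f → (∀ x, |f x| ≤ C) →
        Integrable fun x => f x * ψ x := fun hf hC => by
      simpa only [mul_comm] using hψ.integrable_mul hf hC
    have m1 : Measurable (z t) := h.measurable.comp measurable_prodMk_left
    have m2 : Measurable (z' t) := h'.measurable.comp measurable_prodMk_left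
    simp only [sub_mul]
    rw [integral_sub (i1 m1 (h.bound t)) (i1 m2 (h'.bound t)),
      integral_sub (i1 h.measurable_zero h.bound_zero) (i1 h'.measurable_zero h'.bound_zero),
      h.weak t ht ψ hψ, h'.weak t ht ψ hψ, add_sub_add_comm,
      ← intervalIntegral.integral_sub (h.intervalIntegrable_weak hv hψ _ _)
        (h'.intervalIntegrable_weak hv hψ _ _)]
    congr 2
    funext s
    rw [← integral_sub (e1 s) (e2 s)]
    congr 1
    funext x
    ring

/-- Multiplication of a solution by a function of time. -/
lemma mul_time {z : ℝ → Plane → ℝ} {z0 : Plane → ℝ} (h : WSol v τ C (fun _ _ => 0) z0 z)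
    (hv : IsField K L v) {q H : ℝ → ℝ} {b : ℝ} (hb : 1 ≤ b) (hq : Measurable q)
    (hqb : ∀ t, |q t| ≤ b) (hH : Measurable H) (hHb : ∀ t, |H t| ≤ b)
    (hHq : ∀ t ∈ Icc 0 τ, H t = 1 + ∫ s in 0..t, q s) :
    WSol v τ (b * C) (fun t x => q t * z t x) z0 (fun t x => H t * z t x) where
  measurable := (hH.comp measurable_fst).mul h.measurable
  measurable_source := (hq.comp measurable_fst).mul h.measurable
  measurable_zero := h.measurable_zero
  bound t x := by
    rw [abs_mul]
    exact mul_le_mul (hHb t) (h.bound t x) (abs_nonneg _) (by linarith)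
  bound_source t x := by
    rw [abs_mul]
    exact mul_le_mul (hqb t) (h.bound t x) (abs_nonneg _) (by linarith)
  bound_zero x := (h.bound_zero x).trans (le_mul_of_one_le_left h.C_nonneg hb)
  weak t ht ψ hψ := by
    obtain ⟨hm, M, hM⟩ := h.exists_bound_weak hv hψ
    have hsub : ∀ s ∈ Icc 0 t, s ∈ Icc 0 τ := fun s hs => ⟨hs.1, hs.2.trans ht.2⟩
    have key := mul_eq_add_integral (M := max b M) (F := H) (G := fun t => ∫ x, z t x * ψ x)
      ht.1 hq hm (fun s => (hqb s).trans (le_max_left _ _))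
      (fun s => (hM s).trans (le_max_right _ _)) (fun s hs => hHq s (hsub s hs))
      (fun s hs => h.weak s (hsub s hs) ψ hψ)
    simp only [mul_assoc, integral_const_mul]
    rw [key, one_mul]
    congr 2
    funext s
    have i0 : Measurable (z s) := h.measurable.comp measurable_prodMk_left
    have i1 : Integrable fun x => z s x * ψ x := by
      simpa only [mul_comm] using hψ.integrable_mul i0 (h.bound s)
    have i2 := h.integrable_mul_operator hv hψ s
    rw [integral_add (i2.const_mul _) (i1.const_mul _), integral_const_mul, integral_const_mul]
    simp only [zero_mul, add_zero]

end WSol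

/-- Comparison of the reaction-diffusion equation with the passive scalar equation. -/
lemma IsReactionSolution.ae_le_two_mul {f : ℝ → ℝ} {T₀ : Plane → ℝ} {T φ : ℝ → Plane → ℝ}
    {M c α b : ℝ} {k : ℝ≥0} (hT : IsReactionSolution D v f T₀ T) (hv : IsField K L v)
    (hφ : UnitSolution D v M T₀ φ) (hf0 : f 0 = 0) (hf : LipschitzOnWith k f (Icc 0 1))
    (hα : 1 < α) (hfα : ∀ s ∈ Icc (0:ℝ) 1, f s ≤ c * s ^ α) {q : ℝ → ℝ} (hq : Measurable q)
    (hq0 : ∀ t, 0 ≤ q t) (hqb : ∀ t, q t ≤ b) (hq1 : ∀ t, 0 ≤ t → ∫ s in 0..t, q s ≤ 1)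
    (hqφ : ∀ t, 0 ≤ t → ∀ᵐ x, 2 ^ α * c * φ t x ^ (α - 1) ≤ q t) (hc : 0 < c)
    {t : ℝ} (ht : 0 ≤ t) : ∀ᵐ x, T t x ≤ 2 * φ t x := by
  have hTmem : ∀ s x, (Icc 0 t).indicator T s x ∈ Icc (0:ℝ) 1 := fun s x => by
    by_cases hs : s ∈ Icc 0 t
    · rw [indicator_of_mem hs]; exact hT.mem_Icc s hs.1 x
    · rw [indicator_of_notMem hs]; simp
  have hflip : ∀ x ∈ Icc (0:ℝ) 1, ∀ y ∈ Icc (0:ℝ) 1, |f x - f y| ≤ k * |x - y| := by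
    intro x hx y hy
    simpa only [Real.dist_eq] using hf.dist_le_mul x hx y hy
  have hfb : ∀ x ∈ Icc (0:ℝ) 1, |f x| ≤ k := fun x hx => by
    have := hflip x hx 0 (by simp)
    rw [hf0, sub_zero, sub_zero] at this
    exact this.trans (mul_le_of_le_one_right k.2 (abs_le_one_of_mem hx))
  -- Outside [0, 1] nothing is known about `f`, so measurability of the source is obtained from a
  -- continuous extension that agrees with `f` on the values taken.
  have hfm : Measurable (IccExtend zero_le_one ((Icc 0 1).domRestrict f)) :=
    (hf.continuousOn.domRestrict.Icc_extend').measurable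
  have hfe : ∀ s x, IccExtend zero_le_one ((Icc 0 1).domRestrict f) ((Icc 0 t).indicator T s x)
      = f ((Icc 0 t).indicator T s x) := fun s x => by
    rw [IccExtend_of_mem _ _ (hTmem s x)]; rfl
  have hTm := measurable_uncurry_indicator hT.weakSolution.measurable
    (measurableSet_Icc (a := (0:ℝ)) (b := t))
  have hT' : WSol v t (max 1 k) (fun s x => f ((Icc 0 t).indicator T s x)) T₀
      ((Icc 0 t).indicator T) := by
    refine WSol.of_ae_eq (z := T) (g := fun s x => f (T s x)) (z0 := T₀) hTm ?_
      hφ.measurable_zero (fun s x => (abs_le_one_of_mem (hTmem s x)).trans (le_max_left _ _))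
      (fun s x => (hfb _ (hTmem s x)).trans (le_max_right _ _))
      (fun x => (abs_le_one_of_mem (hφ.mem_zero x)).trans (le_max_left _ _))
      (fun s hs => by rw [indicator_of_mem hs])
      (fun s hs => by simp only [indicator_of_mem hs]; rfl) EventuallyEq.rfl
      fun s hs ψ hψ => ?_
    · have : (Function.uncurry fun s x => f ((Icc 0 t).indicator T s x))
          = IccExtend zero_le_one ((Icc 0 1).domRestrict f)
            ∘ Function.uncurry ((Icc 0 t).indicator T) := funext fun p => (hfe p.1 p.2).symm
      rw [this]
      exact hfm.comp hTm
    · rw [hT.weakSolution.weak s hs.1 ψ hψ]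
      simp only [weak_integrand_eq hψ]
  -- The bound by q holds almost everywhere, while the source condition of the comparison principle
  -- is pointwise. Setting φ to 0 at the exceptional points repairs this.
  let φ' : ℝ → Plane → ℝ := fun s x => if 2 ^ α * c * φ s x ^ (α - 1) ≤ q s then φ s x else 0
  have hφ'mem : ∀ s x, φ' s x ∈ Icc (0:ℝ) 1 := fun s x => by
    simp only [φ']
    split_ifs
    · exact hφ.mem s x
    · simp
  have hφ'q : ∀ s x, 2 ^ α * c * φ' s x ^ (α - 1) ≤ q s := fun s x => by
    simp only [φ']
    split_ifs with h
    · exact h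
    · rw [Real.zero_rpow (by linarith), mul_zero]; exact hq0 s
  have hae : ∀ s, 0 ≤ s → φ' s =ᵐ[volume] φ s := fun s hs => by
    filter_upwards [hqφ s hs] with x hx
    simp only [φ', if_pos hx]
  have hφ'm : Measurable (Function.uncurry φ') := by
    refine Measurable.ite (measurableSet_le ?_ (hq.comp measurable_fst))
      hφ.weakSolution.measurable measurable_const
    exact (hφ.weakSolution.measurable.pow_const _).const_mul _
  have hφ' : WSol v t 1 (fun _ _ => 0) T₀ φ' :=
    WSol.of_ae_eq (z := φ) (g := fun _ _ => 0) (z0 := T₀) hφ'm measurable_const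
      hφ.measurable_zero (fun s x => abs_le_one_of_mem (hφ'mem s x)) (fun _ _ => by simp)
      (fun x => abs_le_one_of_mem (hφ.mem_zero x)) (fun s hs => hae s hs.1)
      (fun _ _ => EventuallyEq.rfl) EventuallyEq.rfl (hφ.wsol t).weak
  have hqi : ∀ a d, IntervalIntegrable q volume a d := fun a d => by
    rw [intervalIntegrable_iff]
    exact Measure.integrableOn_of_bounded (M := b) (by simp) hq.aestronglyMeasurable
      (ae_of_all _ fun s => by rw [Real.norm_eq_abs, abs_of_nonneg (hq0 s)]; exact hqb s)
  -- Freezing the primitive at negative times keeps H between 1 and 2 throughout, as the global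
  -- bounds in `WSol` require.
  let H : ℝ → ℝ := fun s => 1 + ∫ r in 0..max s 0, q r
  have hH1 : ∀ s, 1 ≤ H s := fun s => by
    have : 0 ≤ ∫ r in 0..max s 0, q r :=
      intervalIntegral.integral_nonneg (le_max_right s 0) fun r _ => hq0 r
    simp only [H]; linarith
  have hH2 : ∀ s, H s ≤ 2 := fun s => by
    have := hq1 _ (le_max_right s 0)
    simp only [H]; linarith
  have hHm : Measurable H := by
    have : Continuous H := continuous_const.add
      ((intervalIntegral.continuous_primitive hqi 0).comp (continuous_id.max continuous_const))
    exact this.measurable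
  have hw := hφ'.mul_time hv (q := q) (H := H) (b := max 2 b)
    (by linarith [le_max_left 2 b]) hq
    (fun s => by rw [abs_of_nonneg (hq0 s)]; exact (hqb s).trans (le_max_right _ _)) hHm
    (fun s => by
      rw [abs_of_nonneg (by linarith [hH1 s])]; exact (hH2 s).trans (le_max_left _ _))
    (fun s hs => by simp only [H, max_eq_left hs.1])
  -- The source of T - Hφ is f(T) - qφ ≤ k (T - Hφ) + f(Hφ) - qφ. It is needed only where T > Hφ,
  -- and there Hφ < 1, so that f is evaluated inside [0, 1]; then f(Hφ) ≤ c (2φ)^α ≤ qφ.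
  have key := (hT'.sub hw hv).le_of_source_le hv (a := 0) (Q := k) le_rfl k.2
    (fun x => by simp) (fun s hs x hx => by
      have hy := hTmem s x
      have hp := hφ'mem s x
      set y := (Icc 0 t).indicator T s x
      set p := φ' s x with hpdef
      have hw0 : 0 ≤ H s * p := mul_nonneg (by linarith [hH1 s]) hp.1
      have hwy : H s * p ≤ y := by linarith
      have h1 := (le_abs_self _).trans (hflip y hy (H s * p) ⟨hw0, hwy.trans hy.2⟩)
      rw [abs_of_nonneg (by linarith)] at h1
      have h2 : f (H s * p) ≤ q s * p := by
        calc f (H s * p) ≤ c * (H s * p) ^ α := hfα _ ⟨hw0, hwy.trans hy.2⟩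
          _ ≤ c * (2 * p) ^ α := by
            have := hH2 s
            have := hp.1
            gcongr
          _ = 2 ^ α * c * p ^ (α - 1) * p := by
            rw [Real.mul_rpow zero_le_two hp.1]
            rcases hp.1.eq_or_lt with h0 | h0
            · rw [← h0, Real.zero_rpow (by linarith)]; ring
            · rw [Real.rpow_sub_one h0.ne']; field_simp
          _ ≤ q s * p := mul_le_mul_of_nonneg_right (hφ'q s x) hp.1
      rw [sub_zero]
      linarith) (t := t) ⟨ht, le_rfl⟩
  filter_upwards [key, hae t ht] with x h1 h2
  rw [indicator_of_mem (show t ∈ Icc 0 t from ⟨ht, le_rfl⟩), h2] at h1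
  have := mul_le_mul_of_nonneg_right (hH2 t) (hφ.mem t x).1
  linarith

end

/-! ### Quenching -/

section

variable {D : Domain} {u v : Plane → Plane} {K L : ℝ} {φ₀ : Plane → ℝ}

/-- An integrable weight which is large for short times, and decays slowly. -/
lemma exists_time_weight {κ C θ : ℝ} (hκ : 0 < κ) (hC : 0 < C) (hθ : 1 < θ) :
    ∃ (τ η b : ℝ) (q : ℝ → ℝ), 0 < τ ∧ 0 < η ∧ Measurable q ∧ (∀ t, 0 ≤ q t) ∧ (∀ t, q t ≤ b) ∧
      (∀ t, 0 ≤ t → ∫ s in 0..t, q s ≤ 1) ∧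
      ∀ t, 0 ≤ t → κ ≤ q t ∨ (τ ≤ t ∧ η ≤ q t) ∨ (2 ≤ t ∧ C * (t - 1) ^ (-θ) ≤ q t) := by
  -- The factor 2^θ absorbs the shift by one unit of time, since t - 1 ≥ t / 2 for t ≥ 2.
  set C2 := C * 2 ^ θ with hC2
  have hC2p : 0 < C2 := by positivity
  obtain ⟨ℓ, hℓ2, hℓ⟩ : ∃ ℓ : ℝ, 2 ≤ ℓ ∧ C2 * (ℓ ^ (-(θ - 1)) / (θ - 1)) ≤ 1 / 3 := by
    have h := ((tendsto_rpow_neg_atTop (sub_pos.2 hθ)).div_const (θ - 1)).const_mul C2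
    rw [zero_div, mul_zero] at h
    obtain ⟨ℓ, h1, h2⟩ := ((h.eventually (ge_mem_nhds (by norm_num : (0:ℝ) < 1 / 3))).and
      (eventually_ge_atTop 2)).exists
    exact ⟨ℓ, h2, h1⟩
  have hℓ0 : 0 < ℓ := by linarith
  -- The budget 1 is split into thirds: ℓ is chosen first so that the tail beyond it costs at most
  -- 1/3, then τ and η so that κ on [0, τ] and η on [0, ℓ] cost 1/3 each.
  set τ := 1 / (3 * κ) with hτ
  set η := 1 / (3 * ℓ) with hη
  have hτ0 : 0 < τ := by positivity
  have hη0 : 0 < η := by positivity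
  let q1 : ℝ → ℝ := (Icc 0 τ).indicator fun _ => κ
  let q2 : ℝ → ℝ := (Icc 0 ℓ).indicator fun _ => η
  let q3 : ℝ → ℝ := (Ioi ℓ).indicator fun t => C2 * t ^ (-θ)
  have h1 : ∀ t, 0 ≤ q1 t := fun t => indicator_nonneg (fun _ _ => hκ.le) t
  have h2 : ∀ t, 0 ≤ q2 t := fun t => indicator_nonneg (fun _ _ => hη0.le) t
  have h3 : ∀ t, 0 ≤ q3 t := fun t => indicator_nonneg (fun s hs => by
    have : 0 < s := hℓ0.trans hs
    positivity) t
  have i1 : Integrable q1 := by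
    refine IntegrableOn.integrable_indicator ?_ measurableSet_Icc
    exact integrableOn_const (by simp)
  have i2 : Integrable q2 := by
    refine IntegrableOn.integrable_indicator ?_ measurableSet_Icc
    exact integrableOn_const (by simp)
  have i3 : Integrable q3 := by
    refine IntegrableOn.integrable_indicator ?_ measurableSet_Ioi
    exact (integrableOn_Ioi_rpow_of_lt (by linarith) hℓ0).const_mul _
  have I1 : ∫ t, q1 t = 1 / 3 := by
    simp only [q1]
    rw [integral_indicator measurableSet_Icc, setIntegral_const]
    rw [Real.volume_real_Icc_of_le hτ0.le, smul_eq_mul, hτ]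
    field_simp
    ring
  have I2 : ∫ t, q2 t = 1 / 3 := by
    simp only [q2]
    rw [integral_indicator measurableSet_Icc, setIntegral_const]
    rw [Real.volume_real_Icc_of_le hℓ0.le, smul_eq_mul, hη]
    field_simp
    ring
  have I3 : ∫ t, q3 t ≤ 1 / 3 := by
    simp only [q3]
    rw [integral_indicator measurableSet_Ioi, integral_const_mul,
      integral_Ioi_rpow_of_lt (by linarith) hℓ0]
    convert hℓ using 2
    rw [show -θ + 1 = -(θ - 1) by ring, neg_div_neg_eq]
  have hq0 : ∀ t, 0 ≤ q1 t + q2 t + q3 t := fun t => by linarith [h1 t, h2 t, h3 t]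
  refine ⟨τ, η, κ + η + C2, fun t => q1 t + q2 t + q3 t, hτ0, hη0, ?_, hq0, fun t => ?_,
    fun t ht => ?_, fun t ht => ?_⟩
  · refine ((measurable_const.indicator measurableSet_Icc).add
      (measurable_const.indicator measurableSet_Icc)).add (Measurable.indicator ?_ measurableSet_Ioi)
    exact (measurable_id.pow_const _).const_mul _
  · refine add_le_add (add_le_add ?_ ?_) ?_
    · exact indicator_le' (f := fun _ => κ) (g := fun _ => κ) (fun _ _ => le_rfl)
        (fun _ _ => hκ.le) t
    · exact indicator_le' (f := fun _ => η) (g := fun _ => η) (fun _ _ => le_rfl)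
        (fun _ _ => hη0.le) t
    · refine indicator_le' (f := fun t => C2 * t ^ (-θ)) (g := fun _ => C2) (fun s hs => ?_)
        (fun _ _ => hC2p.le) t
      have hs : ℓ < s := hs
      exact mul_le_of_le_one_right hC2p.le
        (Real.rpow_le_one_of_one_le_of_nonpos (by linarith) (by linarith))
  · rw [intervalIntegral.integral_of_le ht]
    refine (setIntegral_le_integral ((i1.add i2).add i3) (ae_of_all _ hq0)).trans ?_
    rw [integral_add' (i1.add i2) i3, integral_add' i1 i2, I1, I2]
    linarith
  · by_cases ht1 : t ≤ τ
    · left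
      have : q1 t = κ := indicator_of_mem (show t ∈ Icc 0 τ from ⟨ht, ht1⟩) _
      linarith [h2 t, h3 t]
    by_cases ht2 : t ≤ ℓ
    · right; left
      have : q2 t = η := indicator_of_mem (show t ∈ Icc 0 ℓ from ⟨ht, ht2⟩) _
      exact ⟨(not_le.1 ht1).le, by linarith [h1 t, h3 t]⟩
    · right; right
      rw [not_le] at ht2
      have : q3 t = C2 * t ^ (-θ) := indicator_of_mem (show t ∈ Ioi ℓ from ht2) _
      refine ⟨by linarith, ?_⟩
      have hle : (t - 1) ^ (-θ) ≤ 2 ^ θ * t ^ (-θ) := by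
        calc (t - 1) ^ (-θ) ≤ (t / 2) ^ (-θ) :=
              Real.rpow_le_rpow_of_nonpos (by linarith) (by linarith) (by linarith)
          _ = 2 ^ θ * t ^ (-θ) := by
              rw [Real.div_rpow (by linarith) zero_le_two, Real.rpow_neg zero_le_two, div_inv_eq_mul,
                mul_comm]
      have := mul_le_mul_of_nonneg_left hle hC.le
      rw [← mul_assoc, ← hC2] at this
      linarith [h1 t, h2 t]

namespace UnitSolution

variable {M : ℝ} {φ : ℝ → Plane → ℝ}

lemma eLpNorm_le_of_integral_pow_le (h : UnitSolution D v M φ₀ φ) {n : ℕ} (hn : 1 ≤ n) {B t : ℝ}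
    (hB : ∫ x, φ t x ^ n ∂D.measure ≤ B) :
    eLpNorm (φ t) n D.measure ≤ ENNReal.ofReal (B ^ (1 / (n:ℝ))) := by
  have hn0 : (n : ℝ≥0∞) ≠ 0 := by exact_mod_cast (by omega : n ≠ 0)
  have hmeas := (h.measurable_apply t)
  have hi : Integrable (fun x => φ t x ^ n) D.measure := by
    have h1 : Integrable (φ t) D.measure :=
      ⟨hmeas.aestronglyMeasurable, (h.mass t).trans_lt ENNReal.ofReal_lt_top⟩
    refine h1.mono' (hmeas.pow_const n).aestronglyMeasurable (ae_of_all _ fun x => ?_)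
    rw [Real.norm_eq_abs, abs_of_nonneg (pow_nonneg (h.mem t x).1 _)]
    exact pow_le_of_le_one (h.mem t x).1 (h.mem t x).2 (by omega)
  have hB0 : 0 ≤ B := (integral_nonneg fun x => pow_nonneg (h.mem t x).1 n).trans hB
  rw [eLpNorm_eq_lintegral_rpow_enorm_toReal hn0 (by simp), ENNReal.toReal_natCast,
    ← ENNReal.ofReal_rpow_of_nonneg hB0 (by positivity)]
  refine ENNReal.rpow_le_rpow ?_ (by positivity)
  refine le_trans (le_of_eq ?_) (ENNReal.ofReal_le_ofReal hB)
  rw [ofReal_integral_eq_lintegral_ofReal hi (ae_of_all _ fun x => pow_nonneg (h.mem t x).1 n)]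
  refine lintegral_congr fun x => ?_
  rw [Real.enorm_eq_ofReal_abs, abs_of_nonneg (h.mem t x).1, ENNReal.rpow_natCast,
    ENNReal.ofReal_pow (h.mem t x).1]

/-- Decay of the supremum from the decay of an integral norm. -/
lemma eLpNorm_top_le_of_integral_pow_le (h : UnitSolution D v M φ₀ φ) (hv : IsField K L v)
    (hM : 1 ≤ M) {n : ℕ} (hn : 1 ≤ n) (hop : solutionOperatorNorm D v n ⊤ 1 ≤ 1) {t B : ℝ}
    (ht : 1 ≤ t) (hB0 : 0 < B) (hB : ∫ x, φ (t - 1) x ^ n ∂D.measure ≤ B) :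
    eLpNorm (φ t) ⊤ D.measure ≤ ENNReal.ofReal (B ^ (1 / (n:ℝ))) := by
  have h1 := (h.shift hv (r := t - 1) (by linarith)).eLpNorm_top_le hM hn
    (b := B ^ (1 / (n:ℝ))) (by positivity) (h.eLpNorm_le_of_integral_pow_le hn hB) 1
  rw [sub_add_cancel] at h1
  exact h1.trans (mul_le_of_le_one_right' hop)

end UnitSolution

lemma Domain.one_lt_criticalExponent (D : Domain) : 1 < D.criticalExponent := by
  cases D <;> norm_num [Domain.criticalExponent]

/-- With p = 2k - 1 the quantity equals (α - 1)/(d - 1) · (p - 1)/p, where d is the critical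
exponent. The first factor exceeds one and the second tends to one as k grows. -/
lemma Domain.exists_one_lt_div_rate (D : Domain) {α : ℝ} (hα : D.criticalExponent < α) :
    ∃ k : ℕ, 2 ≤ k ∧ 1 < (α - 1) * (1 / D.rate k * (1 / ((2 * k - 1 : ℕ) : ℝ))) := by
  have hd := D.one_lt_criticalExponent
  obtain ⟨m, hm⟩ := exists_nat_gt ((D.criticalExponent - 1) / (α - D.criticalExponent))
  rw [div_lt_iff₀ (by linarith)] at hm
  refine ⟨m + 2, by omega, ?_⟩
  have hp : ((2 * (m + 2) - 1 : ℕ) : ℝ) = 2 * m + 3 := by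
    rw [show 2 * (m + 2) - 1 = 2 * m + 3 by omega]; push_cast; ring
  rw [hp, Domain.rate]
  have hm0 : (0:ℝ) ≤ m := Nat.cast_nonneg m
  have : (α - 1) * (1 / ((D.criticalExponent - 1) / (2 * ((m + 2 : ℕ) : ℝ) - 2)) * (1 / (2 * m + 3)))
      = (α - 1) * (2 * m + 2) / ((D.criticalExponent - 1) * (2 * m + 3)) := by
    have : 0 < D.criticalExponent - 1 := by linarith
    have : (0:ℝ) < 2 * m + 2 := by linarith
    push_cast
    rw [show 2 * ((m:ℝ) + 2) - 2 = 2 * m + 2 by ring]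
    field_simp
  rw [this, one_lt_div (mul_pos (by linarith) (by linarith))]
  nlinarith

lemma Domain.measure_absolutelyContinuous (D : Domain) : D.measure ≪ volume := by
  cases D
  · exact Measure.AbsolutelyContinuous.rfl
  · exact Measure.restrict_le_self.absolutelyContinuous

/-- Dissipation-enhancing flows quench reactions of ignition or weak type. -/
theorem tendsto_eLpNorm_top (hu : IsFlow D u) {f : ℝ → ℝ} (hf_zero : f 0 = 0)
    (hf_lip : ∃ K : ℝ≥0, LipschitzOnWith K f (Icc 0 1)) {c α : ℝ} (hc : 0 < c)
    (hα : D.criticalExponent < α) (hf_le : ∀ s ∈ Icc (0 : ℝ) 1, f s ≤ c * s ^ α)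
    (hdiss : DissipationEnhancing D u) (M : ℝ) :
    ∃ A₀ : ℝ, ∀ A : ℝ, A₀ < A → ∀ T₀ : Plane → ℝ, D.IsFun T₀ → Measurable T₀ →
      (∀ x, T₀ x ∈ Icc (0 : ℝ) 1) → eLpNorm T₀ 1 D.measure ≤ ENNReal.ofReal M →
      ∀ T : ℝ → Plane → ℝ, IsReactionSolution D (fun x => A • u x) f T₀ T →
        Tendsto (fun t : ℝ => eLpNorm (T t) ⊤ D.measure) atTop (𝓝 0) := by
  have hα1 : 1 < α := D.one_lt_criticalExponent.trans hα
  obtain ⟨kf, hkf⟩ := hf_lip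
  obtain ⟨k, hk, hθ⟩ := D.exists_one_lt_div_rate hα
  obtain ⟨KL, LL, hfield⟩ := hu.exists_isField
  set n : ℕ := 2 * k - 1 with hn
  have hn1 : 1 ≤ n := by omega
  have hn0 : (0:ℝ) < n := by exact_mod_cast hn1
  have hrate := D.rate_pos hk
  set M₁ := max M 1 with hM₁
  have hM1 : 1 ≤ M₁ := le_max_right _ _
  obtain ⟨Q, hQ, hdecay⟩ := exists_integral_pow_decay D hk hM1
  set σ := 1 / D.rate k * (1 / (n:ℝ)) with hσ
  have hσ0 : 0 < σ := by positivity
  set κ := 2 ^ α * c with hκ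
  have hκ0 : 0 < κ := by positivity
  -- The weight depends on f, the domain and M only, because `Q` is uniform in the flow. The
  -- amplitude can therefore be chosen afterwards. The exponent is θ = (α - 1) σ.
  obtain ⟨τ, η, b, q, hτ, hη, hqm, hq0, hqb, hq1, hqt⟩ := exists_time_weight hκ0
    (C := κ * (Q ^ (1 / (n:ℝ))) ^ (α - 1)) (by positivity) hθ
  -- The sup bound on the middle range for which κ ε^(α-1) is exactly η.
  set ε := (η / κ) ^ (1 / (α - 1)) with hε
  have hε0 : 0 < ε := by positivity
  -- Only two operator norms enter: L¹ → L^∞ at time τ, for smallness on the middle range, and L^n →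
  -- L^∞ at time 1, which converts integral decay into sup decay.
  have hev : ∀ᶠ A : ℝ in atTop,
      solutionOperatorNorm D (fun x => A • u x) 1 ⊤ τ ≤ ENNReal.ofReal (ε / M₁) ∧
      solutionOperatorNorm D (fun x => A • u x) n ⊤ 1 ≤ 1 :=
    ((hdiss 1 ⊤ le_rfl (by simp) τ hτ).eventually_le_const
        (ENNReal.ofReal_pos.2 (by positivity))).and
      ((hdiss n ⊤ (by exact_mod_cast hn1) (by simp) 1 one_pos).eventually_le_const one_pos)
  obtain ⟨A₀, hA₀⟩ := eventually_atTop.1 hev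
  refine ⟨A₀, fun A hA T₀ hT₀f hT₀m hT₀ hT₀M T hT => ?_⟩
  obtain ⟨hop1, hopn⟩ := hA₀ A hA.le
  have hv := hfield A
  have hvf : D.IsFun fun x => A • u x := hu.isFun.comp fun w => A • w
  rw [eLpNorm_one_eq_lintegral_enorm] at hT₀M
  have hT₀M₁ := hT₀M.trans (ENNReal.ofReal_le_ofReal (le_max_left M 1))
  obtain ⟨φ, hφ⟩ := exists_unitSolution hv hvf hT₀m hT₀f hT₀ (by linarith) hT₀M₁
  have hsup : ∀ t, 2 ≤ t → eLpNorm (φ t) ⊤ D.measure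
      ≤ ENNReal.ofReal (Q ^ (1 / (n:ℝ)) * (t - 1) ^ (-σ)) := fun t ht => by
    have ht1 : 0 < t - 1 := by linarith
    have h1 := hφ.eLpNorm_top_le_of_integral_pow_le hv hM1 hn1 hopn (t := t) (by linarith)
      (B := Q * (t - 1) ^ (-(1 / D.rate k))) (by positivity)
      (hdecay (hφ.wsol (t - 1)) hv hvf hφ.weakSolution.isFun (fun t x => (hφ.mem t x).1) hφ.mass
        (t - 1) ⟨by linarith, le_rfl⟩)
    rwa [Real.mul_rpow hQ.le (by positivity), ← Real.rpow_mul ht1.le, neg_mul] at h1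
  have hearly : ∀ᵐ x, φ τ x ≤ ε := by
    refine ae_le_of_eLpNorm_top_le (hφ.weakSolution.isFun τ) hε0.le ?_
    have h1 := hφ.eLpNorm_top_le hM1 le_rfl (b := M₁) (by linarith)
      (eLpNorm_le_of_mem_Icc hT₀ hM1 hT₀M₁ le_rfl) τ
    rw [Nat.cast_one] at h1
    refine (h1.trans (mul_le_mul' le_rfl hop1)).trans ?_
    rw [← ENNReal.ofReal_mul (by linarith), mul_div_cancel₀ _ (by linarith)]
  -- The three regimes: φ ≤ 1 at early times, φ ≤ ε from time τ on because the supremum does not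
  -- increase, and the algebraic decay for late times.
  have hqφ : ∀ t, 0 ≤ t → ∀ᵐ x, 2 ^ α * c * φ t x ^ (α - 1) ≤ q t := by
    have hmono : ∀ {t x a}, φ t x ≤ a → 2 ^ α * c * φ t x ^ (α - 1) ≤ κ * a ^ (α - 1) :=
      fun {t x a} hx => mul_le_mul_of_nonneg_left
        (Real.rpow_le_rpow (hφ.mem t x).1 hx (by linarith)) hκ0.le
    intro t ht
    rcases hqt t ht with h | ⟨h1, h2⟩ | ⟨h1, h2⟩
    · refine ae_of_all _ fun x => (hmono (hφ.mem t x).2).trans ?_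
      rwa [Real.one_rpow, mul_one]
    · filter_upwards [hφ.ae_le hv hτ.le h1 hearly hε0.le] with x hx
      refine (hmono hx).trans (le_trans (le_of_eq ?_) h2)
      rw [hε, ← Real.rpow_mul (by positivity), one_div_mul_cancel (by linarith), Real.rpow_one,
        mul_div_cancel₀ _ hκ0.ne']
    · have ht1 : 0 < t - 1 := by linarith
      filter_upwards [ae_le_of_eLpNorm_top_le (hφ.weakSolution.isFun t) (by positivity)
        (hsup t h1)] with x hx
      refine (hmono hx).trans (le_trans (le_of_eq ?_) h2)
      rw [Real.mul_rpow (by positivity) (by positivity), ← Real.rpow_mul ht1.le, neg_mul,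
        mul_comm σ, ← mul_assoc]
  have hle : ∀ t, 2 ≤ t → eLpNorm (T t) ⊤ D.measure
      ≤ ENNReal.ofReal (2 * (Q ^ (1 / (n:ℝ)) * (t - 1) ^ (-σ))) := fun t ht => by
    have h1 := hT.ae_le_two_mul hv hφ hf_zero hkf hα1 hf_le hqm hq0 hqb hq1 hqφ hc
      (t := t) (by linarith)
    rw [ENNReal.ofReal_mul zero_le_two]
    have h2 : ∀ᵐ x ∂D.measure, T t x ≤ 2 * φ t x := D.measure_absolutelyContinuous.ae_le h1
    refine (eLpNorm_le_mul_eLpNorm_of_ae_le_mul (h2.mono fun x hx => ?_) ⊤).trans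
      (mul_le_mul' le_rfl (hsup t ht))
    rwa [Real.norm_eq_abs, Real.norm_eq_abs, abs_of_nonneg (hT.mem_Icc t (by linarith) x).1,
      abs_of_nonneg (hφ.mem t x).1]
  have hlim : Tendsto (fun t : ℝ => ENNReal.ofReal (2 * (Q ^ (1 / (n:ℝ)) * (t - 1) ^ (-σ))))
      atTop (𝓝 0) := by
    have h1 : Tendsto (fun t : ℝ => t - 1) atTop atTop :=
      tendsto_atTop_add_const_right _ (-1) tendsto_id
    have h2 := (((tendsto_rpow_neg_atTop hσ0).comp h1).const_mul (Q ^ (1 / (n:ℝ)))).const_mul 2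
    rw [mul_zero, mul_zero] at h2
    simpa using ENNReal.tendsto_ofReal h2
  exact tendsto_of_tendsto_of_tendsto_of_le_of_le' tendsto_const_nhds hlim
    (Eventually.of_forall fun _ => zero_le) ((eventually_ge_atTop 2).mono hle)

end

end FlowQuenching

end

theorem theorem6p3 (D : FlowQuenching.Domain)
    (u : FlowQuenching.Plane → FlowQuenching.Plane) (hu : FlowQuenching.IsFlow D u)
    (f : ℝ → ℝ) (hf_zero : f 0 = 0) (hf_one : f 1 = 0)
    (hf_lip : ∃ K : NNReal, LipschitzOnWith K f (Set.Icc 0 1))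
    (c α : ℝ) (hc : 0 < c) (hα : D.criticalExponent < α)
    (hf_le : ∀ s ∈ Set.Icc (0 : ℝ) 1, f s ≤ c * s ^ α)
    (hdiss : FlowQuenching.DissipationEnhancing D u) :
    ∀ M : ℝ, ∃ A₀ : ℝ, ∀ A : ℝ, A₀ < A →
      ∀ T₀ : FlowQuenching.Plane → ℝ, D.IsFun T₀ → Measurable T₀ →
        (∀ x, T₀ x ∈ Set.Icc (0 : ℝ) 1) →
        MeasureTheory.eLpNorm T₀ 1 D.measure ≤ ENNReal.ofReal M →
        ∀ T : ℝ → FlowQuenching.Plane → ℝ,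
          FlowQuenching.IsReactionSolution D (fun x => A • u x) f T₀ T →
          Filter.Tendsto (fun t : ℝ => MeasureTheory.eLpNorm (T t) ⊤ D.measure)
            Filter.atTop (nhds 0) :=
  FlowQuenching.tendsto_eLpNorm_top hu hf_zero hf_lip hc hα hf_le hdiss
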